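/- **Setting.** Let $n,p\ge 1$. Agent $i\in\{1,\dots,n\}$ has a data distribution $\mathcal D_i$ and a stochastic cost $F_i:\mathbb R^p\times\Xi_i\to\mathbb R$; put $f_i(x)=\mathbb E_{\xi\sim\mathcal D_i}F_i(x,\xi)$, $f=\frac1n\sum_{i=1}^n f_i$, $f_i^*=\inf f_i$, $f^*=\inf f$. Assume: 1. $f^*>-\infty$ and $f$ satisfies the Polyak–Łojasiewicz condition $\frac12\|\nabla f(x)\|^2\ge\nu(f(x)-f^*)$ for all $x$, with some $\nu>0$; 2. $f_i^*>-\infty$ for every $i$; 3. the agents communicate over an undirected connected weighted graph with Laplacian $L$; 4. the (possibly random) compressor $\mathcal C:\mathbb R^p\to\mathbb R^p$ satisfies $\mathbb E\|\mathcal C(x)/r-x\|^2\le(1-\delta)\|x\|^2$ for all $x$, where $\delta\in(0,1]$, $r>0$; 5. for almost every $\xi$, $F_i(\cdot,\xi)$ is differentiable with $\ell$-Lipschitz gradient, where $\ell>0$; 6. $\mathbb E_{\xi}\|\nabla_xF_i(x,\xi)-\nabla f_i(x)\|^2\le\eta_1^2\|\nabla f_i(x)\|^2+\sigma_1^2$ for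 all $i,x$. **Algorithm.** Start from $x_{i,0}\in\mathbb R^p$ and $v_{i,0}=y_{i,0}=z_{i,0}=0$. At iteration $k=0,1,\dots$ set $q_{i,k}=\mathcal C(x_{i,k}-y_{i,k})$, draw $\xi_{i,k}\sim\mathcal D_i$ and $\zeta_{i,k}$ uniformly from the unit sphere of $\mathbb R^p$ (all draws independent, and independent of the randomness of the compressor, which is independent across iterations), set $g^z_{i,k}=\frac{p\,(F_i(x_{i,k}+\mu_{i,k}\zeta_{i,k},\xi_{i,k})-F_i(x_{i,k},\xi_{i,k}))}{\mu_{i,k}}\zeta_{i,k}$, and update $$y_{i,k+1}=y_{i,k}+\omega q_{i,k},\qquad z_{i,k+1}=z_{i,k}+\omega\sum_jL_{ij}q_{j,k},$$ $$x_{i,k+1}=x_{i,k}-\alpha_k\beta_k\Big(z_{i,k}+\sum_jL_{ij}q_{j,k}\Big)-\alpha_k(\gamma_kv_{i,k}+g^z_{i,k}),\qquad v_{i,k+1}=v_{i,k}+\alpha_k\gamma_k\Big(z_{i,k}+\sum_jL_{ij}q_{j,k}\Big).$$ Let $\bar x_k=\frac1n\sum_ix_{i,k}$. **Theorem.** There are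 positive thresholds $\kappa_1$, $\kappa_2(\epsilon_1)$, $\kappa_T(\epsilon_1,\epsilon_2,\theta)$, none of which depends on $\nu$, such that the following holds whenever $$\alpha_k=\frac1{(T+1)^\theta},\quad \gamma_k=\frac{\epsilon_2}{\alpha_k},\quad \beta_k=\epsilon_1\gamma_k,\quad \theta\in(0.5,1),\quad 0<\mu_{i,k}\le\frac{\kappa_\mu\sqrt{p\alpha_k}}{\sqrt{n+p}},\quad 0<\omega\le\frac1r,$$ $$\epsilon_1>\kappa_1,\quad \epsilon_2\in(0,\kappa_2(\epsilon_1)),\quad \kappa_\mu>0,\quad T\ge\kappa_T(\epsilon_1,\epsilon_2,\theta):$$ $$\mathbb E\Big[\frac1n\sum_{i=1}^n\|x_{i,T}-\bar x_T\|^2\Big]\le C_0\,\frac p{T^{2\theta}},\qquad \mathbb E[f(\bar x_T)-f^*]\le C_1\,\frac p{nT^\theta}+C_2\,\frac p{T^{2\theta}}.$$ The constants depend only on the following quantities. Let $[\underline\rho,\bar\rho]$, $\underline\rho>0$, be an interval that contains the nonzero eigenvalues of $L$, let $D$ be an upper bound for $f^*-\frac1n\sum_if_i^*$, and let $\Delta_0,R_0$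 be upper bounds for $f(\bar x_0)-f^*$ and $\frac1n\sum_i\|x_{i,0}\|^2$. Then $\kappa_1$ depends only on $\underline\rho$; $\kappa_2$ only on $\epsilon_1,\underline\rho,\bar\rho,\delta,r,\omega,\ell$; $\kappa_T$ only on $\epsilon_1,\epsilon_2,\theta,\underline\rho,\bar\rho,\delta,r,\omega,\ell,\eta_1,\sigma_1,D,\kappa_\mu,n,p$. The constant $C_1$ of the leading term depends only on $\ell,\eta_1,\sigma_1,D,\Delta_0,R_0,\kappa_\mu,\theta,\nu$, so it is independent of $n$, $p$, $T$, the network and the compressor. $C_0$ and $C_2$ depend only on these quantities and on $\underline\rho,\bar\rho,\delta,r,\omega,\epsilon_1,\epsilon_2$, so they are independent of $p$ and $T$, and depend on $n$ and the network only through $\underline\rho,\bar\rho$. -/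

import Mathlib

open MeasureTheory ProbabilityTheory

universe u v w

noncomputable section

/-- The decision space `ℝ^p` with its Euclidean norm. -/
abbrev Vec (p : ℕ) : Type := EuclideanSpace ℝ (Fin p)

/-- The uniform probability distribution on the unit sphere of `ℝ^p`, as a measure on `ℝ^p`
(normalised surface measure; meaningful for `p ≥ 1`). -/
def unifSphere (p : ℕ) : Measure (Vec p) :=
  Measure.map Subtype.val
    (((volume : Measure (Vec p)).toSphere Set.univ)⁻¹ • (volume : Measure (Vec p)).toSphere)

/-- The average of `n` vectors. -/
def meanVec {n p : ℕ} (x : Fin n → Vec p) : Vec p := (n : ℝ)⁻¹ • ∑ i, x i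

/-! ### Communication network -/

/-- An undirected weighted graph on `n` agents, given by its weighted adjacency matrix. -/
structure WeightedGraph (n : ℕ) where
  /-- the weights; there is an edge between `i` and `j` exactly if `0 < A i j` -/
  A : Matrix (Fin n) (Fin n) ℝ
  nonneg : ∀ i j, 0 ≤ A i j
  symm : ∀ i j, A i j = A j i

namespace WeightedGraph

variable {n : ℕ} (G : WeightedGraph n)

/-- The underlying simple graph. -/
def graph : SimpleGraph (Fin n) := SimpleGraph.fromRel fun i j => 0 < G.A i j

/-- The graph is connected. -/
def Connected : Prop := G.graph.Connected

/-- The Laplacian: row sums on the diagonal, minus the adjacency matrix. -/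
def laplacian : Matrix (Fin n) (Fin n) ℝ :=
  Matrix.diagonal (fun i => ∑ j, G.A i j) - G.A

end WeightedGraph

/-! ### Stochastic optimisation problem -/

/-- `n` agents, each with a sample space, a data distribution and a stochastic cost function on
`ℝ^p`, measurable and with a finite mean at every point. -/
structure StochasticProblem (n p : ℕ) where
  /-- the sample space of each agent -/
  Ξ : Fin n → Type u
  [measurableSpace : ∀ i, MeasurableSpace (Ξ i)]
  /-- the data distribution of each agent -/
  D : ∀ i, Measure (Ξ i)
  [isProbabilityMeasure : ∀ i, IsProbabilityMeasure (D i)]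
  /-- the stochastic cost functions -/
  F : ∀ i, Vec p → Ξ i → ℝ
  measurable_F : ∀ i, Measurable (Function.uncurry (F i))
  integrable_F : ∀ i x, Integrable (F i x) (D i)

attribute [instance] StochasticProblem.measurableSpace
attribute [instance] StochasticProblem.isProbabilityMeasure

namespace StochasticProblem

variable {n p : ℕ} (P : StochasticProblem.{u} n p)

/-- Local cost `f_i(x) = 𝔼 F_i(x, ξ_i)`. -/
def localCost (i : Fin n) (x : Vec p) : ℝ := ∫ ξ, P.F i x ξ ∂(P.D i)

/-- Global cost `f = (1/n) ∑ f_i`. -/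
def cost (x : Vec p) : ℝ := (n : ℝ)⁻¹ * ∑ i, P.localCost i x

/-- `f_i^* = inf f_i`. -/
def localInf (i : Fin n) : ℝ := ⨅ x, P.localCost i x

/-- `f^* = inf f`. -/
def costInf : ℝ := ⨅ x, P.cost x

/-- Every local cost is bounded from below. -/
def LowerBounded : Prop := ∀ i, BddBelow (Set.range (P.localCost i))

/-- For almost every sample, the stochastic cost is `ℓ`-smooth: differentiable with an
`ℓ`-Lipschitz gradient. -/
def Smooth (ℓ : ℝ) : Prop :=
  ∀ i, ∀ᵐ ξ ∂(P.D i), Differentiable ℝ (fun x => P.F i x ξ) ∧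
    ∀ x y, ‖gradient (fun x' => P.F i x' ξ) x - gradient (fun x' => P.F i x' ξ) y‖ ≤ ℓ * ‖x - y‖

/-- Bounded state-dependent variance of the stochastic gradients. -/
def BoundedVariance (η₁ σ₁ : ℝ) : Prop :=
  ∀ i x,
    Integrable (fun ξ => ‖gradient (fun x' => P.F i x' ξ) x - gradient (P.localCost i) x‖ ^ 2)
      (P.D i) ∧
    ∫ ξ, ‖gradient (fun x' => P.F i x' ξ) x - gradient (P.localCost i) x‖ ^ 2 ∂(P.D i)
      ≤ η₁ ^ 2 * ‖gradient (P.localCost i) x‖ ^ 2 + σ₁ ^ 2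

/-- Polyak–Łojasiewicz condition with constant `ν` for the global cost. -/
def PolyakLojasiewicz (ν : ℝ) : Prop :=
  BddBelow (Set.range P.cost) ∧
    ∀ x, ν * (P.cost x - P.costInf) ≤ (1 / 2) * ‖gradient P.cost x‖ ^ 2

end StochasticProblem

/-! ### Compressor -/

/-- A possibly random map `ℝ^p → ℝ^p`: a measurable map of the input and of a random seed. -/
structure RandomMap (p : ℕ) where
  /-- the space of seeds -/
  S : Type v
  [measurableSpace : MeasurableSpace S]
  /-- the law of the seed -/
  law : Measure S
  [isProbabilityMeasure : IsProbabilityMeasure law]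
  /-- the map -/
  C : Vec p → S → Vec p
  measurable_C : Measurable (Function.uncurry C)

attribute [instance] RandomMap.measurableSpace
attribute [instance] RandomMap.isProbabilityMeasure

/-- Bounded relative compression error: `𝔼 ‖C(x)/r - x‖² ≤ (1 - δ) ‖x‖²` for all `x`. -/
def RandomMap.IsCompressor {p : ℕ} (K : RandomMap.{v} p) (δ r : ℝ) : Prop :=
  ∀ x, Integrable (fun s => ‖r⁻¹ • K.C x s - x‖ ^ 2) K.law ∧
    ∫ s, ‖r⁻¹ • K.C x s - x‖ ^ 2 ∂K.law ≤ (1 - δ) * ‖x‖ ^ 2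

/-! ### The algorithm -/

section Algorithm

variable {n p : ℕ}

/-- The randomness of one iteration: data samples, directions and compressor seeds of all
agents. -/
abbrev Noise (P : StochasticProblem.{u} n p) (K : RandomMap.{v} p) : Type (max u v) :=
  (∀ i, P.Ξ i) × (Fin n → Vec p) × (Fin n → K.S)

/-- The variables of all agents. -/
structure AgentState (n p : ℕ) where
  /-- primal variables -/
  x : Fin n → Vec p
  /-- dual variables -/
  v : Fin n → Vec p
  /-- auxiliary variables for compression -/
  y : Fin n → Vec p
  /-- auxiliary variables for communication -/
  z : Fin n → Vec p

/-- The algorithm's parameters: step sizes `α k, β k, γ k`, exploration parameters `μ i k` and the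
compression gain `ω`. -/
structure AlgParams (n : ℕ) where
  α : ℕ → ℝ
  β : ℕ → ℝ
  γ : ℕ → ℝ
  μ : Fin n → ℕ → ℝ
  ω : ℝ

/-- Two-point zeroth-order gradient estimator. -/
def zoGradient (P : StochasticProblem.{u} n p) (i : Fin n) (μ : ℝ) (x : Vec p) (ξ : P.Ξ i)
    (ζ : Vec p) : Vec p :=
  ((p : ℝ) * (P.F i (x + μ • ζ) ξ - P.F i x ξ) / μ) • ζ

/-- One iteration (iteration number `k`) of the algorithm. -/
def algStep (G : WeightedGraph n) (P : StochasticProblem.{u} n p) (K : RandomMap.{v} p)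
    (a : AlgParams n) (k : ℕ) (N : Noise P K) (s : AgentState n p) : AgentState n p :=
  let q : Fin n → Vec p := fun i => K.C (s.x i - s.y i) (N.2.2 i)
  let Lq : Fin n → Vec p := fun i => ∑ j, G.laplacian i j • q j
  let g : Fin n → Vec p := fun i => zoGradient P i (a.μ i k) (s.x i) (N.1 i) (N.2.1 i)
  { x := fun i => s.x i - (a.α k * a.β k) • (s.z i + Lq i) - a.α k • (a.γ k • s.v i + g i)
    v := fun i => s.v i + (a.α k * a.γ k) • (s.z i + Lq i)
    y := fun i => s.y i + a.ω • q i
    z := fun i => s.z i + a.ω • Lq i }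

/-- The state after `k` iterations, started at `x₀` with all other variables equal to zero. -/
def algState (G : WeightedGraph n) (P : StochasticProblem.{u} n p) (K : RandomMap.{v} p)
    (a : AlgParams n) (x₀ : Fin n → Vec p) (N : ℕ → Noise P K) : ℕ → AgentState n p
  | 0 => { x := x₀, v := 0, y := 0, z := 0 }
  | k + 1 => algStep G P K a k (N k) (algState G P K a x₀ N k)

/-- `N k` is the randomness of iteration `k`. Different iterations are independent; within an
iteration, the data samples `ξ_i ∼ D_i`, the directions `ζ_i`, uniform on the sphere, and the
compressor seeds are independent, over all agents. Each seed has the law prescribed by the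
compressor; the seeds that different agents use in one iteration may depend on each other (in
particular, they may be independent). -/
def IsNoise (P : StochasticProblem.{u} n p) (K : RandomMap.{v} p) {Ω : Type w}
    [MeasurableSpace Ω] (Q : Measure Ω) (N : ℕ → Ω → Noise P K) : Prop :=
  (∀ k, Measurable (N k)) ∧ iIndepFun N Q ∧
    ∀ k, ∃ seeds : Measure (Fin n → K.S), IsProbabilityMeasure seeds ∧
      (∀ i, seeds.map (fun s => s i) = K.law) ∧
      Q.map (N k) =
        (Measure.pi P.D).prod ((Measure.pi fun _ : Fin n => unifSphere p).prod seeds)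

end Algorithm

/-! ### Constants on which thresholds and bounds may depend -/

/-- Constants of the cost functions: smoothness `ℓ`, variance `η₁, σ₁`, and a bound `gap` for
`f^* - (1/n) ∑ f_i^*`. -/
structure CostConstants where
  ℓ : ℝ
  η₁ : ℝ
  σ₁ : ℝ
  gap : ℝ

/-- Constants of the communication: bounds `lo, hi` for the nonzero Laplacian eigenvalues, the
compressor's `δ, r`, and the compression gain `ω`. -/
structure CommConstants where
  lo : ℝ
  hi : ℝ
  δ : ℝ
  r : ℝ
  ω : ℝ

/-- Constants of the initial point: bounds for `f(x̄₀) - f^*` and for `(1/n) ∑ ‖x_{i,0}‖²`. -/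
structure InitConstants where
  gap : ℝ
  sqNorm : ℝ

end

/-!
The proof separates the two time scales of the iteration. With the prescribed parameters
`α γ = ε₂` and `α β = ε₁ ε₂` do not depend on the horizon, so the part of the iteration that
concerns communication is a fixed linear primal-dual system for the deviations from the average,
perturbed by the gradient step, which has the small size `α = (T + 1) ^ (-θ)`. Along the trajectory
`z = L y` and the dual variables sum to zero (`AgentState.Consistent`), hence
`z + L q = L (x + e)` with the compression error `e`, whose second moment is at most a multiple of
`‖x - y‖²`.

*Consensus.* The Lyapunov function `energy` is the sum of `⟪x, L x⟫ / 2 + ‖v‖² / 2`, of a cross term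
`η ⟪x, v⟫` that makes it decrease in the direction of the dual variable too, and of the distance
`‖x - y‖²` to the compressed copies, which the compressor contracts. The products `h ⟪v, L x⟫` that
the primal and the dual step produce cancel, the choice of `η` lets the decrease absorb the
indefinite terms that the cross term adds, and what remains is of second order in `h = ε₂` or
quadratic in the perturbations (`energy_step`). For small `ε₂` the expected energy therefore
contracts by a constant factor, up to `O(α²)` times the second moment of the gradient estimators
(`integral_stateEnergy_algStep_le`). That second moment is of the order `p`, and bounded in terms of
the optimality gap and the consensus error.

*Descent.* The average of the agents follows a stochastic gradient method for the global cost. Its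
estimator has a bias of at most `ℓ μ`, without a factor `p`: comparing a direction with its mirror
image shows that a Lipschitz function on the sphere correlates only weakly with a coordinate
(`abs_integral_mul_inner_le_of_lipschitz`). Its variance is divided by `n`, since the agents sample
independently. With the Polyak–Łojasiewicz condition this gives `integral_cost_algStep_le`: the gap
contracts by `1 - α ν`, up to a variance term of the order `α² p / n` and `α` times the consensus
error.

*Combination.* The noise of an iteration is independent of the state before it, so both
estimates hold for the expectations along the trajectory (`trajectory_recursion`). In the resulting
system of two scalar recursions, the gap plus a multiple of `α` times the energy satisfies a single
recursion (`coupled_recursion_le`). As the sum of `α²` over the horizon is small (`θ > 1/2`), this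
quantity stays bounded by a constant that depends on the initial values only. Inserting this bound
into both recursions gives an energy of the order `α² p` and a gap of the order
`α p / n + α² p`; the coefficient of `α p / n` involves neither the network nor the compressor. The
initial errors decay faster than any power of `T`.
-/

/-! ### The uniform distribution on the sphere -/

open scoped Pointwise in
lemma image_cone_sphere {p : ℕ} (R : Vec p ≃ₗᵢ[ℝ] Vec p)
    (B : Set (Vec p)) :
    Set.Ioo (0 : ℝ) 1 • (Subtype.val '' ((Subtype.val : Metric.sphere (0 : Vec p) 1 → Vec p) ⁻¹'
        (R ⁻¹' B)))
      = R ⁻¹' (Set.Ioo (0 : ℝ) 1 • (Subtype.val ''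
        ((Subtype.val : Metric.sphere (0 : Vec p) 1 → Vec p) ⁻¹' B))) := by
  ext x
  simp only [Set.mem_smul, Set.mem_image, Set.mem_preimage, Subtype.exists, mem_sphere_iff_norm,
    sub_zero, exists_and_left, exists_prop, exists_eq_right_right]
  constructor
  · rintro ⟨t, ht, y, ⟨hB, hy⟩, rfl⟩
    exact ⟨t, ht, R y, ⟨hB, by simpa using hy⟩, by simp⟩
  · rintro ⟨t, ht, y, ⟨hB, hy⟩, h⟩
    refine ⟨t, ht, R.symm y, ⟨by simpa using hB, by simpa using hy⟩, ?_⟩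
    rw [← map_smul, h, R.symm_apply_apply]

lemma measurable_coe_sphere {p : ℕ} :
    Measurable (Subtype.val : Metric.sphere (0 : Vec p) 1 → Vec p) := measurable_subtype_coe

lemma unifSphere_isProbabilityMeasure {p : ℕ} (hp : 0 < p) :
    IsProbabilityMeasure (unifSphere p) := by
  have : Nonempty (Fin p) := ⟨⟨0, hp⟩⟩
  have : Nontrivial (Vec p) := inferInstance
  have h0 : (volume : Measure (Vec p)).toSphere ≠ 0 := Measure.toSphere_ne_zero _
  have : IsProbabilityMeasure (((volume : Measure (Vec p)).toSphere Set.univ)⁻¹ •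
      (volume : Measure (Vec p)).toSphere) := by
    have : NeZero ((volume : Measure (Vec p)).toSphere) := ⟨h0⟩
    infer_instance
  exact Measure.isProbabilityMeasure_map measurable_coe_sphere.aemeasurable

lemma ae_norm_eq_one_unifSphere (p : ℕ) : ∀ᵐ ζ ∂(unifSphere p), ‖ζ‖ = 1 := by
  rw [unifSphere, ae_map_iff measurable_coe_sphere.aemeasurable
    (measurableSet_eq_fun measurable_norm measurable_const)]
  exact Filter.Eventually.of_forall fun x => by simp

/-- The uniform distribution on the sphere is invariant under linear isometries. -/
lemma measurePreserving_unifSphere {p : ℕ} (R : Vec p ≃ₗᵢ[ℝ] Vec p) :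
    MeasurePreserving R (unifSphere p) (unifSphere p) := by
  have hR : Measurable R := R.continuous.measurable
  refine ⟨hR, ?_⟩
  ext B hB
  rw [Measure.map_apply hR hB, unifSphere, Measure.map_apply measurable_coe_sphere (hR hB),
    Measure.map_apply measurable_coe_sphere hB, Measure.smul_apply, Measure.smul_apply,
    Measure.toSphere_apply' _ (measurable_coe_sphere (hR hB)),
    Measure.toSphere_apply' _ (measurable_coe_sphere hB), image_cone_sphere,
    (LinearIsometryEquiv.measurePreserving R).measure_preimage_emb
      R.toHomeomorph.measurableEmbedding]

section Moments

variable {p : ℕ}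

lemma integrable_of_bound_on_sphere (hp : 0 < p) {f : Vec p → ℝ} (hf : Measurable f) (C : ℝ)
    (h : ∀ ζ, ‖ζ‖ = 1 → |f ζ| ≤ C) : Integrable f (unifSphere p) := by
  have := unifSphere_isProbabilityMeasure hp
  refine Integrable.mono' (integrable_const C) hf.aestronglyMeasurable ?_
  filter_upwards [ae_norm_eq_one_unifSphere p] with ζ hζ
  exact h ζ hζ

lemma abs_inner_le_norm_of_unit (a ζ : Vec p) (hζ : ‖ζ‖ = 1) : |inner ℝ a ζ| ≤ ‖a‖ := by
  simpa [hζ] using abs_real_inner_le_norm a ζ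

lemma integrable_inner_mul_inner_unifSphere (hp : 0 < p) (a b : Vec p) :
    Integrable (fun ζ => inner ℝ a ζ * inner ℝ b ζ) (unifSphere p) := by
  refine integrable_of_bound_on_sphere hp (by fun_prop) (‖a‖ * ‖b‖) fun ζ hζ => ?_
  rw [abs_mul]
  exact mul_le_mul (abs_inner_le_norm_of_unit a ζ hζ) (abs_inner_le_norm_of_unit b ζ hζ)
    (abs_nonneg _) (norm_nonneg _)

lemma integral_inner_sq_unifSphere_eq_of_norm_eq {a b : Vec p} (h : ‖a‖ = ‖b‖) :
    ∫ ζ, inner ℝ a ζ ^ 2 ∂(unifSphere p) = ∫ ζ, inner ℝ b ζ ^ 2 ∂(unifSphere p) := by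
  set R : Vec p ≃ₗᵢ[ℝ] Vec p := Submodule.reflection (Submodule.span ℝ {a - b})ᗮ with hR
  have hab : R a = b := Submodule.reflection_sub h
  rw [← (measurePreserving_unifSphere R).integral_comp R.toHomeomorph.measurableEmbedding
    (fun ζ => inner ℝ b ζ ^ 2)]
  refine integral_congr_ae (Filter.Eventually.of_forall fun ζ => ?_)
  simp only
  rw [← hab, R.inner_map_map]

/-- The second moment matrix of a uniform direction is `I / p`. -/
lemma integral_inner_sq_unifSphere (hp : 0 < p) (a : Vec p) :
    ∫ ζ, inner ℝ a ζ ^ 2 ∂(unifSphere p) = ‖a‖ ^ 2 / p := by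
  have := unifSphere_isProbabilityMeasure hp
  have hp' : (p : ℝ) ≠ 0 := by positivity
  set e := EuclideanSpace.basisFun (Fin p) ℝ
  have h1 : ∀ i, ∫ ζ, inner ℝ (‖a‖ • e i) ζ ^ 2 ∂(unifSphere p)
      = ∫ ζ, inner ℝ a ζ ^ 2 ∂(unifSphere p) := fun i =>
    integral_inner_sq_unifSphere_eq_of_norm_eq (by simp [norm_smul, e])
  have h2 : ∑ i, ∫ ζ, inner ℝ (‖a‖ • e i) ζ ^ 2 ∂(unifSphere p) = ‖a‖ ^ 2 := by
    rw [← integral_finsetSum]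
    · have : ∫ ζ : Vec p, ‖a‖ ^ 2 ∂(unifSphere p) = ‖a‖ ^ 2 := by simp
      rw [← this]
      refine integral_congr_ae ?_
      filter_upwards [ae_norm_eq_one_unifSphere p] with ζ hζ
      simp only [real_inner_smul_left, mul_pow, ← Finset.mul_sum]
      have := e.sum_sq_norm_inner_right ζ
      simp only [Real.norm_eq_abs, sq_abs] at this
      rw [this, hζ]; simp
    · intro i _
      simpa [sq] using integrable_inner_mul_inner_unifSphere hp (‖a‖ • e i) (‖a‖ • e i)
  rw [Finset.sum_congr rfl fun i _ => h1 i] at h2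
  simp only [Finset.sum_const, Finset.card_univ, Fintype.card_fin, nsmul_eq_mul] at h2
  field_simp
  linarith

lemma integral_inner_mul_inner_unifSphere (hp : 0 < p) (a b : Vec p) :
    ∫ ζ, inner ℝ a ζ * inner ℝ b ζ ∂(unifSphere p) = inner ℝ a b / p := by
  have hsq : ∀ c : Vec p, Integrable (fun ζ => inner ℝ c ζ ^ 2) (unifSphere p) := fun c => by
    simpa [sq] using integrable_inner_mul_inner_unifSphere hp c c
  have h : ∀ ζ : Vec p, inner ℝ a ζ * inner ℝ b ζ
      = (inner ℝ (a + b) ζ ^ 2 - inner ℝ a ζ ^ 2 - inner ℝ b ζ ^ 2) / 2 := fun ζ => by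
    rw [inner_add_left]; ring
  simp_rw [h]
  have i1 : Integrable (fun ζ => inner ℝ (a + b) ζ ^ 2 - inner ℝ a ζ ^ 2) (unifSphere p) :=
    (hsq _).sub (hsq _)
  rw [integral_div, integral_sub i1 (hsq _), integral_sub (hsq _) (hsq _),
    integral_inner_sq_unifSphere hp, integral_inner_sq_unifSphere hp,
    integral_inner_sq_unifSphere hp, norm_add_sq_real]
  ring

/-- A function on the sphere that is `M`-Lipschitz has correlation at most `M / p` with a
coordinate: comparing `ζ` with its mirror image across the hyperplane orthogonal to the unit
vector `e` changes the function by at most `2 M |⟨e, ζ⟩|`. -/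
lemma abs_integral_mul_inner_le_of_lipschitz (hp : 0 < p) {h : Vec p → ℝ} (hm : Measurable h)
    {M B : ℝ} (hB : ∀ ζ, ‖ζ‖ = 1 → |h ζ| ≤ B)
    (hM : ∀ ζ ζ', ‖ζ‖ = 1 → ‖ζ'‖ = 1 → |h ζ - h ζ'| ≤ M * ‖ζ - ζ'‖) {e : Vec p}
    (he : ‖e‖ = 1) :
    |∫ ζ, h ζ * inner ℝ e ζ ∂(unifSphere p)| ≤ M / p := by
  have := unifSphere_isProbabilityMeasure hp
  have hM0 : 0 ≤ M := by
    have := hM e (-e) he (by simpa using he)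
    rw [sub_neg_eq_add, ← two_smul ℝ e, norm_smul, he] at this
    norm_num at this
    linarith [abs_nonneg (h e - h (-e))]
  set R : Vec p ≃ₗᵢ[ℝ] Vec p := Submodule.reflection (Submodule.span ℝ {e})ᗮ with hR
  have hRe : R e = -e := Submodule.reflection_orthogonalComplement_singleton_eq_neg e
  have hRinner : ∀ ζ, inner ℝ e (R ζ) = - inner ℝ e ζ := fun ζ => by
    have h1 : inner ℝ (R e) (R ζ) = inner ℝ e ζ := R.inner_map_map e ζ
    rw [hRe, inner_neg_left] at h1
    linarith
  have hsub : ∀ ζ, ζ - R ζ = (2 * inner ℝ e ζ) • e := fun ζ => by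
    rw [hR, Submodule.reflection_orthogonal_apply, Submodule.reflection_singleton_apply, he]
    simp only [RCLike.ofReal_real_eq_id, id_eq, one_pow, div_one]
    module
  have hint : ∀ g : Vec p → ℝ, Measurable g → (∀ ζ, ‖ζ‖ = 1 → |g ζ| ≤ B) →
      Integrable (fun ζ => g ζ * inner ℝ e ζ) (unifSphere p) := fun g hg hgB => by
    refine integrable_of_bound_on_sphere hp (by fun_prop) B fun ζ hζ => ?_
    rw [abs_mul]
    have h1 := abs_inner_le_norm_of_unit e ζ hζ
    rw [he] at h1
    nlinarith [hgB ζ hζ, abs_nonneg (g ζ), abs_nonneg (inner ℝ e ζ : ℝ)]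
  have hRm : Measurable R := R.continuous.measurable
  have i1 := hint h hm hB
  have i2 := hint (fun ζ => h (R ζ)) (hm.comp hRm) fun ζ hζ => hB _ (by simpa using hζ)
  have hswap : ∫ ζ, h ζ * inner ℝ e ζ ∂(unifSphere p)
      = -∫ ζ, h (R ζ) * inner ℝ e ζ ∂(unifSphere p) := by
    rw [← (measurePreserving_unifSphere R).integral_comp R.toHomeomorph.measurableEmbedding
      (fun ζ => h ζ * inner ℝ e ζ), ← integral_neg]
    refine integral_congr_ae (Filter.Eventually.of_forall fun ζ => ?_)
    simp only [hRinner]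
    ring
  have h2 : 2 * ∫ ζ, h ζ * inner ℝ e ζ ∂(unifSphere p)
      = ∫ ζ, (h ζ - h (R ζ)) * inner ℝ e ζ ∂(unifSphere p) := by
    simp_rw [sub_mul]
    rw [integral_sub i1 i2]
    linarith
  have hsqi : Integrable (fun ζ => 2 * M * inner ℝ e ζ ^ 2) (unifSphere p) := by
    have := (integrable_inner_mul_inner_unifSphere hp e e).const_mul (2 * M)
    simpa [sq] using this
  have h3 : |∫ ζ, (h ζ - h (R ζ)) * inner ℝ e ζ ∂(unifSphere p)|
      ≤ ∫ ζ, 2 * M * inner ℝ e ζ ^ 2 ∂(unifSphere p) := by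
    refine (norm_integral_le_integral_norm (μ := unifSphere p)
      (fun ζ => (h ζ - h (R ζ)) * inner ℝ e ζ)).trans (integral_mono_ae ?_ hsqi ?_)
    · refine (i1.sub i2).norm.congr (Filter.Eventually.of_forall fun ζ => ?_)
      simp [sub_mul]
    · filter_upwards [ae_norm_eq_one_unifSphere p] with ζ hζ
      rw [Real.norm_eq_abs, abs_mul]
      have h4 := hM ζ (R ζ) hζ (by simpa using hζ)
      rw [hsub, norm_smul, he, mul_one, Real.norm_eq_abs, abs_mul, abs_two] at h4
      calc |h ζ - h (R ζ)| * |inner ℝ e ζ|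
          ≤ (M * (2 * |inner ℝ e ζ|)) * |inner ℝ e ζ| :=
            mul_le_mul_of_nonneg_right h4 (abs_nonneg _)
        _ = 2 * M * |inner ℝ e ζ| ^ 2 := by ring
        _ = _ := by rw [sq_abs]
  rw [integral_const_mul, integral_inner_sq_unifSphere hp, he, ← h2, abs_mul, abs_two] at h3
  have : 2 * M * (1 ^ 2 / (p : ℝ)) = 2 * (M / p) := by ring
  linarith

end Moments

/-! ### The Laplacian as an operator on stacked vectors -/

/-- Stacked vectors of all agents, with the Euclidean norm. -/
abbrev Stack (n p : ℕ) : Type := PiLp 2 fun _ : Fin n => Vec p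

lemma Stack.inner_eq_sum {n p : ℕ} (x y : Stack n p) : inner ℝ x y = ∑ i, inner ℝ (x i) (y i) :=
  PiLp.inner_apply x y

lemma Stack.norm_sq_eq_sum {n p : ℕ} (x : Stack n p) : ‖x‖ ^ 2 = ∑ i, ‖x i‖ ^ 2 :=
  PiLp.norm_sq_eq_of_L2 _ x

namespace WeightedGraph

variable {n p : ℕ} (G : WeightedGraph n)

/-- The Laplacian acting on stacked vectors, that is `L ⊗ I`. -/
noncomputable def lapOp (p : ℕ) : Stack n p →ₗ[ℝ] Stack n p where
  toFun x := WithLp.toLp 2 fun i => ∑ j, G.laplacian i j • x j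
  map_add' x y := by
    ext1 i
    simp [smul_add, Finset.sum_add_distrib]
  map_smul' c x := by
    ext1 i
    simp [Finset.smul_sum, smul_comm c]

lemma lapOp_apply (x : Stack n p) (i : Fin n) :
    G.lapOp p x i = ∑ j, G.laplacian i j • x j := rfl

lemma laplacian_symm (i j : Fin n) : G.laplacian i j = G.laplacian j i := by
  simp only [laplacian, Matrix.sub_apply, Matrix.diagonal_apply, G.symm i j]
  by_cases h : i = j
  · subst h; simp
  · simp [h, Ne.symm h]

lemma sum_laplacian (j : Fin n) : ∑ i, G.laplacian i j = 0 := by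
  simp only [laplacian, Matrix.sub_apply, Matrix.diagonal_apply, Finset.sum_sub_distrib,
    Finset.sum_ite_eq', Finset.mem_univ, if_true]
  rw [sub_eq_zero]
  exact Finset.sum_congr rfl fun i _ => G.symm j i

lemma sum_lapOp (x : Stack n p) : ∑ i, G.lapOp p x i = 0 := by
  simp only [lapOp_apply]
  rw [Finset.sum_comm]
  refine Finset.sum_eq_zero fun j _ => ?_
  rw [← Finset.sum_smul, sum_laplacian, zero_smul]

lemma lapOp_isSymmetric : (G.lapOp p).IsSymmetric := by
  intro x y
  rw [Stack.inner_eq_sum, Stack.inner_eq_sum]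
  simp only [lapOp_apply, sum_inner, inner_sum, real_inner_smul_left, real_inner_smul_right]
  rw [Finset.sum_comm]
  exact Finset.sum_congr rfl fun i _ => Finset.sum_congr rfl fun j _ => by
    rw [G.laplacian_symm]

lemma lapOp_apply_eq (x : Stack n p) (i : Fin n) :
    G.lapOp p x i = ∑ j, G.A i j • (x i - x j) := by
  simp only [lapOp_apply, laplacian, Matrix.sub_apply, Matrix.diagonal_apply, sub_smul, ite_smul,
    zero_smul, Finset.sum_sub_distrib, smul_sub, Finset.sum_ite_eq, Finset.mem_univ, if_true,
    Finset.sum_smul]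

lemma two_mul_inner_lapOp (x : Stack n p) :
    2 * inner ℝ x (G.lapOp p x) = ∑ i, ∑ j, G.A i j * ‖x i - x j‖ ^ 2 := by
  have h1 : inner ℝ x (G.lapOp p x) = ∑ i, ∑ j, G.A i j * inner ℝ (x i) (x i - x j) := by
    rw [Stack.inner_eq_sum]
    simp only [lapOp_apply_eq, inner_sum, real_inner_smul_right]
  have h2 : inner ℝ x (G.lapOp p x) = ∑ i, ∑ j, G.A i j * inner ℝ (x j) (x j - x i) := by
    rw [h1, Finset.sum_comm]
    exact Finset.sum_congr rfl fun i _ => Finset.sum_congr rfl fun j _ => by rw [G.symm]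
  rw [two_mul]
  nth_rewrite 1 [h1]
  rw [h2, ← Finset.sum_add_distrib]
  refine Finset.sum_congr rfl fun i _ => ?_
  rw [← Finset.sum_add_distrib]
  refine Finset.sum_congr rfl fun j _ => ?_
  rw [← mul_add, ← real_inner_self_eq_norm_sq]
  congr 1
  simp only [inner_sub_left, inner_sub_right, real_inner_comm (x j) (x i)]
  ring

lemma eq_of_lapOp_eq_zero (hG : G.Connected) {x : Stack n p} (hx : G.lapOp p x = 0) (i j : Fin n) :
    x i = x j := by
  have h := G.two_mul_inner_lapOp x
  rw [hx, inner_zero_right, mul_zero] at h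
  have hnn : ∀ i j, 0 ≤ G.A i j * ‖x i - x j‖ ^ 2 := fun i j =>
    mul_nonneg (G.nonneg i j) (sq_nonneg _)
  have hz : ∀ i j, G.A i j * ‖x i - x j‖ ^ 2 = 0 := fun i j => by
    have h1 := (Finset.sum_eq_zero_iff_of_nonneg
      (fun i _ => Finset.sum_nonneg fun j _ => hnn i j)).1 h.symm i (Finset.mem_univ _)
    exact (Finset.sum_eq_zero_iff_of_nonneg (fun j _ => hnn i j)).1 h1 j (Finset.mem_univ _)
  have hedge : ∀ i j, 0 < G.A i j → x i = x j := fun i j hij => by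
    have h2 := (mul_eq_zero.1 (hz i j)).resolve_left hij.ne'
    exact sub_eq_zero.1 (norm_eq_zero.1 (pow_eq_zero_iff two_ne_zero |>.1 h2))
  have hadj : ∀ i j, G.graph.Adj i j → x i = x j := fun i j hij => by
    rcases (SimpleGraph.fromRel_adj _ _ _).1 hij with ⟨-, h3 | h3⟩
    · exact hedge i j h3
    · exact (hedge j i h3).symm
  obtain ⟨W⟩ := hG.preconnected i j
  induction W with
  | nil => rfl
  | cons hab _ ih => exact (hadj _ _ hab).trans ih

lemma eigenvalue_mem_spectrum {x : Stack n p} (hx : x ≠ 0) {m : ℝ} (h : G.lapOp p x = m • x) :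
    m ∈ spectrum ℝ G.laplacian := by
  obtain ⟨i, c, hic⟩ : ∃ i c, x i c ≠ 0 := by
    by_contra! hcon
    exact hx (by ext i c; simpa using hcon i c)
  rw [← Matrix.spectrum_toLin', ← Module.End.hasEigenvalue_iff_mem_spectrum]
  refine Module.End.hasEigenvalue_of_hasEigenvector (x := fun i => x i c)
    ⟨Module.End.mem_eigenspace_iff.2 ?_, fun h0 => hic (congrFun h0 i)⟩
  ext j
  have h1 := congrArg (fun y : Stack n p => y j c) h
  simpa [lapOp_apply, Matrix.toLin'_apply, Matrix.mulVec, dotProduct] using h1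

section Spectral

variable {lo hi : ℝ}

lemma exists_eigenbasis (p : ℕ) (hspec : spectrum ℝ G.laplacian ⊆ insert 0 (Set.Icc lo hi)) :
    ∃ (N : ℕ) (e : OrthonormalBasis (Fin N) ℝ (Stack n p)) (m : Fin N → ℝ),
      (∀ k, G.lapOp p (e k) = m k • e k) ∧ ∀ k, m k = 0 ∨ (lo ≤ m k ∧ m k ≤ hi) := by
  obtain ⟨N, hN⟩ : ∃ N, Module.finrank ℝ (Stack n p) = N := ⟨_, rfl⟩
  have hs := G.lapOp_isSymmetric (p := p)
  have he : ∀ k, G.lapOp p (hs.eigenvectorBasis hN k)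
      = hs.eigenvalues hN k • hs.eigenvectorBasis hN k := fun k => hs.apply_eigenvectorBasis hN k
  refine ⟨N, hs.eigenvectorBasis hN, hs.eigenvalues hN, he, fun k => ?_⟩
  have h := hspec (G.eigenvalue_mem_spectrum
    ((hs.eigenvectorBasis hN).orthonormal.ne_zero k) (he k))
  rwa [Set.mem_insert_iff, Set.mem_Icc] at h

lemma spectral_bounds (hlo : 0 < lo)
    (hspec : spectrum ℝ G.laplacian ⊆ insert 0 (Set.Icc lo hi)) (x : Stack n p) :
    0 ≤ inner ℝ x (G.lapOp p x) ∧ lo * inner ℝ x (G.lapOp p x) ≤ ‖G.lapOp p x‖ ^ 2 ∧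
      ‖G.lapOp p x‖ ≤ |hi| * ‖x‖ := by
  obtain ⟨N, e, m, he, hm⟩ := G.exists_eigenbasis p hspec
  have hc : ∀ k, inner ℝ (e k) (G.lapOp p x) = m k * inner ℝ (e k) x := fun k => by
    rw [← G.lapOp_isSymmetric, he, real_inner_smul_left]
  have h1 : inner ℝ x (G.lapOp p x) = ∑ k, m k * inner ℝ (e k) x ^ 2 := by
    rw [← e.sum_inner_mul_inner]
    exact Finset.sum_congr rfl fun k _ => by rw [hc, real_inner_comm]; ring
  have h2 : ‖G.lapOp p x‖ ^ 2 = ∑ k, m k ^ 2 * inner ℝ (e k) x ^ 2 := by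
    rw [← e.sum_sq_norm_inner_right]
    exact Finset.sum_congr rfl fun k _ => by rw [hc, Real.norm_eq_abs, sq_abs]; ring
  have h3 : ‖x‖ ^ 2 = ∑ k, inner ℝ (e k) x ^ 2 := by
    rw [← e.sum_sq_norm_inner_right]
    exact Finset.sum_congr rfl fun k _ => by rw [Real.norm_eq_abs, sq_abs]
  refine ⟨?_, ?_, ?_⟩
  · rw [h1]
    refine Finset.sum_nonneg fun k _ => mul_nonneg ?_ (sq_nonneg _)
    rcases hm k with h | h <;> linarith
  · rw [h1, h2, Finset.mul_sum]
    refine Finset.sum_le_sum fun k _ => ?_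
    rw [← mul_assoc]
    refine mul_le_mul_of_nonneg_right ?_ (sq_nonneg _)
    rcases hm k with h | h
    · simp [h]
    · nlinarith [h.1]
  · refine abs_le_of_sq_le_sq' ?_ (by positivity) |>.2
    rw [h2, mul_pow, h3, Finset.mul_sum, sq_abs]
    refine Finset.sum_le_sum fun k _ => mul_le_mul_of_nonneg_right ?_ (sq_nonneg _)
    rcases hm k with h | h
    · rw [h]; simp [sq_nonneg]
    · exact pow_le_pow_left₀ (hlo.le.trans h.1) h.2 2

lemma spectral_gap (hG : G.Connected)
    (hspec : spectrum ℝ G.laplacian ⊆ insert 0 (Set.Icc lo hi)) {x : Stack n p}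
    (hx : ∑ i, x i = 0) : lo * ‖x‖ ^ 2 ≤ inner ℝ x (G.lapOp p x) := by
  obtain ⟨N, e, m, he, hm⟩ := G.exists_eigenbasis p hspec
  have hc : ∀ k, inner ℝ (e k) (G.lapOp p x) = m k * inner ℝ (e k) x := fun k => by
    rw [← G.lapOp_isSymmetric, he, real_inner_smul_left]
  have h1 : inner ℝ x (G.lapOp p x) = ∑ k, m k * inner ℝ (e k) x ^ 2 := by
    rw [← e.sum_inner_mul_inner]
    exact Finset.sum_congr rfl fun k _ => by rw [hc, real_inner_comm]; ring
  have h3 : ‖x‖ ^ 2 = ∑ k, inner ℝ (e k) x ^ 2 := by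
    rw [← e.sum_sq_norm_inner_right]
    exact Finset.sum_congr rfl fun k _ => by rw [Real.norm_eq_abs, sq_abs]
  rw [h1, h3, Finset.mul_sum]
  refine Finset.sum_le_sum fun k _ => ?_
  rcases hm k with h | h
  · -- an eigenvector of eigenvalue zero is constant over the agents, so orthogonal to `x`
    have hconst := G.eq_of_lapOp_eq_zero hG (x := e k) (by rw [he, h, zero_smul])
    have : inner ℝ (e k) x = (0 : ℝ) := by
      obtain ⟨i₀⟩ := hG.nonempty
      rw [Stack.inner_eq_sum, Finset.sum_congr rfl fun i _ => by rw [hconst i i₀], ← inner_sum, hx,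
        inner_zero_right]
    simp [this]
  · exact mul_le_mul_of_nonneg_right h.1 (sq_nonneg _)

end Spectral

end WeightedGraph

/-! ### Smooth functions -/

section SmoothFunctions

variable {p : ℕ} {φ : Vec p → ℝ} {ℓ : ℝ}

/-- First-order Taylor expansion is Lipschitz with a constant proportional to the radius. -/
lemma abs_sub_sub_inner_le_of_mem_ball (hd : Differentiable ℝ φ)
    (hL : ∀ x y, ‖gradient φ x - gradient φ y‖ ≤ ℓ * ‖x - y‖) (hℓ : 0 ≤ ℓ) (x y z : Vec p) {ρ : ℝ}
    (hy : ‖y - x‖ ≤ ρ) (hz : ‖z - x‖ ≤ ρ) :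
    |φ z - φ y - inner ℝ (gradient φ x) (z - y)| ≤ ℓ * ρ * ‖z - y‖ := by
  have h := (convex_closedBall x ρ).norm_image_sub_le_of_norm_hasFDerivWithin_le'
    (f := φ) (f' := fun w => InnerProductSpace.toDual ℝ (Vec p) (gradient φ w))
    (φ := InnerProductSpace.toDual ℝ (Vec p) (gradient φ x)) (C := ℓ * ρ)
    (x := y) (y := z)
    (fun w _ => (hd w).hasGradientAt.hasFDerivAt.hasFDerivWithinAt)
    (fun w hw => by
      rw [← map_sub, LinearIsometryEquiv.norm_map]
      exact (hL w x).trans (mul_le_mul_of_nonneg_left (by simpa [dist_eq_norm] using hw) hℓ))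
    (by simpa [dist_eq_norm] using hy) (by simpa [dist_eq_norm] using hz)
  simpa using h

lemma abs_sub_sub_inner_le (hd : Differentiable ℝ φ)
    (hL : ∀ x y, ‖gradient φ x - gradient φ y‖ ≤ ℓ * ‖x - y‖) (hℓ : 0 ≤ ℓ) (x y : Vec p) :
    |φ y - φ x - inner ℝ (gradient φ x) (y - x)| ≤ ℓ * ‖y - x‖ ^ 2 := by
  have h := abs_sub_sub_inner_le_of_mem_ball hd hL hℓ x x y (ρ := ‖y - x‖) (by simp) le_rfl
  rw [sq, ← mul_assoc]
  exact h

/-- The gradient of a smooth function is controlled by the distance to a lower bound. -/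
lemma norm_gradient_sq_le (hd : Differentiable ℝ φ)
    (hL : ∀ x y, ‖gradient φ x - gradient φ y‖ ≤ ℓ * ‖x - y‖) (hℓ : 0 < ℓ) {m : ℝ}
    (hm : ∀ x, m ≤ φ x) (x : Vec p) : ‖gradient φ x‖ ^ 2 ≤ 4 * ℓ * (φ x - m) := by
  set g := gradient φ x with hg
  have h := (abs_le.1 (abs_sub_sub_inner_le hd hL hℓ.le x (x - (1 / (2 * ℓ)) • g))).2
  have h1 := hm (x - (1 / (2 * ℓ)) • g)
  rw [sub_sub_cancel_left, inner_neg_right, real_inner_smul_right, ← hg, real_inner_self_eq_norm_sq,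
    norm_neg, norm_smul, mul_pow, Real.norm_eq_abs, sq_abs] at h
  have h2 : ‖g‖ ^ 2 / (4 * ℓ) ≤ φ x - m := by
    have e1 : ℓ * ((1 / (2 * ℓ)) ^ 2 * ‖g‖ ^ 2) = ‖g‖ ^ 2 / (4 * ℓ) := by field_simp; ring
    have e2 : 1 / (2 * ℓ) * ‖g‖ ^ 2 = 2 * (‖g‖ ^ 2 / (4 * ℓ)) := by field_simp; ring
    rw [e1, e2] at h
    linarith
  rw [div_le_iff₀ (by positivity)] at h2
  linarith

end SmoothFunctions

/-! ### Local costs -/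

namespace StochasticProblem

variable {n p : ℕ} {P : StochasticProblem.{u} n p} {ℓ η₁ σ₁ : ℝ}

/-- The gradient of the stochastic cost of agent `i` at a sample. -/
noncomputable def sampleGrad (P : StochasticProblem.{u} n p) (i : Fin n) (x : Vec p) (ξ : P.Ξ i) : Vec p :=
  gradient (fun x' => P.F i x' ξ) x

/-- The gradient is the limit of difference quotients along the coordinates. -/
lemma aestronglyMeasurable_sampleGrad (hS : P.Smooth ℓ) (i : Fin n) (x : Vec p) :
    AEStronglyMeasurable (P.sampleGrad i x) (P.D i) := by
  set e := EuclideanSpace.basisFun (Fin p) ℝ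
  have hmeas : ∀ y, Measurable (P.F i y) := fun y =>
    (P.measurable_F i).comp measurable_prodMk_left
  refine aestronglyMeasurable_of_tendsto_ae Filter.atTop
    (f := fun (m : ℕ) ξ => ∑ c, (((m : ℝ) + 1) *
      (P.F i (x + ((m : ℝ) + 1)⁻¹ • e c) ξ - P.F i x ξ)) • e c) (fun m => ?_) ?_
  · refine (Finset.measurable_fun_sum _ fun c _ => ?_).aestronglyMeasurable
    exact (measurable_const.mul ((hmeas _).sub (hmeas _))).smul_const _
  · filter_upwards [hS i] with ξ hξ
    have h1 : P.sampleGrad i x ξ = ∑ c, inner ℝ (P.sampleGrad i x ξ) (e c) • e c := by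
      conv_lhs => rw [← e.sum_repr (P.sampleGrad i x ξ)]
      exact Finset.sum_congr rfl fun c _ => by rw [e.repr_apply_apply, real_inner_comm]
    rw [h1]
    refine tendsto_finsetSum _ fun c _ => Filter.Tendsto.smul_const ?_ _
    have h2 : HasFDerivAt (fun x' => P.F i x' ξ)
        (InnerProductSpace.toDual ℝ (Vec p) (P.sampleGrad i x ξ)) x :=
      (hξ.1 x).hasGradientAt.hasFDerivAt
    have h3 := h2.lim (v := e c) (α := ℕ) (c := fun m => (m : ℝ) + 1) (l := Filter.atTop) (by
      refine Filter.tendsto_atTop_mono (fun m => ?_) tendsto_natCast_atTop_atTop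
      simp only [Real.norm_eq_abs]
      exact (by linarith : (m : ℝ) ≤ m + 1).trans (le_abs_self _))
    simpa using h3

lemma integrable_sampleGrad (hS : P.Smooth ℓ) (hℓ : 0 ≤ ℓ) (i : Fin n) (x : Vec p) :
    Integrable (P.sampleGrad i x) (P.D i) := by
  set e := EuclideanSpace.basisFun (Fin p) ℝ
  have hb : Integrable (fun ξ => ∑ c, (|P.F i (x + e c) ξ| + |P.F i x ξ| + ℓ)) (P.D i) :=
    integrable_finsetSum _ fun c _ =>
      ((P.integrable_F i _).abs.add (P.integrable_F i _).abs).add (integrable_const _)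
  refine hb.mono' (aestronglyMeasurable_sampleGrad hS i x) ?_
  filter_upwards [hS i] with ξ hξ
  have h1 : ‖P.sampleGrad i x ξ‖ ≤ ∑ c, |inner ℝ (P.sampleGrad i x ξ) (e c)| := by
    conv_lhs => rw [← e.sum_repr (P.sampleGrad i x ξ)]
    refine (norm_sum_le _ _).trans (Finset.sum_le_sum fun c _ => ?_)
    rw [norm_smul, e.repr_apply_apply, real_inner_comm, e.orthonormal.1 c, mul_one,
      Real.norm_eq_abs]
  refine h1.trans (Finset.sum_le_sum fun c _ => ?_)
  have h2 := abs_sub_sub_inner_le hξ.1 hξ.2 hℓ x (x + e c)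
  rw [add_sub_cancel_left, e.orthonormal.1 c, one_pow, mul_one] at h2
  have h3 : inner ℝ (P.sampleGrad i x ξ) (e c) = (P.F i (x + e c) ξ - P.F i x ξ)
      - (P.F i (x + e c) ξ - P.F i x ξ - inner ℝ (gradient (fun x' => P.F i x' ξ) x) (e c)) := by
    rw [sampleGrad]; ring
  rw [h3]
  refine (abs_sub _ _).trans (add_le_add ((abs_sub _ _)) h2)

lemma hasGradientAt_localCost (hS : P.Smooth ℓ) (hℓ : 0 ≤ ℓ) (i : Fin n) (x : Vec p) :
    HasGradientAt (P.localCost i) (∫ ξ, P.sampleGrad i x ξ ∂(P.D i)) x := by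
  have hI := integrable_sampleGrad hS hℓ i x
  have key : ∀ y, ‖P.localCost i y - P.localCost i x
      - inner ℝ (∫ ξ, P.sampleGrad i x ξ ∂(P.D i)) (y - x)‖ ≤ ℓ * ‖y - x‖ ^ 2 := fun y => by
    have hIi : Integrable (fun ξ => inner ℝ (P.sampleGrad i x ξ) (y - x)) (P.D i) :=
      hI.inner_const _
    have h1 : P.localCost i y - P.localCost i x
        - inner ℝ (∫ ξ, P.sampleGrad i x ξ ∂(P.D i)) (y - x)
        = ∫ ξ, (P.F i y ξ - P.F i x ξ - inner ℝ (P.sampleGrad i x ξ) (y - x)) ∂(P.D i) := by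
      have h0 : Integrable (fun ξ => P.F i y ξ - P.F i x ξ) (P.D i) :=
        (P.integrable_F i y).sub (P.integrable_F i x)
      rw [integral_sub h0 hIi, integral_sub (P.integrable_F i y) (P.integrable_F i x)]
      simp_rw [real_inner_comm (y - x)]
      rw [integral_inner hI]
      rfl
    rw [h1]
    refine (norm_integral_le_of_norm_le_const (C := ℓ * ‖y - x‖ ^ 2) ?_).trans (by simp)
    filter_upwards [hS i] with ξ hξ
    exact abs_sub_sub_inner_le hξ.1 hξ.2 hℓ x y
  rw [hasGradientAt_iff_isLittleO]
  refine (Asymptotics.IsBigO.of_bound ℓ (Filter.Eventually.of_forall fun y => ?_)).trans_isLittleO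
    ((Asymptotics.isLittleO_pow_sub_sub x (one_lt_two)))
  simpa using key y

lemma gradient_localCost (hS : P.Smooth ℓ) (hℓ : 0 ≤ ℓ) (i : Fin n) (x : Vec p) :
    gradient (P.localCost i) x = ∫ ξ, P.sampleGrad i x ξ ∂(P.D i) :=
  (hasGradientAt_localCost hS hℓ i x).gradient

lemma differentiable_localCost (hS : P.Smooth ℓ) (hℓ : 0 ≤ ℓ) (i : Fin n) :
    Differentiable ℝ (P.localCost i) := fun x =>
  (hasGradientAt_localCost hS hℓ i x).differentiableAt

lemma norm_gradient_localCost_sub_le (hS : P.Smooth ℓ) (hℓ : 0 ≤ ℓ) (i : Fin n) (x y : Vec p) :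
    ‖gradient (P.localCost i) x - gradient (P.localCost i) y‖ ≤ ℓ * ‖x - y‖ := by
  rw [gradient_localCost hS hℓ, gradient_localCost hS hℓ,
    ← integral_sub (integrable_sampleGrad hS hℓ i x) (integrable_sampleGrad hS hℓ i y)]
  refine (norm_integral_le_of_norm_le_const (C := ℓ * ‖x - y‖) ?_).trans (by simp)
  filter_upwards [hS i] with ξ hξ
  exact hξ.2 x y

lemma hasGradientAt_cost (hS : P.Smooth ℓ) (hℓ : 0 ≤ ℓ) (x : Vec p) :
    HasGradientAt P.cost ((n : ℝ)⁻¹ • ∑ i, gradient (P.localCost i) x) x := by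
  have h : ∀ i, HasFDerivAt (P.localCost i)
      (InnerProductSpace.toDual ℝ (Vec p) (gradient (P.localCost i) x)) x := fun i =>
    (differentiable_localCost hS hℓ i x).hasGradientAt.hasFDerivAt
  have h1 := (HasFDerivAt.fun_sum (u := Finset.univ) fun i _ => h i).const_mul ((n : ℝ)⁻¹)
  rw [hasGradientAt_iff_hasFDerivAt, map_smul, map_sum]
  exact h1

lemma gradient_cost (hS : P.Smooth ℓ) (hℓ : 0 ≤ ℓ) (x : Vec p) :
    gradient P.cost x = (n : ℝ)⁻¹ • ∑ i, gradient (P.localCost i) x :=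
  (hasGradientAt_cost hS hℓ x).gradient

lemma differentiable_cost (hS : P.Smooth ℓ) (hℓ : 0 ≤ ℓ) : Differentiable ℝ P.cost := fun x =>
  (hasGradientAt_cost hS hℓ x).differentiableAt

lemma norm_gradient_cost_sub_le (hS : P.Smooth ℓ) (hℓ : 0 ≤ ℓ) (hn : 0 < n) (x y : Vec p) :
    ‖gradient P.cost x - gradient P.cost y‖ ≤ ℓ * ‖x - y‖ := by
  rw [gradient_cost hS hℓ, gradient_cost hS hℓ, ← smul_sub, ← Finset.sum_sub_distrib, norm_smul,
    Real.norm_eq_abs, abs_of_nonneg (by positivity)]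
  have h1 : ‖∑ i, (gradient (P.localCost i) x - gradient (P.localCost i) y)‖
      ≤ ∑ _i : Fin n, ℓ * ‖x - y‖ :=
    (norm_sum_le _ _).trans
      (Finset.sum_le_sum fun i _ => norm_gradient_localCost_sub_le hS hℓ i x y)
  have hn' : (0 : ℝ) < n := by exact_mod_cast hn
  rw [inv_mul_le_iff₀ hn']
  simpa using h1

/-- The average of the squared local gradients at a point is controlled by the optimality gap and
the heterogeneity of the agents. -/
lemma sum_norm_gradient_sq_le (hS : P.Smooth ℓ) (hℓ : 0 < ℓ) (hB : P.LowerBounded) {D : ℝ}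
    (hD : P.costInf - (n : ℝ)⁻¹ * ∑ i, P.localInf i ≤ D) (x : Vec p) :
    (n : ℝ)⁻¹ * ∑ i, ‖gradient (P.localCost i) x‖ ^ 2
      ≤ 4 * ℓ * ((P.cost x - P.costInf) + D) := by
  have h1 : ∀ i, ‖gradient (P.localCost i) x‖ ^ 2
      ≤ 4 * ℓ * (P.localCost i x - P.localInf i) := fun i =>
    norm_gradient_sq_le (differentiable_localCost hS hℓ.le i)
      (norm_gradient_localCost_sub_le hS hℓ.le i) hℓ (fun y => ciInf_le (hB i) y) x
  calc (n : ℝ)⁻¹ * ∑ i, ‖gradient (P.localCost i) x‖ ^ 2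
      ≤ (n : ℝ)⁻¹ * ∑ i, 4 * ℓ * (P.localCost i x - P.localInf i) :=
        mul_le_mul_of_nonneg_left (Finset.sum_le_sum fun i _ => h1 i) (by positivity)
    _ = 4 * ℓ * (P.cost x - (n : ℝ)⁻¹ * ∑ i, P.localInf i) := by
        rw [← Finset.mul_sum, Finset.sum_sub_distrib, cost]; ring
    _ ≤ _ := mul_le_mul_of_nonneg_left (by linarith) (by linarith)

lemma costInf_le (hP : BddBelow (Set.range P.cost)) (x : Vec p) : P.costInf ≤ P.cost x :=
  ciInf_le hP x

/-- The infimum of an average is at least the average of the infima. -/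
lemma gap_nonneg (hB : P.LowerBounded) :
    0 ≤ P.costInf - (n : ℝ)⁻¹ * ∑ i, P.localInf i := by
  rw [sub_nonneg]
  refine le_ciInf fun x => ?_
  exact mul_le_mul_of_nonneg_left (Finset.sum_le_sum fun i _ => ciInf_le (hB i) x) (by positivity)

lemma integrable_norm_sampleGrad_sq (hS : P.Smooth ℓ) (hV : P.BoundedVariance η₁ σ₁)
    (i : Fin n) (x : Vec p) :
    Integrable (fun ξ => ‖P.sampleGrad i x ξ‖ ^ 2) (P.D i) := by
  have h := ((hV i x).1.const_mul 2).add
    (integrable_const (μ := P.D i) (2 * ‖gradient (P.localCost i) x‖ ^ 2))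
  refine h.mono' ((aestronglyMeasurable_sampleGrad hS i x).norm.pow 2)
    (Filter.Eventually.of_forall fun ξ => ?_)
  rw [Real.norm_eq_abs, abs_of_nonneg (by positivity)]
  set a := P.sampleGrad i x ξ
  set b := gradient (P.localCost i) x
  have h1 : ‖a‖ ≤ ‖a - b‖ + ‖b‖ := by simpa using norm_add_le (a - b) b
  change ‖a‖ ^ 2 ≤ 2 * ‖a - b‖ ^ 2 + 2 * ‖b‖ ^ 2
  nlinarith [norm_nonneg a, sq_nonneg (‖a - b‖ - ‖b‖)]

lemma integral_norm_sampleGrad_sq_le (hS : P.Smooth ℓ) (hV : P.BoundedVariance η₁ σ₁)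
    (i : Fin n) (x : Vec p) :
    ∫ ξ, ‖P.sampleGrad i x ξ‖ ^ 2 ∂(P.D i)
      ≤ 2 * ((η₁ ^ 2 + 1) * ‖gradient (P.localCost i) x‖ ^ 2 + σ₁ ^ 2) := by
  have hc := integrable_const (μ := P.D i) (2 * ‖gradient (P.localCost i) x‖ ^ 2)
  have h := ((hV i x).1.const_mul 2).add hc
  have h2 : ∫ ξ, ‖P.sampleGrad i x ξ‖ ^ 2 ∂(P.D i) ≤ _ :=
    integral_mono (integrable_norm_sampleGrad_sq hS hV i x) h fun ξ => by
      set a := P.sampleGrad i x ξ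
      set b := gradient (P.localCost i) x
      have h1 : ‖a‖ ≤ ‖a - b‖ + ‖b‖ := by simpa using norm_add_le (a - b) b
      change ‖a‖ ^ 2 ≤ 2 * ‖a - b‖ ^ 2 + 2 * ‖b‖ ^ 2
      nlinarith [norm_nonneg a, sq_nonneg (‖a - b‖ - ‖b‖)]
  refine h2.trans ?_
  rw [integral_add' ((hV i x).1.const_mul 2) hc, integral_const_mul]
  have := (hV i x).2
  simp only [integral_const, probReal_univ, one_smul]
  linarith

end StochasticProblem

/-! ### Moments of the two-point gradient estimator -/

namespace StochasticProblem

variable {n p : ℕ} {P : StochasticProblem.{u} n p} {ℓ η₁ σ₁ μ : ℝ}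

lemma measurable_zoGradient (P : StochasticProblem.{u} n p) (i : Fin n) (μ : ℝ) :
    Measurable fun a : Vec p × P.Ξ i × Vec p => zoGradient P i μ a.1 a.2.1 a.2.2 := by
  have h1 : Measurable fun a : Vec p × P.Ξ i × Vec p => P.F i (a.1 + μ • a.2.2) a.2.1 :=
    (P.measurable_F i).comp
      ((measurable_fst.add (measurable_snd.snd.const_smul μ)).prodMk measurable_snd.fst)
  have h2 : Measurable fun a : Vec p × P.Ξ i × Vec p => P.F i a.1 a.2.1 :=
    (P.measurable_F i).comp (measurable_fst.prodMk measurable_snd.fst)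
  exact (((h1.sub h2).const_mul (p : ℝ)).div_const μ).smul measurable_snd.snd

lemma norm_zoGradient_sq_le {i : Fin n} {x ζ : Vec p} {ξ : P.Ξ i}
    (hξ : Differentiable ℝ (fun x => P.F i x ξ) ∧
      ∀ x y, ‖gradient (fun x' => P.F i x' ξ) x - gradient (fun x' => P.F i x' ξ) y‖ ≤ ℓ * ‖x - y‖)
    (hℓ : 0 ≤ ℓ) (hμ : 0 < μ) (hζ : ‖ζ‖ = 1) :
    ‖zoGradient P i μ x ξ ζ‖ ^ 2
      ≤ 2 * p ^ 2 * inner ℝ (P.sampleGrad i x ξ) ζ ^ 2 + 2 * p ^ 2 * ℓ ^ 2 * μ ^ 2 := by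
  have h := abs_sub_sub_inner_le hξ.1 hξ.2 hℓ x (x + μ • ζ)
  rw [add_sub_cancel_left, real_inner_smul_right, norm_smul, hζ, mul_one, Real.norm_eq_abs,
    sq_abs] at h
  change |P.F i (x + μ • ζ) ξ - P.F i x ξ - μ * inner ℝ (P.sampleGrad i x ξ) ζ| ≤ ℓ * μ ^ 2 at h
  set d := P.F i (x + μ • ζ) ξ - P.F i x ξ with hd
  set a := inner ℝ (P.sampleGrad i x ξ) ζ with ha
  have h1 : (d - μ * a) ^ 2 ≤ (ℓ * μ ^ 2) ^ 2 := sq_le_sq' (abs_le.1 h).1 (abs_le.1 h).2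
  have h2 : d ^ 2 ≤ 2 * μ ^ 2 * a ^ 2 + 2 * (ℓ * μ ^ 2) ^ 2 := by
    nlinarith [sq_nonneg (d - 2 * (μ * a))]
  have h3 : ‖zoGradient P i μ x ξ ζ‖ ^ 2 = p ^ 2 * (d ^ 2 / μ ^ 2) := by
    rw [zoGradient, norm_smul, hζ, mul_one, Real.norm_eq_abs, sq_abs, ← hd]
    ring
  rw [h3]
  have h4 : d ^ 2 / μ ^ 2 ≤ 2 * a ^ 2 + 2 * ℓ ^ 2 * μ ^ 2 := by
    rw [div_le_iff₀ (by positivity)]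
    linarith
  calc (p : ℝ) ^ 2 * (d ^ 2 / μ ^ 2) ≤ p ^ 2 * (2 * a ^ 2 + 2 * ℓ ^ 2 * μ ^ 2) :=
        mul_le_mul_of_nonneg_left h4 (by positivity)
    _ = _ := by ring

lemma aestronglyMeasurable_zoGradient (P : StochasticProblem.{u} n p) (i : Fin n) (μ : ℝ)
    (x : Vec p) {ρ : Measure (P.Ξ i × Vec p)} :
    AEStronglyMeasurable (fun a : P.Ξ i × Vec p => zoGradient P i μ x a.1 a.2) ρ :=
  ((measurable_zoGradient P i μ).comp measurable_prodMk_left).aestronglyMeasurable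

lemma ae_prod_unifSphere (hp : 0 < p) (hS : P.Smooth ℓ) (i : Fin n) :
    ∀ᵐ a ∂((P.D i).prod (unifSphere p)), (Differentiable ℝ (fun x => P.F i x a.1) ∧
      ∀ x y, ‖gradient (fun x' => P.F i x' a.1) x - gradient (fun x' => P.F i x' a.1) y‖
        ≤ ℓ * ‖x - y‖) ∧ ‖a.2‖ = 1 := by
  have := unifSphere_isProbabilityMeasure hp
  exact (Measure.quasiMeasurePreserving_fst.ae (hS i)).and
    (Measure.quasiMeasurePreserving_snd.ae (ae_norm_eq_one_unifSphere p))

lemma integrable_inner_sampleGrad_sq (hp : 0 < p) (hS : P.Smooth ℓ)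
    (hV : P.BoundedVariance η₁ σ₁) (i : Fin n) (x : Vec p) :
    Integrable (fun a : P.Ξ i × Vec p => inner ℝ (P.sampleGrad i x a.1) a.2 ^ 2)
      ((P.D i).prod (unifSphere p)) := by
  have := unifSphere_isProbabilityMeasure hp
  have h1 : Integrable (fun a : P.Ξ i × Vec p => ‖P.sampleGrad i x a.1‖ ^ 2)
      ((P.D i).prod (unifSphere p)) := (integrable_norm_sampleGrad_sq hS hV i x).comp_fst _
  refine h1.mono' ?_ ?_
  · exact ((aestronglyMeasurable_sampleGrad hS i x).comp_fst.inner
      (measurable_snd.aestronglyMeasurable)).pow 2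
  · filter_upwards [ae_prod_unifSphere hp hS i] with a ha
    rw [Real.norm_eq_abs, abs_of_nonneg (by positivity), ← sq_abs]
    exact pow_le_pow_left₀ (abs_nonneg _) (abs_inner_le_norm_of_unit _ _ ha.2) 2

lemma integrable_norm_zoGradient_sq (hp : 0 < p) (hS : P.Smooth ℓ) (hℓ : 0 ≤ ℓ)
    (hV : P.BoundedVariance η₁ σ₁) (hμ : 0 < μ) (i : Fin n) (x : Vec p) :
    Integrable (fun a : P.Ξ i × Vec p => ‖zoGradient P i μ x a.1 a.2‖ ^ 2)
      ((P.D i).prod (unifSphere p)) := by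
  have := unifSphere_isProbabilityMeasure hp
  refine (((integrable_inner_sampleGrad_sq hp hS hV i x).const_mul (2 * p ^ 2)).add
    (integrable_const (2 * p ^ 2 * ℓ ^ 2 * μ ^ 2))).mono'
    ((aestronglyMeasurable_zoGradient P i μ x).norm.pow 2) ?_
  filter_upwards [ae_prod_unifSphere hp hS i] with a ha
  rw [Real.norm_eq_abs, abs_of_nonneg (by positivity)]
  exact norm_zoGradient_sq_le ha.1 hℓ hμ ha.2

/-- The second moment of the estimator grows linearly with the dimension, not quadratically,
because a uniform direction has second moment matrix `I / p`. -/
lemma integral_norm_zoGradient_sq_le (hp : 0 < p) (hS : P.Smooth ℓ) (hℓ : 0 ≤ ℓ)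
    (hV : P.BoundedVariance η₁ σ₁) (hμ : 0 < μ) (i : Fin n) (x : Vec p) :
    ∫ a, ‖zoGradient P i μ x a.1 a.2‖ ^ 2 ∂((P.D i).prod (unifSphere p))
      ≤ 4 * p * ((η₁ ^ 2 + 1) * ‖gradient (P.localCost i) x‖ ^ 2 + σ₁ ^ 2)
        + 2 * p ^ 2 * ℓ ^ 2 * μ ^ 2 := by
  have := unifSphere_isProbabilityMeasure hp
  have hp' : (0 : ℝ) < p := by exact_mod_cast hp
  have hI := integrable_inner_sampleGrad_sq hp hS hV i x
  have hI2 := hI.const_mul (2 * (p : ℝ) ^ 2)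
  have h1 : ∫ a, ‖zoGradient P i μ x a.1 a.2‖ ^ 2 ∂((P.D i).prod (unifSphere p))
      ≤ ∫ a, (2 * p ^ 2 * inner ℝ (P.sampleGrad i x a.1) a.2 ^ 2 + 2 * p ^ 2 * ℓ ^ 2 * μ ^ 2)
        ∂((P.D i).prod (unifSphere p)) := by
    refine integral_mono_ae (integrable_norm_zoGradient_sq hp hS hℓ hV hμ i x)
      (hI2.add (integrable_const _)) ?_
    filter_upwards [ae_prod_unifSphere hp hS i] with a ha
    exact norm_zoGradient_sq_le ha.1 hℓ hμ ha.2
  refine h1.trans ?_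
  rw [integral_add hI2 (integrable_const _), integral_const_mul, integral_prod _ hI]
  simp only [integral_inner_sq_unifSphere hp, integral_div, integral_const, probReal_univ, one_smul]
  have h2 := integral_norm_sampleGrad_sq_le hS hV i x
  have h3 : 2 * (p : ℝ) ^ 2 * ((∫ ξ, ‖P.sampleGrad i x ξ‖ ^ 2 ∂(P.D i)) / p)
      = 2 * p * ∫ ξ, ‖P.sampleGrad i x ξ‖ ^ 2 ∂(P.D i) := by field_simp
  rw [h3]
  nlinarith [mul_le_mul_of_nonneg_left h2 hp'.le]

lemma memLp_two_zoGradient (hp : 0 < p) (hS : P.Smooth ℓ) (hℓ : 0 ≤ ℓ)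
    (hV : P.BoundedVariance η₁ σ₁) (hμ : 0 < μ) (i : Fin n) (x : Vec p) :
    MemLp (fun a : P.Ξ i × Vec p => zoGradient P i μ x a.1 a.2) 2
      ((P.D i).prod (unifSphere p)) :=
  (memLp_two_iff_integrable_sq_norm (aestronglyMeasurable_zoGradient P i μ x)).2
    (integrable_norm_zoGradient_sq hp hS hℓ hV hμ i x)

lemma integrable_zoGradient (hp : 0 < p) (hS : P.Smooth ℓ) (hℓ : 0 ≤ ℓ)
    (hV : P.BoundedVariance η₁ σ₁) (hμ : 0 < μ) (i : Fin n) (x : Vec p) :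
    Integrable (fun a : P.Ξ i × Vec p => zoGradient P i μ x a.1 a.2)
      ((P.D i).prod (unifSphere p)) := by
  have := unifSphere_isProbabilityMeasure hp
  exact (memLp_two_zoGradient hp hS hℓ hV hμ i x).integrable one_le_two

lemma integrable_zoGradient_direction (hp : 0 < p) (hℓ : 0 ≤ ℓ) (hμ : 0 < μ) {i : Fin n}
    {ξ : P.Ξ i} (hξ : Differentiable ℝ (fun x => P.F i x ξ) ∧
      ∀ x y, ‖gradient (fun x' => P.F i x' ξ) x - gradient (fun x' => P.F i x' ξ) y‖ ≤ ℓ * ‖x - y‖)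
    (x : Vec p) :
    Integrable (fun ζ => zoGradient P i μ x ξ ζ) (unifSphere p) := by
  have := unifSphere_isProbabilityMeasure hp
  have hm : AEStronglyMeasurable (fun ζ => zoGradient P i μ x ξ ζ) (unifSphere p) :=
    (((measurable_zoGradient P i μ).comp measurable_prodMk_left).comp
      (measurable_prodMk_left (x := ξ))).aestronglyMeasurable
  have h2 : MemLp (fun ζ => zoGradient P i μ x ξ ζ) 2 (unifSphere p) := by
    rw [memLp_two_iff_integrable_sq_norm hm]
    have hI := ((integrable_inner_mul_inner_unifSphere hp (P.sampleGrad i x ξ)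
      (P.sampleGrad i x ξ)).const_mul (2 * (p : ℝ) ^ 2)).add
        (integrable_const (2 * p ^ 2 * ℓ ^ 2 * μ ^ 2))
    refine hI.mono' (hm.norm.pow 2) ?_
    filter_upwards [ae_norm_eq_one_unifSphere p] with ζ hζ
    rw [Real.norm_eq_abs, abs_of_nonneg (by positivity)]
    refine (norm_zoGradient_sq_le hξ hℓ hμ hζ).trans (le_of_eq ?_)
    simp only [Pi.add_apply]
    ring
  exact h2.integrable one_le_two

/-- For a fixed sample the estimator has a bias of at most `ℓ μ`, whatever the dimension: the
Taylor remainder `ζ ↦ F (x + μ ζ) - F x - μ ⟨∇F x, ζ⟩` is `ℓ μ²`-Lipschitz on the sphere. -/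
lemma norm_integral_zoGradient_sub_le (hp : 0 < p) (hℓ : 0 ≤ ℓ) (hμ : 0 < μ) {i : Fin n}
    {ξ : P.Ξ i} (hξ : Differentiable ℝ (fun x => P.F i x ξ) ∧
      ∀ x y, ‖gradient (fun x' => P.F i x' ξ) x - gradient (fun x' => P.F i x' ξ) y‖ ≤ ℓ * ‖x - y‖)
    (x : Vec p) :
    ‖∫ ζ, zoGradient P i μ x ξ ζ ∂(unifSphere p) - P.sampleGrad i x ξ‖ ≤ ℓ * μ := by
  have := unifSphere_isProbabilityMeasure hp
  have hp' : (0 : ℝ) < p := by exact_mod_cast hp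
  set g := P.sampleGrad i x ξ with hg
  set w := ∫ ζ, zoGradient P i μ x ξ ζ ∂(unifSphere p) - g with hw
  rcases eq_or_ne w 0 with h0 | h0
  · rw [h0, norm_zero]; positivity
  set e := (‖w‖⁻¹ : ℝ) • w with he
  have hwn : ‖w‖ ≠ 0 := norm_ne_zero_iff.2 h0
  have he1 : ‖e‖ = 1 := by rw [he, norm_smul, norm_inv, norm_norm, inv_mul_cancel₀ hwn]
  set R : Vec p → ℝ := fun ζ => P.F i (x + μ • ζ) ξ - P.F i x ξ - μ * inner ℝ g ζ with hR
  have hFc : Continuous fun y => P.F i y ξ := hξ.1.continuous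
  have hRm : Measurable R := by
    have : Continuous R := by fun_prop
    exact this.measurable
  have hRB : ∀ ζ, ‖ζ‖ = 1 → |R ζ| ≤ ℓ * μ ^ 2 := fun ζ hζ => by
    have h := abs_sub_sub_inner_le hξ.1 hξ.2 hℓ x (x + μ • ζ)
    rwa [add_sub_cancel_left, real_inner_smul_right, norm_smul, hζ, mul_one, Real.norm_eq_abs,
      sq_abs] at h
  have hRL : ∀ ζ ζ', ‖ζ‖ = 1 → ‖ζ'‖ = 1 → |R ζ - R ζ'| ≤ ℓ * μ ^ 2 * ‖ζ - ζ'‖ :=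
    fun ζ ζ' hζ hζ' => by
      have h := abs_sub_sub_inner_le_of_mem_ball hξ.1 hξ.2 hℓ x (x + μ • ζ') (x + μ • ζ) (ρ := μ)
        (by simp [norm_smul, hζ', abs_of_pos hμ]) (by simp [norm_smul, hζ, abs_of_pos hμ])
      have e1 : x + μ • ζ - (x + μ • ζ') = μ • (ζ - ζ') := by module
      rw [e1, real_inner_smul_right, norm_smul, Real.norm_eq_abs, abs_of_pos hμ,
        inner_sub_right] at h
      calc |R ζ - R ζ'| = _ := by
            congr 1
            change P.F i (x + μ • ζ) ξ - P.F i x ξ - μ * inner ℝ g ζ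
              - (P.F i (x + μ • ζ') ξ - P.F i x ξ - μ * inner ℝ g ζ') = P.F i (x + μ • ζ) ξ
              - P.F i (x + μ • ζ') ξ - μ * (inner ℝ g ζ - inner ℝ g ζ')
            ring
        _ ≤ _ := h
        _ = _ := by ring
  have hcor := abs_integral_mul_inner_le_of_lipschitz hp hRm hRB hRL he1
  have hRi : Integrable (fun ζ => R ζ * inner ℝ e ζ) (unifSphere p) := by
    refine integrable_of_bound_on_sphere hp (by fun_prop) (ℓ * μ ^ 2) fun ζ hζ => ?_
    rw [abs_mul]
    have h1 := abs_inner_le_norm_of_unit e ζ hζ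
    rw [he1] at h1
    nlinarith [hRB ζ hζ, abs_nonneg (R ζ), abs_nonneg (inner ℝ e ζ : ℝ)]
  have hinner : inner ℝ e w = p / μ * ∫ ζ, R ζ * inner ℝ e ζ ∂(unifSphere p) := by
    have h1 : inner ℝ e (∫ ζ, zoGradient P i μ x ξ ζ ∂(unifSphere p))
        = ∫ ζ, ((p : ℝ) / μ * (R ζ * inner ℝ e ζ) + p * (inner ℝ g ζ * inner ℝ e ζ))
          ∂(unifSphere p) := by
      rw [← integral_inner (integrable_zoGradient_direction hp hℓ hμ hξ x)]
      refine integral_congr_ae (Filter.Eventually.of_forall fun ζ => ?_)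
      simp only [zoGradient, hR, real_inner_smul_right]
      field_simp
      ring
    rw [hw, inner_sub_right, h1, integral_add (hRi.const_mul _)
      ((integrable_inner_mul_inner_unifSphere hp g e).const_mul _), integral_const_mul,
      integral_const_mul, integral_inner_mul_inner_unifSphere hp, real_inner_comm g e]
    field_simp
    ring
  have hnorm : inner ℝ e w = ‖w‖ := by
    rw [he, real_inner_smul_left, real_inner_self_eq_norm_sq]
    field_simp
  calc ‖w‖ = p / μ * ∫ ζ, R ζ * inner ℝ e ζ ∂(unifSphere p) := by rw [← hnorm, hinner]
    _ ≤ p / μ * (ℓ * μ ^ 2 / p) :=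
        mul_le_mul_of_nonneg_left ((le_abs_self _).trans hcor) (by positivity)
    _ = ℓ * μ := by field_simp

lemma norm_integral_zoGradient_sub_gradient_le (hp : 0 < p) (hS : P.Smooth ℓ) (hℓ : 0 ≤ ℓ)
    (hV : P.BoundedVariance η₁ σ₁) (hμ : 0 < μ) (i : Fin n) (x : Vec p) :
    ‖∫ a, zoGradient P i μ x a.1 a.2 ∂((P.D i).prod (unifSphere p)) - gradient (P.localCost i) x‖
      ≤ ℓ * μ := by
  have := unifSphere_isProbabilityMeasure hp
  have hI := integrable_zoGradient hp hS hℓ hV hμ i x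
  rw [integral_prod _ hI, gradient_localCost hS hℓ,
    ← integral_sub hI.integral_prod_left (integrable_sampleGrad hS hℓ i x)]
  refine (norm_integral_le_of_norm_le_const (C := ℓ * μ) ?_).trans (by simp)
  filter_upwards [hS i] with ξ hξ
  exact norm_integral_zoGradient_sub_le hp hℓ hμ hξ x

end StochasticProblem

/-! ### The Lyapunov function of the consensus error -/

/-- Weight of the cross term of the Lyapunov function `energy`; it is small enough for the energy
to be definite and for its decrease in the dual variable to be paid for by the decrease
`b ‖L x‖²` in the primal variable. -/
noncomputable def crossWeight (b lo : ℝ) : ℝ := b * lo / (b ^ 2 * lo + 2)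

lemma crossWeight_pos {b lo : ℝ} (hb : 0 < b) (hlo : 0 < lo) : 0 < crossWeight b lo := by
  unfold crossWeight; positivity

lemma crossWeight_sq_le {b lo : ℝ} (hb : 0 < b) (hlo : 0 < lo) : crossWeight b lo ^ 2 ≤ lo / 4 := by
  rw [crossWeight, div_pow, div_le_iff₀ (by positivity)]
  have : 0 < b ^ 2 * lo := by positivity
  nlinarith [mul_pos hlo (mul_pos this this)]

lemma crossWeight_mul_eq {b lo : ℝ} (hb : 0 < b) (hlo : 0 < lo) :
    crossWeight b lo * (b ^ 2 / 2 + 1 / lo) = b / 2 := by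
  rw [crossWeight]; field_simp

section Energy

variable {E : Type*} [NormedAddCommGroup E] [InnerProductSpace ℝ E]

/-- The Lyapunov function: `x` is the deviation from the average of the primal variables, `v` the
dual variable and `u` the difference between the primal variable and its compressed copy. -/
noncomputable def energy (L : E →ₗ[ℝ] E) (b lo : ℝ) (x v u : E) : ℝ :=
  inner ℝ x (L x) / 2 + ‖v‖ ^ 2 / 2 + crossWeight b lo * inner ℝ x v + ‖u‖ ^ 2

lemma abs_crossWeight_mul_inner_le {b lo : ℝ} (hb : 0 < b) (hlo : 0 < lo) (x v : E) :
    |crossWeight b lo * inner ℝ x v| ≤ (lo * ‖x‖ ^ 2 + ‖v‖ ^ 2) / 4 := by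
  have h1 := crossWeight_sq_le hb hlo
  have h2 := crossWeight_pos hb hlo
  rw [abs_mul, abs_of_pos h2]
  set η := crossWeight b lo
  have h3 : |inner ℝ x v| ≤ ‖x‖ * ‖v‖ := abs_real_inner_le_norm x v
  have h4 : η * |inner ℝ x v| ≤ η * (‖x‖ * ‖v‖) := mul_le_mul_of_nonneg_left h3 h2.le
  have h5 : 4 * η ^ 2 * ‖x‖ ^ 2 ≤ lo * ‖x‖ ^ 2 :=
    mul_le_mul_of_nonneg_right (by linarith) (sq_nonneg _)
  nlinarith [sq_nonneg (2 * η * ‖x‖ - ‖v‖)]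

lemma le_energy {L : E →ₗ[ℝ] E} {b lo : ℝ} (hb : 0 < b) (hlo : 0 < lo) {x v u : E}
    (hx : lo * ‖x‖ ^ 2 ≤ inner ℝ x (L x)) :
    (inner ℝ x (L x) + ‖v‖ ^ 2) / 4 + ‖u‖ ^ 2 ≤ energy L b lo x v u := by
  have h := (abs_le.1 (abs_crossWeight_mul_inner_le hb hlo x v)).1
  unfold energy
  linarith

lemma energy_le {L : E →ₗ[ℝ] E} {b lo : ℝ} (hb : 0 < b) (hlo : 0 < lo) {x v u : E}
    (hx : lo * ‖x‖ ^ 2 ≤ inner ℝ x (L x)) :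
    energy L b lo x v u ≤ inner ℝ x (L x) + ‖v‖ ^ 2 + ‖u‖ ^ 2 := by
  have h := (abs_le.1 (abs_crossWeight_mul_inner_le hb hlo x v)).2
  have := sq_nonneg ‖v‖
  have h2 : 0 ≤ lo * ‖x‖ ^ 2 := by positivity
  unfold energy
  linarith

end Energy

lemma add_add_sq_le (x y z : ℝ) : (x + y + z) ^ 2 ≤ 3 * (x ^ 2 + y ^ 2 + z ^ 2) := by
  nlinarith [sq_nonneg (x - y), sq_nonneg (x - z), sq_nonneg (y - z)]

/-- The real inequality behind the decrease of the energy: `a = ‖L x‖`, `w = ‖v‖`, `ε = ‖e‖` is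
the compression error and `D` the size of the gradient step; `X` and `Y` bound the increments of
the primal and the dual variable. -/
lemma energy_increment_le {b lo H h a w ε D s X Y : ℝ} (hb : 0 < b) (hlo : 0 < lo) (hH : 0 < H)
    (hh : 0 < h) (hh1 : h ≤ 1)
    (hs : s ≤ a ^ 2 / lo)
    (hX0 : 0 ≤ X) (hY0 : 0 ≤ Y)
    (hX : X ≤ b * h * (a + H * ε) + h * w + D) (hY : Y ≤ h * (a + H * ε)) :
    (-(b * h * a ^ 2) + b * h * a * (H * ε) + a * D + h * w * (H * ε)
      + crossWeight b lo * (b * h * a * w + b * h * (H * ε) * w - h * w ^ 2 + D * w + h * s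
        + h * a * ε)) + (H * X ^ 2 / 2 + Y ^ 2 / 2 + crossWeight b lo * (X * Y))
      ≤ -(min b (crossWeight b lo) / 4 * h * (a ^ 2 + w ^ 2))
        + (4 * b * H ^ 2 + 4 / b + 4 * H ^ 2 / crossWeight b lo + 4 * crossWeight b lo * b ^ 2 * H ^ 2
          + 4 * crossWeight b lo + 4 * crossWeight b lo ^ 2 / b
          + (H + crossWeight b lo + 1) * (6 * b ^ 2 * (1 + H ^ 2) + 3 + 2 * (1 + H ^ 2)))
          * (h * ε ^ 2 + D ^ 2 / h + h ^ 2 * (a ^ 2 + w ^ 2)) := by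
  have hη := crossWeight_pos hb hlo
  have hmul := crossWeight_mul_eq hb hlo
  set η := crossWeight b lo
  have hh2 : h ^ 2 ≤ h := by nlinarith
  have hDh : D ^ 2 ≤ D ^ 2 / h := by
    rw [le_div_iff₀ hh]; nlinarith [sq_nonneg D]
  have y1 : b * h * a * (H * ε) ≤ b * h * a ^ 2 / 16 + 4 * b * H ^ 2 * (h * ε ^ 2) := by
    have : 0 ≤ b * h * (a / 4 - 2 * (H * ε)) ^ 2 := by positivity
    have e : b * h * (a / 4 - 2 * (H * ε)) ^ 2
        = b * h * a ^ 2 / 16 - b * h * a * (H * ε) + 4 * b * H ^ 2 * (h * ε ^ 2) := by ring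
    linarith
  have y2 : a * D ≤ b * h * a ^ 2 / 16 + 4 / b * (D ^ 2 / h) := by
    have : 0 ≤ (b * h * a / 4 - 2 * D) ^ 2 / (b * h) := by positivity
    have e : (b * h * a / 4 - 2 * D) ^ 2 / (b * h)
        = b * h * a ^ 2 / 16 - a * D + 4 / b * (D ^ 2 / h) := by field_simp; ring
    linarith
  have y3 : h * w * (H * ε) ≤ η * h * w ^ 2 / 16 + 4 * H ^ 2 / η * (h * ε ^ 2) := by
    have : 0 ≤ h * (η * w / 4 - 2 * (H * ε)) ^ 2 / η := by positivity
    have e : h * (η * w / 4 - 2 * (H * ε)) ^ 2 / η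
        = η * h * w ^ 2 / 16 - h * w * (H * ε) + 4 * H ^ 2 / η * (h * ε ^ 2) := by
      field_simp; ring
    linarith
  have y4 : η * (b * h * (H * ε) * w)
      ≤ η * h * w ^ 2 / 16 + 4 * η * b ^ 2 * H ^ 2 * (h * ε ^ 2) := by
    have : 0 ≤ η * h * (w / 4 - 2 * (b * H * ε)) ^ 2 := by positivity
    have e : η * h * (w / 4 - 2 * (b * H * ε)) ^ 2
        = η * h * w ^ 2 / 16 - η * (b * h * (H * ε) * w) + 4 * η * b ^ 2 * H ^ 2 * (h * ε ^ 2) := by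
      ring
    linarith
  have y5 : η * (D * w) ≤ η * h * w ^ 2 / 16 + 4 * η * (D ^ 2 / h) := by
    have : 0 ≤ η * ((h * w / 4 - 2 * D) ^ 2 / h) := by positivity
    have e : η * ((h * w / 4 - 2 * D) ^ 2 / h)
        = η * h * w ^ 2 / 16 - η * (D * w) + 4 * η * (D ^ 2 / h) := by field_simp; ring
    linarith
  have y6 : η * (h * a * ε) ≤ b * h * a ^ 2 / 16 + 4 * η ^ 2 / b * (h * ε ^ 2) := by
    have : 0 ≤ h * (b * a / 4 - 2 * (η * ε)) ^ 2 / b := by positivity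
    have e : h * (b * a / 4 - 2 * (η * ε)) ^ 2 / b
        = b * h * a ^ 2 / 16 - η * (h * a * ε) + 4 * η ^ 2 / b * (h * ε ^ 2) := by
      field_simp; ring
    linarith
  -- the two indefinite terms take half of the available decrease
  have y7 : η * (b * h * a * w + h * s) ≤ η * h * w ^ 2 / 2 + b * h * a ^ 2 / 2 := by
    have e : b * h * a ^ 2 / 2 = h * a ^ 2 * (η * (b ^ 2 / 2 + 1 / lo)) := by rw [hmul]; ring
    have f : η * (h * s) ≤ η * (h * (a ^ 2 / lo)) := by gcongr
    have g : 0 ≤ η * h * (b * a - w) ^ 2 := by positivity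
    have e2 : h * a ^ 2 * (η * (b ^ 2 / 2 + 1 / lo))
        = η * h * (b ^ 2 * a ^ 2) / 2 + η * (h * (a ^ 2 / lo)) := by field_simp
    have e3 : η * h * (b * a - w) ^ 2
        = η * h * (b ^ 2 * a ^ 2) - 2 * (η * (b * h * a * w)) + η * h * w ^ 2 := by ring
    rw [e, e2, mul_add]
    linarith
  have hXX : X ^ 2 ≤ (b * h * (a + H * ε) + h * w + D) ^ 2 := pow_le_pow_left₀ hX0 hX 2
  have hYY : Y ^ 2 ≤ (h * (a + H * ε)) ^ 2 := pow_le_pow_left₀ hY0 hY 2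
  have hsum : (a + H * ε) ^ 2 ≤ 2 * (a ^ 2 + H ^ 2 * ε ^ 2) := by
    rw [← mul_pow]; exact add_sq_le
  have hX3 : (b * h * (a + H * ε) + h * w + D) ^ 2
      ≤ 3 * (b ^ 2 * h ^ 2 * (a + H * ε) ^ 2 + h ^ 2 * w ^ 2 + D ^ 2) := by
    have := add_add_sq_le (b * h * (a + H * ε)) (h * w) D
    rwa [mul_pow, mul_pow, mul_pow] at this
  set Z := h * ε ^ 2 + D ^ 2 / h + h ^ 2 * (a ^ 2 + w ^ 2) with hZ
  have z1 : h ^ 2 * (a ^ 2 + H ^ 2 * ε ^ 2) ≤ (1 + H ^ 2) * Z := by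
    have i1 : h ^ 2 * ε ^ 2 ≤ h * ε ^ 2 := mul_le_mul_of_nonneg_right hh2 (sq_nonneg _)
    have i2 : 0 ≤ H ^ 2 * (D ^ 2 / h + h ^ 2 * (a ^ 2 + w ^ 2)) := by positivity
    have i3 : 0 ≤ h * ε ^ 2 + D ^ 2 / h + h ^ 2 * w ^ 2 := by positivity
    have i4 : H ^ 2 * (h ^ 2 * ε ^ 2) ≤ H ^ 2 * (h * ε ^ 2) := by gcongr
    rw [hZ]
    linarith
  have z2 : h ^ 2 * w ^ 2 + D ^ 2 ≤ Z := by
    have i3 : 0 ≤ h * ε ^ 2 + h ^ 2 * a ^ 2 := by positivity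
    rw [hZ]
    linarith
  have hS : X ^ 2 + Y ^ 2 ≤ (6 * b ^ 2 * (1 + H ^ 2) + 3 + 2 * (1 + H ^ 2)) * Z := by
    have i1 : b ^ 2 * h ^ 2 * (a + H * ε) ^ 2 ≤ b ^ 2 * h ^ 2 * (2 * (a ^ 2 + H ^ 2 * ε ^ 2)) := by
      gcongr
    have i2 : h ^ 2 * (a + H * ε) ^ 2 ≤ h ^ 2 * (2 * (a ^ 2 + H ^ 2 * ε ^ 2)) := by gcongr
    have i3 : b ^ 2 * (h ^ 2 * (a ^ 2 + H ^ 2 * ε ^ 2)) ≤ b ^ 2 * ((1 + H ^ 2) * Z) := by gcongr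
    rw [mul_pow] at hYY
    linarith
  have hsec : H * X ^ 2 / 2 + Y ^ 2 / 2 + η * (X * Y) ≤ (H + η + 1) * (X ^ 2 + Y ^ 2) := by
    have i1 : 0 ≤ H * X ^ 2 := by positivity
    have i2 : 0 ≤ H * Y ^ 2 := by positivity
    have i3 : 0 ≤ η * (X - Y) ^ 2 := by positivity
    have i4 : 0 ≤ η * (X ^ 2 + Y ^ 2) := by positivity
    linarith [sq_nonneg X, sq_nonneg Y]
  have hsec2 := hsec.trans (mul_le_mul_of_nonneg_left hS (by positivity : 0 ≤ H + η + 1))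
  have hmin : min b η / 4 * h * (a ^ 2 + w ^ 2) ≤ b * h * a ^ 2 / 4 + η * h * w ^ 2 / 4 := by
    have i1 : min b η * (h * a ^ 2) ≤ b * (h * a ^ 2) :=
      mul_le_mul_of_nonneg_right (min_le_left _ _) (by positivity)
    have i2 : min b η * (h * w ^ 2) ≤ η * (h * w ^ 2) :=
      mul_le_mul_of_nonneg_right (min_le_right _ _) (by positivity)
    linarith
  have t1 : 0 ≤ D ^ 2 / h := by positivity
  have t2 : 0 ≤ h * ε ^ 2 := by positivity
  have t3 : 0 ≤ h ^ 2 * (a ^ 2 + w ^ 2) := by positivity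
  have k1 : 4 * b * H ^ 2 * (h * ε ^ 2) ≤ 4 * b * H ^ 2 * Z :=
    mul_le_mul_of_nonneg_left (by linarith) (by positivity)
  have k2 : 4 / b * (D ^ 2 / h) ≤ 4 / b * Z :=
    mul_le_mul_of_nonneg_left (by linarith) (by positivity)
  have k3 : 4 * H ^ 2 / η * (h * ε ^ 2) ≤ 4 * H ^ 2 / η * Z :=
    mul_le_mul_of_nonneg_left (by linarith) (by positivity)
  have k4 : 4 * η * b ^ 2 * H ^ 2 * (h * ε ^ 2) ≤ 4 * η * b ^ 2 * H ^ 2 * Z :=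
    mul_le_mul_of_nonneg_left (by linarith) (by positivity)
  have k5 : 4 * η * (D ^ 2 / h) ≤ 4 * η * Z :=
    mul_le_mul_of_nonneg_left (by linarith) (by positivity)
  have k6 : 4 * η ^ 2 / b * (h * ε ^ 2) ≤ 4 * η ^ 2 / b * Z :=
    mul_le_mul_of_nonneg_left (by linarith) (by positivity)
  have p1 : 0 ≤ b * h * a ^ 2 := by positivity
  have p2 : 0 ≤ η * h * w ^ 2 := by positivity
  linarith

lemma increment_sq_le {b H h a w ε D X : ℝ} (hh : 0 < h) (hh1 : h ≤ 1) (hX0 : 0 ≤ X)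
    (hX : X ≤ b * h * (a + H * ε) + h * w + D) :
    X ^ 2 ≤ (6 * b ^ 2 * (1 + H ^ 2) + 3)
      * (h * ε ^ 2 + D ^ 2 / h + h ^ 2 * (a ^ 2 + w ^ 2)) := by
  have hh2 : h ^ 2 ≤ h := by nlinarith
  have hDh : D ^ 2 ≤ D ^ 2 / h := by
    rw [le_div_iff₀ hh]; nlinarith [sq_nonneg D]
  have h1 : X ^ 2 ≤ (b * h * (a + H * ε) + h * w + D) ^ 2 := pow_le_pow_left₀ hX0 hX 2
  have h2 := add_add_sq_le (b * h * (a + H * ε)) (h * w) D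
  have h3 : (b * h * (a + H * ε)) ^ 2 ≤ b ^ 2 * (2 * (h ^ 2 * (a ^ 2 + H ^ 2 * ε ^ 2))) := by
    have : (a + H * ε) ^ 2 ≤ 2 * (a ^ 2 + (H * ε) ^ 2) := add_sq_le
    calc (b * h * (a + H * ε)) ^ 2 = b ^ 2 * (h ^ 2 * (a + H * ε) ^ 2) := by ring
      _ ≤ b ^ 2 * (h ^ 2 * (2 * (a ^ 2 + (H * ε) ^ 2))) := by gcongr
      _ = _ := by ring
  set Z := h * ε ^ 2 + D ^ 2 / h + h ^ 2 * (a ^ 2 + w ^ 2) with hZ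
  have i1 : h ^ 2 * ε ^ 2 ≤ h * ε ^ 2 := mul_le_mul_of_nonneg_right hh2 (sq_nonneg _)
  have t1 : 0 ≤ D ^ 2 / h := by positivity
  have t2 : 0 ≤ h * ε ^ 2 := by positivity
  have t3 : 0 ≤ h ^ 2 * a ^ 2 := by positivity
  have t4 : 0 ≤ h ^ 2 * w ^ 2 := by positivity
  have z1 : h ^ 2 * (a ^ 2 + H ^ 2 * ε ^ 2) ≤ (1 + H ^ 2) * Z := by
    have i2 : h ^ 2 * a ^ 2 ≤ Z := by rw [hZ]; linarith
    have i3 : h ^ 2 * ε ^ 2 ≤ Z := by rw [hZ]; linarith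
    have i4 : H ^ 2 * (h ^ 2 * ε ^ 2) ≤ H ^ 2 * Z := by gcongr
    linarith
  have z2 : (h * w) ^ 2 + D ^ 2 ≤ Z := by rw [hZ]; linarith
  have z3 : b ^ 2 * (2 * (h ^ 2 * (a ^ 2 + H ^ 2 * ε ^ 2))) ≤ b ^ 2 * (2 * ((1 + H ^ 2) * Z)) := by
    gcongr
  linarith

/-- Constant of the error terms in `energy_step`. -/
noncomputable def energyConst (b lo H ρ : ℝ) : ℝ :=
  4 * b * H ^ 2 + 4 / b + 4 * H ^ 2 / crossWeight b lo + 4 * crossWeight b lo * b ^ 2 * H ^ 2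
    + 4 * crossWeight b lo + 4 * crossWeight b lo ^ 2 / b
    + (H + crossWeight b lo + 1) * (6 * b ^ 2 * (1 + H ^ 2) + 3 + 2 * (1 + H ^ 2))
    + (1 + 2 / ρ) * (6 * b ^ 2 * (1 + H ^ 2) + 3)

lemma energyConst_pos {b lo H ρ : ℝ} (hb : 0 < b) (hlo : 0 < lo) (hH : 0 < H) (hρ : 0 < ρ) :
    0 < energyConst b lo H ρ := by
  have := crossWeight_pos hb hlo
  unfold energyConst
  positivity

lemma norm_add_sq_le_weighted {E : Type*} [SeminormedAddCommGroup E] (x y : E) {ρ : ℝ} (hρ : 0 < ρ) :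
    ‖x + y‖ ^ 2 ≤ (1 + ρ / 2) * ‖x‖ ^ 2 + (1 + 2 / ρ) * ‖y‖ ^ 2 := by
  have h1 : ‖x + y‖ ^ 2 ≤ (‖x‖ + ‖y‖) ^ 2 := pow_le_pow_left₀ (norm_nonneg _) (norm_add_le _ _) 2
  have h2 : 0 ≤ (ρ * ‖x‖ - 2 * ‖y‖) ^ 2 / (2 * ρ) := by positivity
  have h3 : (ρ * ‖x‖ - 2 * ‖y‖) ^ 2 / (2 * ρ)
      = ρ / 2 * ‖x‖ ^ 2 - 2 * (‖x‖ * ‖y‖) + 2 / ρ * ‖y‖ ^ 2 := by field_simp; ring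
  linarith

section Step

variable {E : Type*} [NormedAddCommGroup E] [InnerProductSpace ℝ E]

/-- One step of the primal-dual iteration with compression error `e` and perturbation `d` of the
averaged-out primal variable (`d'` before averaging out): the energy decreases up to terms that are
quadratic in the perturbations or of second order in the step size `h`. -/
lemma energy_step {L : E →ₗ[ℝ] E} (hL : L.IsSymmetric) {b lo H h ρ : ℝ} (hb : 0 < b)
    (hlo : 0 < lo) (hH : 0 < H) (hh : 0 < h) (hh1 : h ≤ 1) (hρ : 0 < ρ)
    (hLH : ∀ x, ‖L x‖ ≤ H * ‖x‖) {x : E} (hx : lo * inner ℝ x (L x) ≤ ‖L x‖ ^ 2)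
    (v e d d' u : E) (hd : ‖d‖ ≤ ‖d'‖) :
    energy L b lo (x - (b * h) • L (x + e) - h • v - d) (v + h • L (x + e))
        (u - (b * h) • L (x + e) - h • v - d')
      ≤ energy L b lo x v 0 - min b (crossWeight b lo) / 4 * h * (‖L x‖ ^ 2 + ‖v‖ ^ 2)
        + energyConst b lo H ρ * (h * ‖e‖ ^ 2 + ‖d'‖ ^ 2 / h + h ^ 2 * (‖L x‖ ^ 2 + ‖v‖ ^ 2))
        + (1 + ρ / 2) * ‖u‖ ^ 2 := by
  have hη := crossWeight_pos hb hlo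
  set A := L x with hA
  set B := L e with hB
  have hLe : L (x + e) = A + B := map_add L x e
  rw [hLe]
  have hBn : ‖B‖ ≤ H * ‖e‖ := hLH e
  have hABn : ‖A + B‖ ≤ ‖A‖ + H * ‖e‖ := (norm_add_le _ _).trans (by linarith)
  set Δx := -((b * h) • (A + B)) - h • v - d with hΔx
  set Δv := h • (A + B) with hΔv
  set δ := -((b * h) • (A + B)) - h • v - d' with hδ
  have ex : x - (b * h) • (A + B) - h • v - d = x + Δx := by rw [hΔx]; abel
  have eu : u - (b * h) • (A + B) - h • v - d' = u + δ := by rw [hδ]; abel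
  rw [ex, eu]
  have hXle : ∀ c : E, ‖c‖ ≤ ‖d'‖ →
      ‖-((b * h) • (A + B)) - h • v - c‖ ≤ b * h * (‖A‖ + H * ‖e‖) + h * ‖v‖ + ‖d'‖ := fun c hc => by
    refine (norm_sub_le _ _).trans (add_le_add ((norm_sub_le _ _).trans (add_le_add ?_ ?_)) hc)
    · rw [norm_neg, norm_smul, Real.norm_eq_abs, abs_of_pos (by positivity)]
      gcongr
    · rw [norm_smul, Real.norm_eq_abs, abs_of_pos hh]
  have hX : ‖Δx‖ ≤ b * h * (‖A‖ + H * ‖e‖) + h * ‖v‖ + ‖d'‖ := hXle d hd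
  have hδn : ‖δ‖ ≤ b * h * (‖A‖ + H * ‖e‖) + h * ‖v‖ + ‖d'‖ := hXle d' le_rfl
  have hY : ‖Δv‖ ≤ h * (‖A‖ + H * ‖e‖) := by
    rw [hΔv, norm_smul, Real.norm_eq_abs, abs_of_pos hh]
    gcongr
  have hs : inner ℝ x A ≤ ‖A‖ ^ 2 / lo := by rw [le_div_iff₀ hlo]; linarith
  have hmain := energy_increment_le (w := ‖v‖) (ε := ‖e‖) (D := ‖d'‖) hb hlo hH hh hh1 hs
    (norm_nonneg Δx) (norm_nonneg Δv) hX hY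
  have hδ2 := increment_sq_le hh hh1 (norm_nonneg δ) hδn
  have hu := norm_add_sq_le_weighted u δ hρ
  -- exact expansion of the increment
  have hxl : ∀ y, inner ℝ x (L y) = inner ℝ A y := fun y => (hL x y).symm
  have exp1 : inner ℝ (x + Δx) (L (x + Δx))
      = inner ℝ x A + 2 * inner ℝ A Δx + inner ℝ Δx (L Δx) := by
    rw [map_add, inner_add_left, inner_add_right, inner_add_right, hxl Δx, ← hA,
      real_inner_comm A Δx]
    ring
  have exp2 : ‖v + Δv‖ ^ 2 = ‖v‖ ^ 2 + 2 * inner ℝ v Δv + ‖Δv‖ ^ 2 := norm_add_sq_real v Δv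
  have exp3 : inner ℝ (x + Δx) (v + Δv)
      = inner ℝ x v + inner ℝ Δx v + inner ℝ x Δv + inner ℝ Δx Δv := by
    simp only [inner_add_left, inner_add_right]; ring
  have f1 : inner ℝ A Δx + inner ℝ v Δv
      ≤ -(b * h * ‖A‖ ^ 2) + b * h * ‖A‖ * (H * ‖e‖) + ‖A‖ * ‖d'‖ + h * ‖v‖ * (H * ‖e‖) := by
    have e1 : inner ℝ A Δx + inner ℝ v Δv = -(b * h * ‖A‖ ^ 2) + b * h * (-inner ℝ A B)
        + (-inner ℝ A d) + h * inner ℝ v B := by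
      rw [hΔx, hΔv]
      simp only [inner_sub_right, inner_neg_right, real_inner_smul_right, inner_add_right,
        real_inner_self_eq_norm_sq, real_inner_comm A v]
      ring
    have g1 : -inner ℝ A B ≤ ‖A‖ * (H * ‖e‖) :=
      (neg_le_abs _).trans ((abs_real_inner_le_norm A B).trans (by gcongr))
    have g2 : -inner ℝ A d ≤ ‖A‖ * ‖d'‖ :=
      (neg_le_abs _).trans ((abs_real_inner_le_norm A d).trans (by gcongr))
    have g3 : inner ℝ v B ≤ ‖v‖ * (H * ‖e‖) :=
      (le_abs_self _).trans ((abs_real_inner_le_norm v B).trans (by gcongr))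
    have g1' := mul_le_mul_of_nonneg_left g1 (by positivity : 0 ≤ b * h)
    have g3' := mul_le_mul_of_nonneg_left g3 hh.le
    rw [e1]
    linarith
  have f2 : inner ℝ Δx v + inner ℝ x Δv ≤ b * h * ‖A‖ * ‖v‖ + b * h * (H * ‖e‖) * ‖v‖
      - h * ‖v‖ ^ 2 + ‖d'‖ * ‖v‖ + h * inner ℝ x A + h * ‖A‖ * ‖e‖ := by
    have e1 : inner ℝ Δx v + inner ℝ x Δv = b * h * (-inner ℝ A v) + b * h * (-inner ℝ B v)
        - h * ‖v‖ ^ 2 + (-inner ℝ d v) + h * inner ℝ x A + h * inner ℝ A e := by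
      rw [hΔx, hΔv]
      simp only [inner_sub_left, inner_neg_left, real_inner_smul_left, inner_add_left,
        real_inner_self_eq_norm_sq, real_inner_smul_right, inner_add_right]
      rw [hB, hxl e]
      ring
    have g1 : -inner ℝ A v ≤ ‖A‖ * ‖v‖ := (neg_le_abs _).trans (abs_real_inner_le_norm A v)
    have g2 : -inner ℝ B v ≤ H * ‖e‖ * ‖v‖ :=
      (neg_le_abs _).trans ((abs_real_inner_le_norm B v).trans (by gcongr))
    have g3 : -inner ℝ d v ≤ ‖d'‖ * ‖v‖ :=
      (neg_le_abs _).trans ((abs_real_inner_le_norm d v).trans (by gcongr))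
    have g4 : inner ℝ A e ≤ ‖A‖ * ‖e‖ := (le_abs_self _).trans (abs_real_inner_le_norm A e)
    have g1' := mul_le_mul_of_nonneg_left g1 (by positivity : 0 ≤ b * h)
    have g2' := mul_le_mul_of_nonneg_left g2 (by positivity : 0 ≤ b * h)
    have g4' := mul_le_mul_of_nonneg_left g4 hh.le
    rw [e1]
    linarith
  have f3 : inner ℝ Δx (L Δx) ≤ H * ‖Δx‖ ^ 2 := by
    refine (le_abs_self _).trans ((abs_real_inner_le_norm _ _).trans ?_)
    exact (mul_le_mul_of_nonneg_left (hLH Δx) (norm_nonneg Δx)).trans (le_of_eq (by ring))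
  have f4 : inner ℝ Δx Δv ≤ ‖Δx‖ * ‖Δv‖ := (le_abs_self _).trans (abs_real_inner_le_norm _ _)
  have f2' := mul_le_mul_of_nonneg_left f2 hη.le
  have f4' := mul_le_mul_of_nonneg_left f4 hη.le
  have hδ3 := mul_le_mul_of_nonneg_left hδ2 (by positivity : 0 ≤ 1 + 2 / ρ)
  unfold energy energyConst
  rw [exp1, exp2, exp3, norm_zero, ← hA]
  set η := crossWeight b lo
  set Z := h * ‖e‖ ^ 2 + ‖d'‖ ^ 2 / h + h ^ 2 * (‖A‖ ^ 2 + ‖v‖ ^ 2) with hZ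
  have c1 := sub_nonneg.2 hmain
  have c2 := sub_nonneg.2 hδ3
  linarith

end Step

/-- For small step sizes the second-order terms are absorbed: the step size threshold depends only
on the spectral bounds, on the contraction factor `1 - ρ` of the compression and on the relative
size `r₀` of the compression error. -/
lemma exists_step_threshold {b lo H ρ r₀ : ℝ} (hb : 0 < b) (hlo : 0 < lo) (hH : 0 < H)
    (hρ : 0 < ρ) (hρ1 : ρ ≤ 1) (hr₀ : 0 ≤ r₀) :
    ∃ κ, 0 < κ ∧ κ ≤ 1 ∧ ∀ h, 0 < h → h < κ → ∃ c, 0 < c ∧ c < 1 ∧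
      ∀ S Q W U : ℝ, 0 ≤ Q → 0 ≤ U → S ≤ (1 / lo + 1) * Q → W ≤ S →
        W - min b (crossWeight b lo) / 4 * h * Q
            + energyConst b lo H ρ * (h * (r₀ * U) + h ^ 2 * Q) + (1 + ρ / 2) * ((1 - ρ) * U)
          ≤ (1 - c) * (W + U) := by
  have hη := crossWeight_pos hb hlo
  have hC := energyConst_pos hb hlo hH hρ
  set C := energyConst b lo H ρ
  set m := min b (crossWeight b lo) with hm
  have hm0 : 0 < m := lt_min hb hη
  refine ⟨min 1 (min (m / (8 * C)) (ρ / (4 * C * (r₀ + 1)))), by positivity, min_le_left _ _,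
    fun h hh hhκ => ?_⟩
  have h1 : h * (8 * C) < m :=
    (lt_div_iff₀ (by positivity)).1 (hhκ.trans_le ((min_le_right _ _).trans (min_le_left _ _)))
  have h2 : h * (4 * C * (r₀ + 1)) < ρ :=
    (lt_div_iff₀ (by positivity)).1 (hhκ.trans_le ((min_le_right _ _).trans (min_le_right _ _)))
  refine ⟨min (m / 8 * h / (1 / lo + 1)) (ρ / 4), by positivity,
    (min_le_right _ _).trans_lt (by linarith), fun S Q W U hQ hU hS hW => ?_⟩
  set c := min (m / 8 * h / (1 / lo + 1)) (ρ / 4) with hc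
  have hc0 : 0 < c := by positivity
  have c1 : c * (1 / lo + 1) ≤ m / 8 * h :=
    (le_div_iff₀ (by positivity)).1 (min_le_left _ _)
  have c2 : c ≤ ρ / 4 := min_le_right _ _
  have a1 : c * W ≤ m / 8 * h * Q := by
    calc c * W ≤ c * ((1 / lo + 1) * Q) := by gcongr; linarith
      _ = c * (1 / lo + 1) * Q := by ring
      _ ≤ _ := by gcongr
  have a2 : C * (h ^ 2 * Q) ≤ m / 8 * h * Q := by
    have : 0 ≤ (m - h * (8 * C)) * (h * Q) := mul_nonneg (by linarith) (by positivity)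
    linarith
  have a3 : C * (h * (r₀ * U)) ≤ ρ / 4 * U := by
    have i1 : 0 ≤ (ρ - h * (4 * C * (r₀ + 1))) * U := mul_nonneg (by linarith) hU
    have i2 : 0 ≤ C * h * U := by positivity
    linarith
  have a4 : (1 + ρ / 2) * ((1 - ρ) * U) ≤ (1 - ρ / 2) * U := by
    have : 0 ≤ ρ ^ 2 * U := by positivity
    linarith
  have a5 : c * U ≤ ρ / 4 * U := by gcongr
  linarith

/-! ### The law of the randomness of one iteration -/

section Noise

lemma measurePreserving_prod_comm {α β γ δ : Type*} [MeasurableSpace α] [MeasurableSpace β]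
    [MeasurableSpace γ] [MeasurableSpace δ] (a : Measure α) (b : Measure β) (c : Measure γ)
    (d : Measure δ) [SFinite a] [SFinite b] [SFinite c] [SFinite d] :
    MeasurePreserving (fun t : (α × β) × (γ × δ) => ((t.1.1, t.2.1), (t.1.2, t.2.2)))
      ((a.prod b).prod (c.prod d)) ((a.prod c).prod (b.prod d)) := by
  have h1 := measurePreserving_prodAssoc a b (c.prod d)
  have h2 := (MeasurePreserving.id a).prod ((measurePreserving_prodAssoc b c d).symm _)
  have h3 := (MeasurePreserving.id a).prod
    ((Measure.measurePreserving_swap (μ := b) (ν := c)).prod (MeasurePreserving.id d))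
  have h4 := (MeasurePreserving.id a).prod (measurePreserving_prodAssoc c b d)
  have h5 := (measurePreserving_prodAssoc a c (b.prod d)).symm _
  exact h5.comp (h4.comp (h3.comp (h2.comp h1)))

lemma measurePreserving_eval_pair {ι : Type*} [Fintype ι] {X : ι → Type*}
    [∀ i, MeasurableSpace (X i)] (μ : ∀ i, Measure (X i)) [∀ i, IsProbabilityMeasure (μ i)]
    {i j : ι} (hij : i ≠ j) :
    MeasurePreserving (fun x : ∀ i, X i => (x i, x j)) (Measure.pi μ) ((μ i).prod (μ j)) := by
  have h := (iIndepFun_pi (μ := μ) (X := fun i (x : X i) => x)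
    (fun i => aemeasurable_id)).indepFun hij
  rw [indepFun_iff_map_prod_eq_prod_map_map (measurable_pi_apply i).aemeasurable
    (measurable_pi_apply j).aemeasurable, (measurePreserving_eval μ i).map_eq,
    (measurePreserving_eval μ j).map_eq] at h
  exact ⟨by fun_prop, h⟩

variable {n p : ℕ}

/-- The law of the randomness of one iteration, given the joint law of the compressor seeds. -/
noncomputable def noiseLaw (P : StochasticProblem.{u} n p) (K : RandomMap.{v} p)
    (seeds : Measure (Fin n → K.S)) : Measure (Noise P K) :=
  (Measure.pi P.D).prod ((Measure.pi fun _ : Fin n => unifSphere p).prod seeds)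

variable (P : StochasticProblem.{u} n p) (K : RandomMap.{v} p) (seeds : Measure (Fin n → K.S))
  [IsProbabilityMeasure seeds]

lemma noiseLaw_isProbabilityMeasure (hp : 0 < p) : IsProbabilityMeasure (noiseLaw P K seeds) := by
  have := unifSphere_isProbabilityMeasure hp
  unfold noiseLaw
  infer_instance

lemma measurePreserving_sample_direction (hp : 0 < p) (i : Fin n) :
    MeasurePreserving (fun N : Noise P K => (N.1 i, N.2.1 i)) (noiseLaw P K seeds)
      ((P.D i).prod (unifSphere p)) := by
  have := unifSphere_isProbabilityMeasure hp
  have h := (measurePreserving_eval P.D i).prod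
    ((measurePreserving_eval (fun _ : Fin n => unifSphere p) i).comp
      (measurePreserving_fst (μ := Measure.pi fun _ : Fin n => unifSphere p) (ν := seeds)))
  exact h

lemma measurePreserving_seed (hp : 0 < p) (hseeds : ∀ i, seeds.map (fun s => s i) = K.law)
    (i : Fin n) :
    MeasurePreserving (fun N : Noise P K => N.2.2 i) (noiseLaw P K seeds) K.law := by
  have := unifSphere_isProbabilityMeasure hp
  have h1 : MeasurePreserving (fun s : Fin n → K.S => s i) seeds K.law :=
    ⟨measurable_pi_apply i, hseeds i⟩
  exact h1.comp ((measurePreserving_snd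
    (μ := Measure.pi fun _ : Fin n => unifSphere p) (ν := seeds)).comp
      (measurePreserving_snd (μ := Measure.pi P.D)))

lemma indepFun_sample_direction (hp : 0 < p) {i j : Fin n} (hij : i ≠ j) :
    IndepFun (fun N : Noise P K => (N.1 i, N.2.1 i)) (fun N : Noise P K => (N.1 j, N.2.1 j))
      (noiseLaw P K seeds) := by
  have := unifSphere_isProbabilityMeasure hp
  have := noiseLaw_isProbabilityMeasure P K seeds hp
  rw [indepFun_iff_map_prod_eq_prod_map_map
    (measurePreserving_sample_direction P K seeds hp i).measurable.aemeasurable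
    (measurePreserving_sample_direction P K seeds hp j).measurable.aemeasurable,
    (measurePreserving_sample_direction P K seeds hp i).map_eq,
    (measurePreserving_sample_direction P K seeds hp j).map_eq]
  have h := (measurePreserving_eval_pair P.D hij).prod
    ((measurePreserving_eval_pair (fun _ : Fin n => unifSphere p) hij).comp
      (measurePreserving_fst (μ := Measure.pi fun _ : Fin n => unifSphere p) (ν := seeds)))
  exact ((measurePreserving_prod_comm _ _ _ _).comp h).map_eq

end Noise

/-- Second moment of a sum of pairwise independent random vectors: averaging `n` independent
estimators divides the variance by `n`. -/
lemma integral_norm_sum_sq_le {Ω : Type*} [MeasurableSpace Ω] {Q : Measure Ω}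
    [IsProbabilityMeasure Q] {n p : ℕ} {X : Fin n → Ω → Vec p} (hX : ∀ i, MemLp (X i) 2 Q)
    (hind : ∀ i j, i ≠ j → IndepFun (X i) (X j) Q) :
    ∫ s, ‖∑ i, X i s‖ ^ 2 ∂Q
      ≤ ‖∑ i, ∫ s, X i s ∂Q‖ ^ 2 + ∑ i, ∫ s, ‖X i s‖ ^ 2 ∂Q := by
  have hI : ∀ i j, Integrable (fun s => inner ℝ (X i s) (X j s)) Q := fun i j => by
    refine ((hX i).integrable_norm_pow two_ne_zero |>.add
      ((hX j).integrable_norm_pow two_ne_zero)).mono' ((hX i).1.inner (hX j).1)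
      (Filter.Eventually.of_forall fun s => ?_)
    refine (norm_inner_le_norm (𝕜 := ℝ) _ _).trans ?_
    simp only [Pi.add_apply]
    nlinarith [sq_nonneg (‖X i s‖ - ‖X j s‖), sq_nonneg ‖X i s‖, sq_nonneg ‖X j s‖]
  have h1 : ∀ s, ‖∑ i, X i s‖ ^ 2 = ∑ i, ∑ j, inner ℝ (X i s) (X j s) := fun s => by
    rw [← real_inner_self_eq_norm_sq, sum_inner]
    exact Finset.sum_congr rfl fun i _ => inner_sum _ _ _
  have h2 : ∀ i j, ∫ s, inner ℝ (X i s) (X j s) ∂Q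
      ≤ inner ℝ (∫ s, X i s ∂Q) (∫ s, X j s ∂Q)
        + if i = j then ∫ s, ‖X i s‖ ^ 2 ∂Q else 0 := fun i j => by
    by_cases hij : i = j
    · subst hij
      simp only [real_inner_self_eq_norm_sq, if_true]
      linarith [sq_nonneg ‖∫ s, X i s ∂Q‖]
    · rw [if_neg hij, add_zero]
      have h := (hind i j hij).integral_bilin ((hX i).integrable one_le_two)
        ((hX j).integrable one_le_two) (innerSL ℝ)
      exact h.le
  simp_rw [h1]
  rw [integral_finsetSum _ fun i _ => integrable_finsetSum _ fun j _ => hI i j,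
    ← real_inner_self_eq_norm_sq, sum_inner, ← Finset.sum_add_distrib]
  refine Finset.sum_le_sum fun i _ => ?_
  rw [integral_finsetSum _ fun j _ => hI i j, inner_sum]
  refine (Finset.sum_le_sum fun j _ => h2 i j).trans (le_of_eq ?_)
  rw [Finset.sum_add_distrib]
  simp

/-! ### Averages and deviations from the average -/

section Mean

variable {n p : ℕ}

/-- The vectors of all agents as one stacked vector. -/
def stack (x : Fin n → Vec p) : Stack n p := WithLp.toLp 2 x

/-- The stacked deviations from the average. -/
noncomputable def deviation (x : Fin n → Vec p) : Stack n p := stack fun i => x i - meanVec x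

lemma stack_apply (x : Fin n → Vec p) (i : Fin n) : stack x i = x i := rfl

lemma deviation_apply (x : Fin n → Vec p) (i : Fin n) : deviation x i = x i - meanVec x := rfl

lemma norm_stack_sq (x : Fin n → Vec p) : ‖stack x‖ ^ 2 = ∑ i, ‖x i‖ ^ 2 :=
  Stack.norm_sq_eq_sum _

lemma norm_deviation_sq (x : Fin n → Vec p) :
    ‖deviation x‖ ^ 2 = ∑ i, ‖x i - meanVec x‖ ^ 2 :=
  Stack.norm_sq_eq_sum _

lemma sum_eq_smul_meanVec (hn : 0 < n) (x : Fin n → Vec p) : ∑ i, x i = (n : ℝ) • meanVec x := by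
  have : (n : ℝ) ≠ 0 := by positivity
  rw [meanVec, smul_smul, mul_inv_cancel₀ this, one_smul]

lemma sum_deviation (hn : 0 < n) (x : Fin n → Vec p) : ∑ i, deviation x i = 0 := by
  simp only [deviation_apply, Finset.sum_sub_distrib, Finset.sum_const, Finset.card_univ,
    Fintype.card_fin]
  rw [sum_eq_smul_meanVec hn, ← Nat.cast_smul_eq_nsmul ℝ, sub_self]

lemma norm_deviation_le (hn : 0 < n) (x : Fin n → Vec p) : ‖deviation x‖ ≤ ‖stack x‖ := by
  refine abs_le_of_sq_le_sq' ?_ (norm_nonneg _) |>.2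
  rw [norm_deviation_sq, norm_stack_sq]
  have h : ∑ i, ‖x i - meanVec x‖ ^ 2 = ∑ i, ‖x i‖ ^ 2 - n * ‖meanVec x‖ ^ 2 := by
    simp_rw [norm_sub_sq_real]
    rw [Finset.sum_add_distrib, Finset.sum_sub_distrib, ← Finset.mul_sum, ← sum_inner,
      sum_eq_smul_meanVec hn, real_inner_smul_left, real_inner_self_eq_norm_sq]
    simp
    ring
  rw [h]
  linarith [mul_nonneg (Nat.cast_nonneg (α := ℝ) n) (sq_nonneg ‖meanVec x‖)]

lemma norm_meanVec_sq_le (x : Fin n → Vec p) :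
    ‖meanVec x‖ ^ 2 ≤ (n : ℝ)⁻¹ * ∑ i, ‖x i‖ ^ 2 := by
  have h1 : ‖∑ i, x i‖ ^ 2 ≤ n * ∑ i, ‖x i‖ ^ 2 := by
    refine (pow_le_pow_left₀ (norm_nonneg _) (norm_sum_le _ _) 2).trans ?_
    simpa using sq_sum_le_card_mul_sum_sq (s := (Finset.univ : Finset (Fin n)))
      (f := fun i => ‖x i‖)
  rcases Nat.eq_zero_or_pos n with rfl | hn
  · simp [meanVec]
  have hn' : (0 : ℝ) < n := by exact_mod_cast hn
  rw [meanVec, norm_smul, mul_pow, Real.norm_eq_abs, sq_abs]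
  calc (n : ℝ)⁻¹ ^ 2 * ‖∑ i, x i‖ ^ 2 ≤ (n : ℝ)⁻¹ ^ 2 * (n * ∑ i, ‖x i‖ ^ 2) := by gcongr
    _ = _ := by field_simp

lemma WeightedGraph.lapOp_deviation (G : WeightedGraph n) (x : Fin n → Vec p) :
    G.lapOp p (deviation x) = G.lapOp p (stack x) := by
  ext1 i
  have h0 : ∑ j, G.laplacian i j = 0 := by
    rw [← G.sum_laplacian i]
    exact Finset.sum_congr rfl fun j _ => G.laplacian_symm i j
  rw [WeightedGraph.lapOp_apply, WeightedGraph.lapOp_apply]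
  simp only [deviation_apply, stack_apply, smul_sub, Finset.sum_sub_distrib]
  rw [← Finset.sum_smul, h0, zero_smul, sub_zero]

end Mean

/-! ### One iteration -/

section Step

variable {n p : ℕ}

/-- The auxiliary variables agree with the Laplacian of the compressed copies, and the dual
variables sum to zero. Both properties are preserved by the iteration. -/
def AgentState.Consistent (G : WeightedGraph n) (s : AgentState n p) : Prop :=
  (∀ i, s.z i = ∑ j, G.laplacian i j • s.y j) ∧ ∑ i, s.v i = 0

/-- The Lyapunov function `energy` at a state of the algorithm. -/
noncomputable def stateEnergy (G : WeightedGraph n) (b lo : ℝ) (s : AgentState n p) : ℝ :=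
  energy (G.lapOp p) b lo (deviation s.x) (stack s.v) (stack fun i => s.x i - s.y i)

instance : MeasurableSpace (AgentState n p) :=
  MeasurableSpace.comap (fun s => (s.x, s.v, s.y, s.z)) inferInstance

lemma AgentState.measurable_toProd :
    Measurable fun s : AgentState n p => (s.x, s.v, s.y, s.z) := comap_measurable _

@[fun_prop]
lemma AgentState.measurable_x : Measurable (AgentState.x : AgentState n p → _) :=
  measurable_fst.comp AgentState.measurable_toProd

@[fun_prop]
lemma AgentState.measurable_v : Measurable (AgentState.v : AgentState n p → _) :=
  measurable_fst.comp (measurable_snd.comp AgentState.measurable_toProd)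

@[fun_prop]
lemma AgentState.measurable_y : Measurable (AgentState.y : AgentState n p → _) :=
  measurable_fst.comp (measurable_snd.comp (measurable_snd.comp AgentState.measurable_toProd))

@[fun_prop]
lemma AgentState.measurable_z : Measurable (AgentState.z : AgentState n p → _) :=
  measurable_snd.comp (measurable_snd.comp (measurable_snd.comp AgentState.measurable_toProd))

lemma AgentState.measurable_mk {Ω : Type*} {m : MeasurableSpace Ω} {x v y z : Ω → Fin n → Vec p}
    (hx : Measurable x) (hv : Measurable v) (hy : Measurable y) (hz : Measurable z) :
    Measurable fun t => AgentState.mk (x t) (v t) (y t) (z t) := by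
  refine measurable_comap_iff.2 ?_
  exact hx.prodMk (hv.prodMk (hy.prodMk hz))

@[fun_prop]
lemma measurable_stack : Measurable (stack : (Fin n → Vec p) → Stack n p) := by
  have : Continuous (stack : (Fin n → Vec p) → Stack n p) := PiLp.continuous_toLp 2 _
  exact this.measurable

@[fun_prop]
lemma measurable_meanVec : Measurable (meanVec : (Fin n → Vec p) → Vec p) := by
  unfold meanVec; fun_prop

@[fun_prop]
lemma measurable_deviation : Measurable (deviation : (Fin n → Vec p) → Stack n p) := by
  unfold deviation; fun_prop

lemma measurable_stateEnergy (G : WeightedGraph n) (b lo : ℝ) :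
    Measurable (stateEnergy G b lo : AgentState n p → ℝ) := by
  have hL : Measurable (G.lapOp p) := by
    have h1 : ∀ j, Measurable fun x : Stack n p => x j := fun j =>
      (PiLp.continuous_apply 2 _ j).measurable
    exact measurable_stack.comp (measurable_pi_lambda _ fun i =>
      Finset.measurable_fun_sum _ fun j _ => Measurable.fun_const_smul (h1 j) _)
  unfold stateEnergy energy
  fun_prop

variable {P : StochasticProblem.{u} n p} {K : RandomMap.{v} p}

lemma RandomMap.measurable_comp {Ω : Type*} {m : MeasurableSpace Ω} (K : RandomMap.{v} p)
    {f : Ω → Vec p} {g : Ω → K.S} (hf : Measurable f) (hg : Measurable g) :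
    Measurable fun t => K.C (f t) (g t) :=
  K.measurable_C.comp (hf.prodMk hg)

lemma measurable_zoGradient_comp {Ω : Type*} {m : MeasurableSpace Ω} (i : Fin n) (μ : ℝ)
    {f h : Ω → Vec p} {g : Ω → P.Ξ i} (hf : Measurable f) (hg : Measurable g)
    (hh : Measurable h) : Measurable fun t => zoGradient P i μ (f t) (g t) (h t) := by
  have h1 : Measurable fun t => (f t, g t, h t) := hf.prodMk (hg.prodMk hh)
  have h2 := (StochasticProblem.measurable_zoGradient P i μ).comp h1
  rw [Function.comp_def] at h2
  exact h2

lemma measurable_algStep (G : WeightedGraph n) (P : StochasticProblem.{u} n p)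
    (K : RandomMap.{v} p) (a : AlgParams n) (k : ℕ) :
    Measurable fun t : AgentState n p × Noise P K => algStep G P K a k t.2 t.1 := by
  have hx : ∀ i, Measurable fun t : AgentState n p × Noise P K => t.1.x i := fun i =>
    (measurable_pi_apply i).comp (AgentState.measurable_x.comp measurable_fst)
  have hv : ∀ i, Measurable fun t : AgentState n p × Noise P K => t.1.v i := fun i =>
    (measurable_pi_apply i).comp (AgentState.measurable_v.comp measurable_fst)
  have hy : ∀ i, Measurable fun t : AgentState n p × Noise P K => t.1.y i := fun i =>
    (measurable_pi_apply i).comp (AgentState.measurable_y.comp measurable_fst)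
  have hz : ∀ i, Measurable fun t : AgentState n p × Noise P K => t.1.z i := fun i =>
    (measurable_pi_apply i).comp (AgentState.measurable_z.comp measurable_fst)
  have hξ : ∀ i, Measurable fun t : AgentState n p × Noise P K => t.2.1 i := fun i =>
    (measurable_pi_apply i).comp (measurable_fst.comp measurable_snd)
  have hζ : ∀ i, Measurable fun t : AgentState n p × Noise P K => t.2.2.1 i := fun i =>
    (measurable_pi_apply i).comp (measurable_fst.comp (measurable_snd.comp measurable_snd))
  have hseed : ∀ i, Measurable fun t : AgentState n p × Noise P K => t.2.2.2 i := fun i =>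
    (measurable_pi_apply i).comp (measurable_snd.comp (measurable_snd.comp measurable_snd))
  have hq : ∀ i, Measurable fun t : AgentState n p × Noise P K =>
      K.C (t.1.x i - t.1.y i) (t.2.2.2 i) := fun i =>
    K.measurable_comp ((hx i).fun_sub (hy i)) (hseed i)
  have hg : ∀ i, Measurable fun t : AgentState n p × Noise P K =>
      zoGradient P i (a.μ i k) (t.1.x i) (t.2.1 i) (t.2.2.1 i) := fun i =>
    measurable_zoGradient_comp i _ (hx i) (hξ i) (hζ i)
  have hLq : ∀ i, Measurable fun t : AgentState n p × Noise P K =>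
      ∑ j, G.laplacian i j • K.C (t.1.x j - t.1.y j) (t.2.2.2 j) := fun i =>
    Finset.measurable_fun_sum _ fun j _ => (hq j).fun_const_smul _
  have hzq : ∀ i, Measurable fun t : AgentState n p × Noise P K =>
      t.1.z i + ∑ j, G.laplacian i j • K.C (t.1.x j - t.1.y j) (t.2.2.2 j) := fun i =>
    (hz i).fun_add (hLq i)
  have hx' : Measurable fun (t : AgentState n p × Noise P K) (i : Fin n) => t.1.x i
      - (a.α k * a.β k) • (t.1.z i + ∑ j, G.laplacian i j • K.C (t.1.x j - t.1.y j) (t.2.2.2 j))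
      - a.α k • (a.γ k • t.1.v i
        + zoGradient P i (a.μ i k) (t.1.x i) (t.2.1 i) (t.2.2.1 i)) :=
    measurable_pi_lambda _ fun i => ((hx i).fun_sub ((hzq i).fun_const_smul _)).fun_sub
      ((((hv i).fun_const_smul _).fun_add (hg i)).fun_const_smul _)
  have hv' : Measurable fun (t : AgentState n p × Noise P K) (i : Fin n) => t.1.v i
      + (a.α k * a.γ k) • (t.1.z i
        + ∑ j, G.laplacian i j • K.C (t.1.x j - t.1.y j) (t.2.2.2 j)) :=
    measurable_pi_lambda _ fun i => (hv i).fun_add ((hzq i).fun_const_smul _)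
  have hy' : Measurable fun (t : AgentState n p × Noise P K) (i : Fin n) => t.1.y i
      + a.ω • K.C (t.1.x i - t.1.y i) (t.2.2.2 i) :=
    measurable_pi_lambda _ fun i => (hy i).fun_add ((hq i).fun_const_smul _)
  have hz' : Measurable fun (t : AgentState n p × Noise P K) (i : Fin n) => t.1.z i
      + a.ω • ∑ j, G.laplacian i j • K.C (t.1.x j - t.1.y j) (t.2.2.2 j) :=
    measurable_pi_lambda _ fun i => (hz i).fun_add ((hLq i).fun_const_smul _)
  exact AgentState.measurable_mk hx' hv' hy' hz'

/-- The compressed messages of one iteration. -/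
def messages (K : RandomMap.{v} p) (s : AgentState n p) (N : Noise P K) : Fin n → Vec p :=
  fun i => K.C (s.x i - s.y i) (N.2.2 i)

/-- The gradient estimators of one iteration. -/
noncomputable def estimators (P : StochasticProblem.{u} n p) (K : RandomMap.{v} p)
    (a : AlgParams n) (k : ℕ) (s : AgentState n p) (N : Noise P K) : Fin n → Vec p :=
  fun i => zoGradient P i (a.μ i k) (s.x i) (N.1 i) (N.2.1 i)

/-- The compression error of one iteration. -/
def compressionError (K : RandomMap.{v} p) (s : AgentState n p) (N : Noise P K) : Stack n p :=
  stack fun i => messages K s N i - (s.x i - s.y i)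

variable {G : WeightedGraph n} {a : AlgParams n} {k : ℕ} {s : AgentState n p}

lemma z_add_eq_lapOp (hs : s.Consistent G) (N : Noise P K) (i : Fin n) :
    s.z i + ∑ j, G.laplacian i j • messages K s N j
      = G.lapOp p (deviation s.x + compressionError K s N) i := by
  rw [map_add, G.lapOp_deviation, ← map_add, WeightedGraph.lapOp_apply, hs.1 i,
    ← Finset.sum_add_distrib]
  refine Finset.sum_congr rfl fun j _ => ?_
  rw [← smul_add]
  congr 1
  simp only [compressionError, PiLp.add_apply, stack_apply]
  abel

lemma algStep_x (hs : s.Consistent G) (N : Noise P K) (i : Fin n) :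
    (algStep G P K a k N s).x i = s.x i
      - (a.α k * a.β k) • G.lapOp p (deviation s.x + compressionError K s N) i
      - (a.α k * a.γ k) • s.v i - a.α k • estimators P K a k s N i := by
  rw [← z_add_eq_lapOp hs]
  simp only [algStep, messages, estimators]
  module

lemma algStep_v (hs : s.Consistent G) (N : Noise P K) (i : Fin n) :
    (algStep G P K a k N s).v i = s.v i
      + (a.α k * a.γ k) • G.lapOp p (deviation s.x + compressionError K s N) i := by
  rw [← z_add_eq_lapOp hs]
  rfl

lemma meanVec_algStep (hs : s.Consistent G) (N : Noise P K) :
    meanVec (algStep G P K a k N s).x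
      = meanVec s.x - a.α k • meanVec (estimators P K a k s N) := by
  simp only [meanVec, algStep_x hs, Finset.sum_sub_distrib, ← Finset.smul_sum,
    WeightedGraph.sum_lapOp, hs.2]
  module

lemma consistent_algStep (hs : s.Consistent G) (N : Noise P K) :
    (algStep G P K a k N s).Consistent G := by
  constructor
  · intro i
    simp only [algStep, hs.1 i, smul_add, Finset.sum_add_distrib, Finset.smul_sum]
    congr 1
    exact Finset.sum_congr rfl fun j _ => smul_comm _ _ _
  · simp only [algStep_v hs, Finset.sum_add_distrib, ← Finset.smul_sum, WeightedGraph.sum_lapOp,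
      hs.2]
    simp

lemma consistent_algState (x₀ : Fin n → Vec p) (N : ℕ → Noise P K) (k : ℕ) :
    (algState G P K a x₀ N k).Consistent G := by
  induction k with
  | zero => constructor <;> simp [algState]
  | succ k ih => exact consistent_algStep ih (N k)

/-- The iteration in terms of stacked deviations. -/
lemma stateEnergy_algStep (hs : s.Consistent G) (N : Noise P K) {b h lo : ℝ}
    (hβ : a.α k * a.β k = b * h) (hγ : a.α k * a.γ k = h) :
    stateEnergy G b lo (algStep G P K a k N s) = energy (G.lapOp p) b lo
      (deviation s.x - (b * h) • G.lapOp p (deviation s.x + compressionError K s N)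
        - h • stack s.v - deviation fun i => a.α k • estimators P K a k s N i)
      (stack s.v + h • G.lapOp p (deviation s.x + compressionError K s N))
      ((stack fun i => s.x i - s.y i - a.ω • messages K s N i)
        - (b * h) • G.lapOp p (deviation s.x + compressionError K s N) - h • stack s.v
        - stack fun i => a.α k • estimators P K a k s N i) := by
  have hmean : meanVec (fun i => a.α k • estimators P K a k s N i)
      = a.α k • meanVec (estimators P K a k s N) := by
    simp only [meanVec, ← Finset.smul_sum]
    rw [smul_comm]
  rw [stateEnergy]
  congr 1
  · ext1 i
    simp only [PiLp.sub_apply, PiLp.smul_apply, deviation_apply, stack_apply, algStep_x hs,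
      meanVec_algStep hs, hmean, hβ, hγ]
    abel
  · ext1 i
    simp only [PiLp.add_apply, PiLp.smul_apply, stack_apply, algStep_v hs, hγ]
  · ext1 i
    simp only [PiLp.sub_apply, PiLp.smul_apply, stack_apply, algStep_x hs, hβ, hγ]
    simp only [algStep, messages]
    abel

end Step

/-! ### Expected change of the energy in one iteration -/

lemma MeasureTheory.MeasurePreserving.integral_comp_of_aestronglyMeasurable {α β F : Type*}
    [MeasurableSpace α] [MeasurableSpace β] [NormedAddCommGroup F] [NormedSpace ℝ F]
    {μ : Measure α} {ν : Measure β} {φ : α → β} (h : MeasurePreserving φ μ ν) {f : β → F}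
    (hf : AEStronglyMeasurable f ν) : ∫ t, f (φ t) ∂μ = ∫ t, f t ∂ν := by
  have h1 := integral_map h.measurable.aemeasurable (f := f) (by rwa [h.map_eq])
  rw [← h1, h.map_eq]

section Compression

variable {p : ℕ} {K : RandomMap.{v} p} {δ r ω : ℝ}

lemma RandomMap.measurable_apply (K : RandomMap.{v} p) (u : Vec p) : Measurable (K.C u) :=
  K.measurable_comp measurable_const measurable_id

lemma compression_error_bound (hK : K.IsCompressor δ r) (hδ : 0 < δ) (hr : 0 < r) (u : Vec p) :
    Integrable (fun s => ‖K.C u s - u‖ ^ 2) K.law ∧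
      ∫ s, ‖K.C u s - u‖ ^ 2 ∂K.law ≤ (2 * r ^ 2 + 2 * (r - 1) ^ 2) * ‖u‖ ^ 2 := by
  have hpt : ∀ s, ‖K.C u s - u‖ ^ 2
      ≤ 2 * r ^ 2 * ‖r⁻¹ • K.C u s - u‖ ^ 2 + 2 * (r - 1) ^ 2 * ‖u‖ ^ 2 := fun s => by
    have e : K.C u s - u = r • (r⁻¹ • K.C u s - u) + (r - 1) • u := by
      rw [smul_sub, smul_smul, mul_inv_cancel₀ hr.ne', one_smul, sub_smul, one_smul]
      abel
    have h1 := norm_add_le (r • (r⁻¹ • K.C u s - u)) ((r - 1) • u)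
    rw [← e] at h1
    have h2 : ‖K.C u s - u‖ ^ 2 ≤ 2 * (‖r • (r⁻¹ • K.C u s - u)‖ ^ 2 + ‖(r - 1) • u‖ ^ 2) :=
      (pow_le_pow_left₀ (norm_nonneg _) h1 2).trans add_sq_le
    simp only [norm_smul, mul_pow, Real.norm_eq_abs, sq_abs] at h2
    linarith
  have hI := ((hK u).1.const_mul (2 * r ^ 2)).add
    (integrable_const (μ := K.law) (2 * (r - 1) ^ 2 * ‖u‖ ^ 2))
  have hI1 : Integrable (fun s => ‖K.C u s - u‖ ^ 2) K.law := by
    refine hI.mono' (((K.measurable_apply u).sub_const u).norm.pow_const 2).aestronglyMeasurable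
      (Filter.Eventually.of_forall fun s => ?_)
    rw [Real.norm_eq_abs, abs_of_nonneg (by positivity)]
    exact hpt s
  refine ⟨hI1, (integral_mono hI1 hI hpt).trans ?_⟩
  rw [integral_add' ((hK u).1.const_mul (2 * r ^ 2)) (integrable_const _), integral_const_mul]
  simp only [integral_const, probReal_univ, one_smul]
  have h2 := (hK u).2
  have h3 : ∫ s, ‖r⁻¹ • K.C u s - u‖ ^ 2 ∂K.law ≤ ‖u‖ ^ 2 := by nlinarith [sq_nonneg ‖u‖]
  nlinarith [mul_le_mul_of_nonneg_left h3 (by positivity : 0 ≤ 2 * r ^ 2)]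

/-- Moving the compressed copy towards the variable contracts their distance, because
`u - ω C(u)` is a convex combination of `u` and `u - C(u) / r`. -/
lemma compression_contraction (hK : K.IsCompressor δ r) (hr : 0 < r) (hω : 0 < ω)
    (hω' : ω ≤ 1 / r) (u : Vec p) :
    Integrable (fun s => ‖u - ω • K.C u s‖ ^ 2) K.law ∧
      ∫ s, ‖u - ω • K.C u s‖ ^ 2 ∂K.law ≤ (1 - ω * r * δ) * ‖u‖ ^ 2 := by
  have hωr : ω * r ≤ 1 := (le_div_iff₀ hr).1 hω'
  have hωr0 : 0 < ω * r := mul_pos hω hr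
  have hpt : ∀ s, ‖u - ω • K.C u s‖ ^ 2
      ≤ ω * r * ‖r⁻¹ • K.C u s - u‖ ^ 2 + (1 - ω * r) * ‖u‖ ^ 2 := fun s => by
    have e : u - ω • K.C u s = (1 - ω * r) • u - (ω * r) • (r⁻¹ • K.C u s - u) := by
      rw [smul_sub, smul_smul, mul_assoc, mul_inv_cancel₀ hr.ne', mul_one, sub_smul, one_smul]
      abel
    have h1 := norm_sub_le ((1 - ω * r) • u) ((ω * r) • (r⁻¹ • K.C u s - u))
    rw [← e, norm_smul, norm_smul, Real.norm_eq_abs, Real.norm_eq_abs, abs_of_pos hωr0,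
      abs_of_nonneg (by linarith)] at h1
    set A := ‖u‖
    set B := ‖r⁻¹ • K.C u s - u‖
    refine (pow_le_pow_left₀ (norm_nonneg _) h1 2).trans ?_
    have : 0 ≤ ω * r * (1 - ω * r) * (A - B) ^ 2 :=
      mul_nonneg (mul_nonneg hωr0.le (by linarith)) (sq_nonneg _)
    linarith
  have hI := ((hK u).1.const_mul (ω * r)).add
    (integrable_const (μ := K.law) ((1 - ω * r) * ‖u‖ ^ 2))
  have hI1 : Integrable (fun s => ‖u - ω • K.C u s‖ ^ 2) K.law := by
    refine hI.mono' ((((K.measurable_apply u).const_smul ω).const_sub u).norm.pow_const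
      2).aestronglyMeasurable (Filter.Eventually.of_forall fun s => ?_)
    rw [Real.norm_eq_abs, abs_of_nonneg (by positivity)]
    exact hpt s
  refine ⟨hI1, (integral_mono hI1 hI hpt).trans ?_⟩
  rw [integral_add' ((hK u).1.const_mul (ω * r)) (integrable_const _), integral_const_mul]
  simp only [integral_const, probReal_univ, one_smul]
  nlinarith [mul_le_mul_of_nonneg_left (hK u).2 hωr0.le]

end Compression

section Step

variable {n p : ℕ} {P : StochasticProblem.{u} n p} {K : RandomMap.{v} p} {G : WeightedGraph n}
  {a : AlgParams n} {k : ℕ} {s : AgentState n p} {seeds : Measure (Fin n → K.S)}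
  [IsProbabilityMeasure seeds] {δ r ω ℓ η₁ σ₁ : ℝ}

lemma integral_compressionError_sq_le (hp : 0 < p)
    (hseeds : ∀ i, seeds.map (fun t => t i) = K.law) (hK : K.IsCompressor δ r) (hδ : 0 < δ)
    (hr : 0 < r) (s : AgentState n p) :
    Integrable (fun N => ‖compressionError K s N‖ ^ 2) (noiseLaw P K seeds) ∧
      ∫ N, ‖compressionError K s N‖ ^ 2 ∂(noiseLaw P K seeds)
        ≤ (2 * r ^ 2 + 2 * (r - 1) ^ 2) * ‖stack fun i => s.x i - s.y i‖ ^ 2 := by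
  have h1 : ∀ N : Noise P K, ‖compressionError K s N‖ ^ 2
      = ∑ i, ‖K.C (s.x i - s.y i) (N.2.2 i) - (s.x i - s.y i)‖ ^ 2 := fun N => norm_stack_sq _
  have h2 := fun i => compression_error_bound hK hδ hr (s.x i - s.y i)
  have h3 := fun i => measurePreserving_seed P K seeds hp hseeds i
  have h4 : ∀ i, Integrable (fun N : Noise P K =>
      ‖K.C (s.x i - s.y i) (N.2.2 i) - (s.x i - s.y i)‖ ^ 2) (noiseLaw P K seeds) := fun i =>
    (h3 i).integrable_comp_of_integrable (h2 i).1
  simp_rw [h1]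
  refine ⟨integrable_finsetSum _ fun i _ => h4 i, ?_⟩
  rw [integral_finsetSum _ fun i _ => h4 i, norm_stack_sq, Finset.mul_sum]
  refine Finset.sum_le_sum fun i _ => ?_
  have h5 := (h3 i).integral_comp_of_aestronglyMeasurable (h2 i).1.aestronglyMeasurable
  rw [h5]
  exact (h2 i).2

lemma integral_copy_error_sq_le (hp : 0 < p)
    (hseeds : ∀ i, seeds.map (fun t => t i) = K.law) (hK : K.IsCompressor δ r)
    (hr : 0 < r) (hω : 0 < ω) (hω' : ω ≤ 1 / r) (s : AgentState n p) :
    Integrable (fun N => ‖stack fun i => s.x i - s.y i - ω • messages K s N i‖ ^ 2)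
        (noiseLaw P K seeds) ∧
      ∫ N, ‖stack fun i => s.x i - s.y i - ω • messages K s N i‖ ^ 2 ∂(noiseLaw P K seeds)
        ≤ (1 - ω * r * δ) * ‖stack fun i => s.x i - s.y i‖ ^ 2 := by
  have h1 : ∀ N : Noise P K, ‖stack fun i => s.x i - s.y i - ω • messages K s N i‖ ^ 2
      = ∑ i, ‖s.x i - s.y i - ω • K.C (s.x i - s.y i) (N.2.2 i)‖ ^ 2 := fun N => norm_stack_sq _
  have h2 := fun i => compression_contraction hK hr hω hω' (s.x i - s.y i)
  have h3 := fun i => measurePreserving_seed P K seeds hp hseeds i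
  have h4 : ∀ i, Integrable (fun N : Noise P K =>
      ‖s.x i - s.y i - ω • K.C (s.x i - s.y i) (N.2.2 i)‖ ^ 2) (noiseLaw P K seeds) := fun i =>
    (h3 i).integrable_comp_of_integrable (h2 i).1
  simp_rw [h1]
  refine ⟨integrable_finsetSum _ fun i _ => h4 i, ?_⟩
  rw [integral_finsetSum _ fun i _ => h4 i, norm_stack_sq, Finset.mul_sum]
  refine Finset.sum_le_sum fun i _ => ?_
  have h5 := (h3 i).integral_comp_of_aestronglyMeasurable (h2 i).1.aestronglyMeasurable
  rw [h5]
  exact (h2 i).2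

lemma memLp_estimators (hp : 0 < p) (hS : P.Smooth ℓ) (hℓ : 0 ≤ ℓ) (hV : P.BoundedVariance η₁ σ₁)
    (hμ : ∀ i, 0 < a.μ i k) (s : AgentState n p) (i : Fin n) :
    MemLp (fun N => estimators P K a k s N i) 2 (noiseLaw P K seeds) := by
  have h := (StochasticProblem.memLp_two_zoGradient hp hS hℓ hV (hμ i) i
    (s.x i)).comp_measurePreserving (measurePreserving_sample_direction P K seeds hp i)
  rw [Function.comp_def] at h
  exact h

lemma integrable_estimators_sq (hp : 0 < p) (hS : P.Smooth ℓ) (hℓ : 0 ≤ ℓ)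
    (hV : P.BoundedVariance η₁ σ₁) (hμ : ∀ i, 0 < a.μ i k) (s : AgentState n p) (i : Fin n) :
    Integrable (fun N => ‖estimators P K a k s N i‖ ^ 2) (noiseLaw P K seeds) :=
  (memLp_estimators hp hS hℓ hV hμ s i).integrable_norm_pow two_ne_zero

/-- The expected energy contracts by the factor `1 - c` of `exists_step_threshold`, up to the
second moment of the gradient steps. -/
lemma integral_stateEnergy_algStep_le {lo hi H b h c : ℝ} (hn : 0 < n) (hp : 0 < p)
    (hG : G.Connected) (hlo : 0 < lo)
    (hspec : spectrum ℝ G.laplacian ⊆ insert 0 (Set.Icc lo hi)) (hH : 0 < H) (hhiH : |hi| ≤ H)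
    (hseeds : ∀ i, seeds.map (fun t => t i) = K.law) (hK : K.IsCompressor δ r) (hδ : 0 < δ)
    (hr : 0 < r) (hω : 0 < a.ω) (hω' : a.ω ≤ 1 / r)
    (hS : P.Smooth ℓ) (hℓ : 0 ≤ ℓ) (hV : P.BoundedVariance η₁ σ₁) (hμ : ∀ i, 0 < a.μ i k)
    (hb : 0 < b) (hh : 0 < h) (hh1 : h ≤ 1)
    (hβ : a.α k * a.β k = b * h) (hγ : a.α k * a.γ k = h)
    (hc : ∀ S Q W U : ℝ, 0 ≤ Q → 0 ≤ U → S ≤ (1 / lo + 1) * Q → W ≤ S →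
        W - min b (crossWeight b lo) / 4 * h * Q
            + energyConst b lo H (a.ω * r * δ) * (h * ((2 * r ^ 2 + 2 * (r - 1) ^ 2) * U) + h ^ 2 * Q)
            + (1 + a.ω * r * δ / 2) * ((1 - a.ω * r * δ) * U)
          ≤ (1 - c) * (W + U))
    (hs : s.Consistent G) :
    Integrable (fun N => stateEnergy G b lo (algStep G P K a k N s)) (noiseLaw P K seeds) ∧
      ∫ N, stateEnergy G b lo (algStep G P K a k N s) ∂(noiseLaw P K seeds)
        ≤ (1 - c) * stateEnergy G b lo s + energyConst b lo H (a.ω * r * δ) / h * (a.α k ^ 2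
          * ∑ i, ∫ N, ‖estimators P K a k s N i‖ ^ 2 ∂(noiseLaw P K seeds)) := by
  have := noiseLaw_isProbabilityMeasure P K seeds hp
  set ν := noiseLaw P K seeds with hν
  set ρ := a.ω * r * δ with hρ
  have hρ0 : 0 < ρ := by positivity
  have hC := energyConst_pos hb hlo hH hρ0
  set C := energyConst b lo H ρ with hCdef
  set m := min b (crossWeight b lo) / 4 * h with hm
  set X := deviation s.x with hX
  set V := stack s.v with hVdef
  set Q := ‖G.lapOp p X‖ ^ 2 + ‖V‖ ^ 2 with hQ
  set U := ‖stack fun i => s.x i - s.y i‖ ^ 2 with hU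
  set W := energy (G.lapOp p) b lo X V 0 with hW
  have hgap : ∀ x : Fin n → Vec p, lo * ‖deviation x‖ ^ 2
      ≤ inner ℝ (deviation x) (G.lapOp p (deviation x)) := fun x =>
    G.spectral_gap hG hspec (sum_deviation hn x)
  have hsb := fun x : Stack n p => G.spectral_bounds hlo hspec x
  have hLH : ∀ x : Stack n p, ‖G.lapOp p x‖ ≤ H * ‖x‖ := fun x =>
    (hsb x).2.2.trans (mul_le_mul_of_nonneg_right hhiH (norm_nonneg _))
  -- pathwise bound
  have hpath : ∀ N : Noise P K, stateEnergy G b lo (algStep G P K a k N s)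
      ≤ (W - m * Q + C * (h ^ 2 * Q)) + C * h * ‖compressionError K s N‖ ^ 2
        + C / h * (a.α k ^ 2 * ∑ i, ‖estimators P K a k s N i‖ ^ 2)
        + (1 + ρ / 2) * ‖stack fun i => s.x i - s.y i - a.ω • messages K s N i‖ ^ 2 := fun N => by
    rw [stateEnergy_algStep hs N hβ hγ]
    have h1 := energy_step G.lapOp_isSymmetric hb hlo hH hh hh1 hρ0 hLH (hsb X).2.1 V
      (compressionError K s N) (deviation fun i => a.α k • estimators P K a k s N i)
      (stack fun i => a.α k • estimators P K a k s N i)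
      (stack fun i => s.x i - s.y i - a.ω • messages K s N i) (norm_deviation_le hn _)
    have h2 : ‖stack fun i => a.α k • estimators P K a k s N i‖ ^ 2
        = a.α k ^ 2 * ∑ i, ‖estimators P K a k s N i‖ ^ 2 := by
      rw [norm_stack_sq, Finset.mul_sum]
      exact Finset.sum_congr rfl fun i _ => by
        rw [norm_smul, mul_pow, Real.norm_eq_abs, sq_abs]
    rw [h2] at h1
    refine h1.trans (le_of_eq ?_)
    simp only [← hW, ← hQ, ← hCdef, ← hm]
    ring
  obtain ⟨hE1, hE2⟩ := integral_compressionError_sq_le (P := P) hp hseeds hK hδ hr s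
  obtain ⟨hF1, hF2⟩ := integral_copy_error_sq_le (P := P) hp hseeds hK hr hω hω' s
  have hGi : Integrable (fun N => ∑ i, ‖estimators P K a k s N i‖ ^ 2) ν :=
    integrable_finsetSum _ fun i _ => integrable_estimators_sq hp hS hℓ hV hμ s i
  have hI0 : Integrable (fun _ : Noise P K => W - m * Q + C * (h ^ 2 * Q)) ν := integrable_const _
  have hI1 := hE1.const_mul (C * h)
  have hI2 := (hGi.const_mul (a.α k ^ 2)).const_mul (C / h)
  have hI3 := hF1.const_mul (1 + ρ / 2)
  have hI01 := hI0.add hI1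
  have hI012 := hI01.add hI2
  have hI := hI012.add hI3
  have hmeas : Measurable fun N => stateEnergy G b lo (algStep G P K a k N s) :=
    (measurable_stateEnergy G b lo).comp ((measurable_algStep G P K a k).comp measurable_prodMk_left)
  have hnn : ∀ s' : AgentState n p, 0 ≤ stateEnergy G b lo s' := fun s' => by
    refine le_trans ?_ (le_energy hb hlo (hgap s'.x))
    have := (hsb (deviation s'.x)).1
    positivity
  have hint : Integrable (fun N => stateEnergy G b lo (algStep G P K a k N s)) ν := by
    refine hI.mono' hmeas.aestronglyMeasurable (Filter.Eventually.of_forall fun N => ?_)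
    rw [Real.norm_eq_abs, abs_of_nonneg (hnn _)]
    exact hpath N
  refine ⟨hint, (integral_mono hint hI hpath).trans ?_⟩
  rw [integral_add' hI012 hI3, integral_add' hI01 hI2, integral_add' hI0 hI1, integral_const_mul,
    integral_const_mul, integral_const_mul, integral_const_mul,
    integral_finsetSum _ fun i _ => integrable_estimators_sq hp hS hℓ hV hμ s i]
  simp only [integral_const, probReal_univ, one_smul]
  have hWS : W ≤ inner ℝ X (G.lapOp p X) + ‖V‖ ^ 2 := by
    have := energy_le (L := G.lapOp p) (v := V) (u := 0) hb hlo (hgap s.x)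
    simpa using this
  have hSQ : inner ℝ X (G.lapOp p X) + ‖V‖ ^ 2 ≤ (1 / lo + 1) * Q := by
    have h1 : inner ℝ X (G.lapOp p X) ≤ ‖G.lapOp p X‖ ^ 2 / lo := by
      rw [le_div_iff₀ hlo]; linarith [(hsb X).2.1]
    have h2 : 0 ≤ ‖V‖ ^ 2 / lo := by positivity
    have h3 := sq_nonneg ‖G.lapOp p X‖
    have h4 : (1 / lo + 1) * Q
        = ‖G.lapOp p X‖ ^ 2 / lo + ‖V‖ ^ 2 / lo + ‖G.lapOp p X‖ ^ 2 + ‖V‖ ^ 2 := by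
      rw [hQ]; ring
    rw [h4]; linarith
  have hfin := hc _ Q W U (by positivity) (by positivity) hSQ hWS
  have hWU : stateEnergy G b lo s = W + U := by
    simp only [stateEnergy, hW, hU, energy, norm_zero]
    ring
  have hE3 := mul_le_mul_of_nonneg_left hE2 (by positivity : 0 ≤ C * h)
  have hF3 := mul_le_mul_of_nonneg_left hF2 (by positivity : 0 ≤ 1 + ρ / 2)
  rw [hWU]
  linarith

end Step

/-! ### Expected change of the cost in one iteration -/

/-- Bound of the second moment of the gradient estimators, per dimension. -/
noncomputable def estimatorConst (c : CostConstants) (κμ : ℝ) : ℝ :=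
  4 * ((c.η₁ ^ 2 + 1) * (8 * c.ℓ + 8 * c.ℓ * c.gap + 2 * c.ℓ ^ 2) + c.σ₁ ^ 2)
    + 2 * c.ℓ ^ 2 * κμ ^ 2

lemma estimatorConst_pos {c : CostConstants} (hℓ : 0 < c.ℓ) (hgap : 0 ≤ c.gap) (κμ : ℝ) :
    0 < estimatorConst c κμ := by
  unfold estimatorConst
  have : 0 < (c.η₁ ^ 2 + 1) * (8 * c.ℓ + 8 * c.ℓ * c.gap + 2 * c.ℓ ^ 2) := by positivity
  positivity

/-- Constant of the error terms in the expected decrease of the cost. It does not involve the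
network, the compressor or the step size parameters. -/
noncomputable def descentConst (c : CostConstants) (κμ : ℝ) : ℝ :=
  c.ℓ ^ 2 * κμ ^ 2 + c.ℓ * estimatorConst c κμ + c.ℓ ^ 2

lemma descentConst_pos {c : CostConstants} (hℓ : 0 < c.ℓ) (hgap : 0 ≤ c.gap) (κμ : ℝ) :
    0 < descentConst c κμ := by
  have := estimatorConst_pos hℓ hgap κμ
  unfold descentConst
  positivity

lemma norm_add_sq_le_two {E : Type*} [SeminormedAddCommGroup E] (x y : E) :
    ‖x + y‖ ^ 2 ≤ 2 * (‖x‖ ^ 2 + ‖y‖ ^ 2) :=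
  (pow_le_pow_left₀ (norm_nonneg _) (norm_add_le x y) 2).trans add_sq_le

section Descent

variable {n p : ℕ} {P : StochasticProblem.{u} n p} {K : RandomMap.{v} p} {G : WeightedGraph n}
  {a : AlgParams n} {k : ℕ} {s : AgentState n p} {seeds : Measure (Fin n → K.S)}
  [IsProbabilityMeasure seeds] {c : CostConstants} {κμ : ℝ}

lemma mean_norm_gradient_sq_le (hS : P.Smooth c.ℓ) (hℓ : 0 < c.ℓ) (hB : P.LowerBounded)
    (hD : P.costInf - (n : ℝ)⁻¹ * ∑ i, P.localInf i ≤ c.gap) (x : Fin n → Vec p) :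
    (n : ℝ)⁻¹ * ∑ i, ‖gradient (P.localCost i) (x i)‖ ^ 2
      ≤ 8 * c.ℓ * ((P.cost (meanVec x) - P.costInf) + c.gap)
        + 2 * c.ℓ ^ 2 * ((n : ℝ)⁻¹ * ‖deviation x‖ ^ 2) := by
  have h1 : ∀ i, ‖gradient (P.localCost i) (x i)‖ ^ 2
      ≤ 2 * ‖gradient (P.localCost i) (meanVec x)‖ ^ 2
        + 2 * c.ℓ ^ 2 * ‖x i - meanVec x‖ ^ 2 := fun i => by
    have h := norm_add_sq_le_two (gradient (P.localCost i) (meanVec x))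
      (gradient (P.localCost i) (x i) - gradient (P.localCost i) (meanVec x))
    rw [add_sub_cancel] at h
    have h2 := pow_le_pow_left₀ (norm_nonneg _)
      (StochasticProblem.norm_gradient_localCost_sub_le hS hℓ.le i (x i) (meanVec x)) 2
    rw [mul_pow] at h2
    linarith
  have h2 := StochasticProblem.sum_norm_gradient_sq_le hS hℓ hB hD (meanVec x)
  have h3 : (n : ℝ)⁻¹ * ∑ i, ‖gradient (P.localCost i) (x i)‖ ^ 2
      ≤ (n : ℝ)⁻¹ * ∑ i, (2 * ‖gradient (P.localCost i) (meanVec x)‖ ^ 2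
        + 2 * c.ℓ ^ 2 * ‖x i - meanVec x‖ ^ 2) :=
    mul_le_mul_of_nonneg_left (Finset.sum_le_sum fun i _ => h1 i) (by positivity)
  rw [Finset.sum_add_distrib, ← Finset.mul_sum, ← Finset.mul_sum, ← norm_deviation_sq] at h3
  linarith

lemma mean_integral_estimators_sq_le (hn : 0 < n) (hp : 0 < p) (hS : P.Smooth c.ℓ) (hℓ : 0 < c.ℓ)
    (hV : P.BoundedVariance c.η₁ c.σ₁) (hB : P.LowerBounded)
    (hD : P.costInf - (n : ℝ)⁻¹ * ∑ i, P.localInf i ≤ c.gap)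
    (hbdd : BddBelow (Set.range P.cost))
    (hμ : ∀ i, 0 < a.μ i k) (hμp : ∀ i, (p : ℝ) ^ 2 * a.μ i k ^ 2 ≤ κμ ^ 2 * p)
    (s : AgentState n p) :
    (n : ℝ)⁻¹ * ∑ i, ∫ N, ‖estimators P K a k s N i‖ ^ 2 ∂(noiseLaw P K seeds)
      ≤ p * estimatorConst c κμ * ((P.cost (meanVec s.x) - P.costInf)
        + (n : ℝ)⁻¹ * ‖deviation s.x‖ ^ 2 + 1) := by
  have hp' : (0 : ℝ) < p := by exact_mod_cast hp
  have hn' : (0 : ℝ) < n := by exact_mod_cast hn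
  have hgap : 0 ≤ c.gap := (StochasticProblem.gap_nonneg hB).trans hD
  have hΔ : 0 ≤ P.cost (meanVec s.x) - P.costInf :=
    sub_nonneg.2 (StochasticProblem.costInf_le hbdd _)
  have h1 : ∀ i, ∫ N, ‖estimators P K a k s N i‖ ^ 2 ∂(noiseLaw P K seeds)
      ≤ 4 * p * (c.η₁ ^ 2 + 1) * ‖gradient (P.localCost i) (s.x i)‖ ^ 2
        + (4 * p * c.σ₁ ^ 2 + 2 * c.ℓ ^ 2 * κμ ^ 2 * p) := fun i => by
    have e := (measurePreserving_sample_direction P K seeds hp i).integral_comp_of_aestronglyMeasurable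
      (StochasticProblem.integrable_norm_zoGradient_sq hp hS hℓ.le hV (hμ i) i
        (s.x i)).aestronglyMeasurable
    have h := StochasticProblem.integral_norm_zoGradient_sq_le hp hS hℓ.le hV (hμ i) i (s.x i)
    rw [← e] at h
    refine h.trans ?_
    have := mul_le_mul_of_nonneg_left (hμp i) (by positivity : 0 ≤ 2 * c.ℓ ^ 2)
    linarith
  have h2 : (n : ℝ)⁻¹ * ∑ i, ∫ N, ‖estimators P K a k s N i‖ ^ 2 ∂(noiseLaw P K seeds)
      ≤ (n : ℝ)⁻¹ * ∑ i, (4 * p * (c.η₁ ^ 2 + 1) * ‖gradient (P.localCost i) (s.x i)‖ ^ 2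
        + (4 * p * c.σ₁ ^ 2 + 2 * c.ℓ ^ 2 * κμ ^ 2 * p)) :=
    mul_le_mul_of_nonneg_left (Finset.sum_le_sum fun i _ => h1 i) (by positivity)
  rw [Finset.sum_add_distrib, ← Finset.mul_sum, Finset.sum_const, Finset.card_univ,
    Fintype.card_fin, nsmul_eq_mul, mul_add, ← mul_assoc (n : ℝ)⁻¹ (n : ℝ),
    inv_mul_cancel₀ hn'.ne', one_mul, mul_left_comm] at h2
  have h3 := mul_le_mul_of_nonneg_left (mean_norm_gradient_sq_le hS hℓ hB hD s.x)
    (by positivity : 0 ≤ 4 * p * (c.η₁ ^ 2 + 1))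
  have hcons : 0 ≤ (n : ℝ)⁻¹ * ‖deviation s.x‖ ^ 2 := by positivity
  set Δ := P.cost (meanVec s.x) - P.costInf
  set co := (n : ℝ)⁻¹ * ‖deviation s.x‖ ^ 2
  refine h2.trans ((add_le_add_left h3 _).trans ?_)
  unfold estimatorConst
  -- what is left is a sum of products of nonnegative quantities
  have k1 : 0 ≤ p * (4 * ((c.η₁ ^ 2 + 1) * (8 * c.ℓ) * (co + 1) + (c.η₁ ^ 2 + 1)
      * (8 * c.ℓ * c.gap) * (Δ + co) + (c.η₁ ^ 2 + 1) * (2 * c.ℓ ^ 2) * (Δ + 1)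
      + c.σ₁ ^ 2 * (Δ + co)) + 2 * c.ℓ ^ 2 * κμ ^ 2 * (Δ + co)) := by positivity
  nlinarith [k1]

/-- The average of the estimators has a bias controlled by the exploration parameters and by the
consensus error. -/
lemma norm_mean_integral_estimators_sub_sq_le (hn : 0 < n) (hp : 0 < p) (hS : P.Smooth c.ℓ)
    (hℓ : 0 < c.ℓ) (hV : P.BoundedVariance c.η₁ c.σ₁) {α : ℝ}
    (hμ : ∀ i, 0 < a.μ i k) (hμn : ∀ i, a.μ i k ^ 2 ≤ κμ ^ 2 * (α * (p / n)))
    (s : AgentState n p) :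
    ‖meanVec (fun i => ∫ N, estimators P K a k s N i ∂(noiseLaw P K seeds))
        - gradient P.cost (meanVec s.x)‖ ^ 2
      ≤ 2 * c.ℓ ^ 2 * (κμ ^ 2 * (α * (p / n)) + (n : ℝ)⁻¹ * ‖deviation s.x‖ ^ 2) := by
  have hn' : (0 : ℝ) < n := by exact_mod_cast hn
  have e1 : meanVec (fun i => ∫ N, estimators P K a k s N i ∂(noiseLaw P K seeds))
        - gradient P.cost (meanVec s.x)
      = meanVec fun i => ∫ N, estimators P K a k s N i ∂(noiseLaw P K seeds)
        - gradient (P.localCost i) (meanVec s.x) := by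
    rw [StochasticProblem.gradient_cost hS hℓ.le]
    simp only [meanVec, Finset.sum_sub_distrib, smul_sub]
  rw [e1]
  refine (norm_meanVec_sq_le _).trans ?_
  have h1 : ∀ i, ‖∫ N, estimators P K a k s N i ∂(noiseLaw P K seeds)
        - gradient (P.localCost i) (meanVec s.x)‖ ^ 2
      ≤ 2 * c.ℓ ^ 2 * (κμ ^ 2 * (α * (p / n))) + 2 * c.ℓ ^ 2 * ‖s.x i - meanVec s.x‖ ^ 2 :=
    fun i => by
    have e := (measurePreserving_sample_direction P K seeds hp i).integral_comp_of_aestronglyMeasurable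
      (StochasticProblem.integrable_zoGradient hp hS hℓ.le hV (hμ i) i
        (s.x i)).aestronglyMeasurable
    have h := StochasticProblem.norm_integral_zoGradient_sub_gradient_le hp hS hℓ.le hV (hμ i) i
      (s.x i)
    rw [← e] at h
    change ‖∫ N, estimators P K a k s N i ∂(noiseLaw P K seeds)
      - gradient (P.localCost i) (s.x i)‖ ≤ _ at h
    have h2 := norm_add_sq_le_two (∫ N, estimators P K a k s N i ∂(noiseLaw P K seeds)
      - gradient (P.localCost i) (s.x i))
      (gradient (P.localCost i) (s.x i) - gradient (P.localCost i) (meanVec s.x))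
    rw [sub_add_sub_cancel] at h2
    have h3 := pow_le_pow_left₀ (norm_nonneg _)
      (StochasticProblem.norm_gradient_localCost_sub_le hS hℓ.le i (s.x i) (meanVec s.x)) 2
    have h4 := pow_le_pow_left₀ (norm_nonneg _) h 2
    rw [mul_pow] at h3 h4
    have h5 := mul_le_mul_of_nonneg_left (hμn i) (sq_nonneg c.ℓ)
    linarith
  have h2 := mul_le_mul_of_nonneg_left (Finset.sum_le_sum fun i (_ : i ∈ Finset.univ) => h1 i)
    (by positivity : 0 ≤ (n : ℝ)⁻¹)
  refine h2.trans (le_of_eq ?_)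
  rw [Finset.sum_add_distrib, Finset.sum_const, Finset.card_univ, Fintype.card_fin, nsmul_eq_mul,
    ← Finset.mul_sum, ← norm_deviation_sq]
  field_simp

/-- The variance of the average of the estimators is the `n`-th part of the average second
moment, since the agents sample independently. -/
lemma integral_norm_meanVec_estimators_sq_le (hn : 0 < n) (hp : 0 < p) (hS : P.Smooth c.ℓ)
    (hℓ : 0 < c.ℓ) (hV : P.BoundedVariance c.η₁ c.σ₁) (hμ : ∀ i, 0 < a.μ i k)
    (s : AgentState n p) :
    ∫ N, ‖meanVec (estimators P K a k s N)‖ ^ 2 ∂(noiseLaw P K seeds)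
      ≤ ‖meanVec (fun i => ∫ N, estimators P K a k s N i ∂(noiseLaw P K seeds))‖ ^ 2
        + (n : ℝ)⁻¹ * ((n : ℝ)⁻¹
          * ∑ i, ∫ N, ‖estimators P K a k s N i‖ ^ 2 ∂(noiseLaw P K seeds)) := by
  have := noiseLaw_isProbabilityMeasure P K seeds hp
  have hind : ∀ i j, i ≠ j → IndepFun (fun N => estimators P K a k s N i)
      (fun N => estimators P K a k s N j) (noiseLaw P K seeds) := fun i j hij => by
    have hm : ∀ i, Measurable fun t : P.Ξ i × Vec p => zoGradient P i (a.μ i k) (s.x i) t.1 t.2 :=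
      fun i => measurable_zoGradient_comp i _ measurable_const measurable_fst measurable_snd
    have h := (indepFun_sample_direction P K seeds hp hij).comp (hm i) (hm j)
    rw [Function.comp_def, Function.comp_def] at h
    exact h
  have h := integral_norm_sum_sq_le
    (fun i => memLp_estimators (K := K) (seeds := seeds) hp hS hℓ.le hV hμ s i) hind
  have e : ∀ w : Fin n → Vec p, ‖meanVec w‖ ^ 2 = (n : ℝ)⁻¹ ^ 2 * ‖∑ i, w i‖ ^ 2 := fun w => by
    rw [meanVec, norm_smul, mul_pow, Real.norm_eq_abs, sq_abs]
  simp_rw [e]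
  rw [integral_const_mul]
  have h2 := mul_le_mul_of_nonneg_left h (by positivity : 0 ≤ (n : ℝ)⁻¹ ^ 2)
  linarith

lemma integral_cost_algStep_le {ν α : ℝ} (hn : 0 < n) (hp : 0 < p) (hS : P.Smooth c.ℓ)
    (hℓ : 0 < c.ℓ) (hV : P.BoundedVariance c.η₁ c.σ₁) (hB : P.LowerBounded)
    (hD : P.costInf - (n : ℝ)⁻¹ * ∑ i, P.localInf i ≤ c.gap) (hPL : P.PolyakLojasiewicz ν)
    (hα : a.α k = α) (hα0 : 0 < α) (hℓα : 2 * c.ℓ * α ≤ 1) (hpα : p * α ≤ 1)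
    (hμ : ∀ i, 0 < a.μ i k) (hμp : ∀ i, (p : ℝ) ^ 2 * a.μ i k ^ 2 ≤ κμ ^ 2 * p)
    (hμn : ∀ i, a.μ i k ^ 2 ≤ κμ ^ 2 * (α * (p / n))) (hs : s.Consistent G) :
    Integrable (fun N => P.cost (meanVec (algStep G P K a k N s).x) - P.costInf)
        (noiseLaw P K seeds) ∧
      ∫ N, (P.cost (meanVec (algStep G P K a k N s).x) - P.costInf) ∂(noiseLaw P K seeds)
        ≤ (1 - α * ν) * (P.cost (meanVec s.x) - P.costInf)
          + descentConst c κμ * (α ^ 2 * (p / n)) * ((P.cost (meanVec s.x) - P.costInf) + 1)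
          + α * descentConst c κμ * ((n : ℝ)⁻¹ * ‖deviation s.x‖ ^ 2) := by
  have := noiseLaw_isProbabilityMeasure P K seeds hp
  have hp' : (0 : ℝ) < p := by exact_mod_cast hp
  have hn' : (1 : ℝ) ≤ n := by exact_mod_cast hn
  set ρ := noiseLaw P K seeds with hρ
  have hgap : 0 ≤ c.gap := (StochasticProblem.gap_nonneg hB).trans hD
  have hA := estimatorConst_pos hℓ hgap κμ
  have hd := StochasticProblem.differentiable_cost hS hℓ.le
  have hL := StochasticProblem.norm_gradient_cost_sub_le hS hℓ.le hn
  have hΔ0 : ∀ x, 0 ≤ P.cost x - P.costInf := fun x =>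
    sub_nonneg.2 (StochasticProblem.costInf_le hPL.1 x)
  set xb := meanVec s.x with hxb
  set g := gradient P.cost xb with hg
  set Δ := P.cost xb - P.costInf with hΔ
  set co := (n : ℝ)⁻¹ * ‖deviation s.x‖ ^ 2 with hco
  have hco0 : 0 ≤ co := by positivity
  -- descent along the averaged estimator
  have hpath : ∀ N, P.cost (meanVec (algStep G P K a k N s).x) - P.costInf
      ≤ (Δ - α * inner ℝ g (meanVec (estimators P K a k s N)))
        + c.ℓ * α ^ 2 * ‖meanVec (estimators P K a k s N)‖ ^ 2 := fun N => by
    rw [meanVec_algStep hs, hα]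
    have h := (abs_le.1 (abs_sub_sub_inner_le hd hL hℓ.le xb
      (xb - α • meanVec (estimators P K a k s N)))).2
    rw [sub_sub_cancel_left, inner_neg_right, real_inner_smul_right, norm_neg, norm_smul, mul_pow,
      Real.norm_eq_abs, sq_abs] at h
    rw [hΔ]
    linarith
  have hLp := fun i => memLp_estimators (K := K) (seeds := seeds) hp hS hℓ.le hV hμ s i
  have hLpm : MemLp (fun N => meanVec (estimators P K a k s N)) 2 ρ := by
    have h := (memLp_finsetSum Finset.univ fun i _ => hLp i).const_smul ((n : ℝ)⁻¹)
    exact h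
  have hIm := hLpm.integrable one_le_two
  have hI2 := hLpm.integrable_norm_pow two_ne_zero
  have hmean : ∫ N, meanVec (estimators P K a k s N) ∂ρ
      = meanVec fun i => ∫ N, estimators P K a k s N i ∂ρ := by
    simp only [meanVec]
    rw [integral_smul, integral_finsetSum _ fun i _ => (hLp i).integrable one_le_two]
  set m := meanVec fun i => ∫ N, estimators P K a k s N i ∂ρ with hm
  have hIin : Integrable (fun N => inner ℝ g (meanVec (estimators P K a k s N))) ρ :=
    hIm.const_inner g
  have hJ1 : Integrable (fun N => Δ - α * inner ℝ g (meanVec (estimators P K a k s N))) ρ :=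
    (integrable_const Δ).sub (hIin.const_mul α)
  have hJ2 := hI2.const_mul (c.ℓ * α ^ 2)
  have hmeas : Measurable fun N => P.cost (meanVec (algStep G P K a k N s).x) - P.costInf := by
    have h1 : Measurable fun N => meanVec (algStep G P K a k N s).x :=
      measurable_meanVec.comp (AgentState.measurable_x.comp
        ((measurable_algStep G P K a k).comp measurable_prodMk_left))
    exact (hd.continuous.measurable.comp h1).sub_const _
  have hint : Integrable (fun N => P.cost (meanVec (algStep G P K a k N s).x) - P.costInf) ρ := by
    refine (hJ1.add hJ2).mono' hmeas.aestronglyMeasurable (Filter.Eventually.of_forall fun N => ?_)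
    rw [Real.norm_eq_abs, abs_of_nonneg (hΔ0 _)]
    exact hpath N
  refine ⟨hint, (integral_mono hint (hJ1.add hJ2) hpath).trans ?_⟩
  rw [integral_add' hJ1 hJ2, integral_sub (integrable_const Δ) (hIin.const_mul α),
    integral_const_mul, integral_const_mul, integral_inner hIm, hmean]
  simp only [integral_const, probReal_univ, one_smul]
  have hvar := integral_norm_meanVec_estimators_sq_le (K := K) (seeds := seeds) hn hp hS hℓ hV hμ s
  have hsec := mean_integral_estimators_sq_le (K := K) (seeds := seeds) (κμ := κμ) hn hp hS hℓ hV hB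
    hD hPL.1 hμ hμp s
  have hbias := norm_mean_integral_estimators_sub_sq_le (K := K) (seeds := seeds) hn hp hS hℓ hV hμ
    hμn s
  simp only [← hρ, ← hxb, ← hΔ, ← hco] at hvar hsec hbias
  rw [← hm, ← hg] at hbias
  rw [← hm] at hvar
  have hpl : ν * Δ ≤ 1 / 2 * ‖g‖ ^ 2 := hPL.2 xb
  have hpol : -(α * inner ℝ g m) = -(α / 2) * ‖g‖ ^ 2 - α / 2 * ‖m‖ ^ 2 + α / 2 * ‖m - g‖ ^ 2 := by
    rw [norm_sub_sq_real, real_inner_comm]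
    ring
  have t1 : c.ℓ * α ^ 2 * ‖m‖ ^ 2 ≤ α / 2 * ‖m‖ ^ 2 := by
    have : 0 ≤ (1 - 2 * c.ℓ * α) * (α / 2 * ‖m‖ ^ 2) := mul_nonneg (by linarith) (by positivity)
    linarith
  have t2 := mul_le_mul_of_nonneg_left hvar (by positivity : 0 ≤ c.ℓ * α ^ 2)
  have t3 := mul_le_mul_of_nonneg_left hsec (by positivity : 0 ≤ c.ℓ * α ^ 2 * (n : ℝ)⁻¹)
  have t4 := mul_le_mul_of_nonneg_left hbias (by positivity : 0 ≤ α / 2)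
  have t5 := mul_le_mul_of_nonneg_left hpl hα0.le
  set A := estimatorConst c κμ with hAdef
  have hpn : α * (p / n) ≤ 1 := by
    have : (p : ℝ) / n ≤ p := div_le_self hp'.le hn'
    nlinarith
  have t6 : c.ℓ * α ^ 2 * (n : ℝ)⁻¹ * (p * A * co) ≤ α * (c.ℓ * A) * co := by
    have : c.ℓ * α ^ 2 * (n : ℝ)⁻¹ * (p * A * co) = α * (p / n) * (α * (c.ℓ * A) * co) := by ring
    rw [this]
    exact mul_le_of_le_one_left (by positivity) hpn
  have e3 : c.ℓ * α ^ 2 * (n : ℝ)⁻¹ * (p * A * (Δ + co + 1))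
      = c.ℓ * A * (α ^ 2 * (p / n)) * (Δ + 1) + c.ℓ * α ^ 2 * (n : ℝ)⁻¹ * (p * A * co) := by ring
  rw [e3] at t3
  have r1 : 0 ≤ (c.ℓ ^ 2 * κμ ^ 2 + c.ℓ ^ 2) * (α ^ 2 * (p / n)) * Δ := by
    have := hΔ0 xb
    positivity
  have r2 : 0 ≤ c.ℓ ^ 2 * (α ^ 2 * (p / n)) := by positivity
  have r3 : 0 ≤ α * (c.ℓ ^ 2 * κμ ^ 2) * co := by positivity
  unfold descentConst
  rw [← hAdef]
  linarith

end Descent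

/-! ### From one iteration to the expected trajectory -/

/-- If `Z` is independent of `X`, the expectation of `Φ (X, Z)` is bounded by integrating first over
the law of `Z`. -/
lemma integral_le_of_indepFun {Ω S N : Type*} [MeasurableSpace Ω] [MeasurableSpace S]
    [MeasurableSpace N] {Q : Measure Ω} [IsProbabilityMeasure Q] {X : Ω → S} {Z : Ω → N}
    (hX : Measurable X) (hZ : Measurable Z) (hind : IndepFun X Z Q) {Φ : S × N → ℝ}
    (hΦ : Measurable Φ) (hΦ0 : ∀ t, 0 ≤ Φ t) {Ψ : Ω → ℝ} (hΨ : Integrable Ψ Q)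
    (h : ∀ t, Integrable (fun z => Φ (X t, z)) (Q.map Z) ∧
      ∫ z, Φ (X t, z) ∂(Q.map Z) ≤ Ψ t) :
    Integrable (fun t => Φ (X t, Z t)) Q ∧ ∫ t, Φ (X t, Z t) ∂Q ≤ ∫ t, Ψ t ∂Q := by
  have : IsProbabilityMeasure (Q.map Z) := Measure.isProbabilityMeasure_map hZ.aemeasurable
  have : IsProbabilityMeasure (Q.map X) := Measure.isProbabilityMeasure_map hX.aemeasurable
  have hmap := (indepFun_iff_map_prod_eq_prod_map_map hX.aemeasurable hZ.aemeasurable).1 hind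
  have hΨ0 : ∀ t, 0 ≤ Ψ t := fun t => (integral_nonneg fun z => hΦ0 _).trans (h t).2
  have hXZ : Measurable fun t => (X t, Z t) := hX.prodMk hZ
  have hofΦ : Measurable fun t => ENNReal.ofReal (Φ t) := hΦ.ennreal_ofReal
  have h1 : ∫⁻ t, ENNReal.ofReal (Φ (X t, Z t)) ∂Q ≤ ∫⁻ t, ENNReal.ofReal (Ψ t) ∂Q := by
    calc ∫⁻ t, ENNReal.ofReal (Φ (X t, Z t)) ∂Q
        = ∫⁻ t, ENNReal.ofReal (Φ t) ∂((Q.map X).prod (Q.map Z)) := by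
          rw [← hmap, lintegral_map hofΦ hXZ]
      _ = ∫⁻ x, ∫⁻ z, ENNReal.ofReal (Φ (x, z)) ∂(Q.map Z) ∂(Q.map X) :=
          lintegral_prod _ hofΦ.aemeasurable
      _ = ∫⁻ t, ∫⁻ z, ENNReal.ofReal (Φ (X t, z)) ∂(Q.map Z) ∂Q :=
          lintegral_map hofΦ.lintegral_prod_right' hX
      _ ≤ _ := by
          refine lintegral_mono fun t => ?_
          rw [← ofReal_integral_eq_lintegral_ofReal (h t).1
            (Filter.Eventually.of_forall fun z => hΦ0 _)]
          exact ENNReal.ofReal_le_ofReal (h t).2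
  have hΨfin : ∫⁻ t, ENNReal.ofReal (Ψ t) ∂Q ≠ ⊤ := by
    rw [← ofReal_integral_eq_lintegral_ofReal hΨ (Filter.Eventually.of_forall hΨ0)]
    exact ENNReal.ofReal_ne_top
  have hm : AEStronglyMeasurable (fun t => Φ (X t, Z t)) Q :=
    (hΦ.comp hXZ).aestronglyMeasurable
  refine ⟨⟨hm, ?_⟩, ?_⟩
  · rw [hasFiniteIntegral_iff_ofReal (Filter.Eventually.of_forall fun t => hΦ0 _)]
    exact h1.trans_lt hΨfin.lt_top
  · rw [integral_eq_lintegral_of_nonneg_ae (Filter.Eventually.of_forall fun t => hΦ0 _) hm,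
      integral_eq_lintegral_of_nonneg_ae (Filter.Eventually.of_forall hΨ0) hΨ.1]
    exact ENNReal.toReal_mono hΨfin h1

section Trajectory

variable {n p : ℕ} {P : StochasticProblem.{u} n p} {K : RandomMap.{v} p} {G : WeightedGraph n}
  {a : AlgParams n} {Ω : Type w} {N : ℕ → Ω → Noise P K}

/-- The state after `k` iterations is a function of the randomness of these iterations. -/
lemma measurable_algState_history (x₀ : Fin n → Vec p) (k : ℕ) :
    Measurable[⨆ j ∈ Set.Iio k, MeasurableSpace.comap (N j) inferInstance]
      fun t => algState G P K a x₀ (fun j => N j t) k := by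
  induction k with
  | zero => exact measurable_const
  | succ k ih =>
    have h1 : Measurable[⨆ j ∈ Set.Iio (k + 1), MeasurableSpace.comap (N j) inferInstance]
        fun t => algState G P K a x₀ (fun j => N j t) k :=
      ih.mono (biSup_mono fun j hj => Nat.lt_succ_of_lt hj) le_rfl
    have h2 : Measurable[⨆ j ∈ Set.Iio (k + 1), MeasurableSpace.comap (N j) inferInstance]
        (N k) :=
      (comap_measurable (N k)).mono
        (le_biSup (fun j => MeasurableSpace.comap (N j) inferInstance)
          (show k ∈ Set.Iio (k + 1) from Nat.lt_succ_self k)) le_rfl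
    have h3 := (measurable_algStep G P K a k).comp (h1.prodMk h2)
    rw [Function.comp_def] at h3
    exact h3

variable [MeasurableSpace Ω] {Q : Measure Ω}

lemma measurable_algState (hN : ∀ k, Measurable (N k)) (x₀ : Fin n → Vec p) (k : ℕ) :
    Measurable fun t => algState G P K a x₀ (fun j => N j t) k :=
  (measurable_algState_history x₀ k).mono
    (iSup₂_le fun j _ => (hN j).comap_le) le_rfl

lemma indepFun_algState (hN : ∀ k, Measurable (N k)) (hind : iIndepFun N Q)
    (x₀ : Fin n → Vec p) (k : ℕ) :
    IndepFun (fun t => algState G P K a x₀ (fun j => N j t) k) (N k) Q := by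
  have h := indep_iSup_of_disjoint (fun j => (hN j).comap_le) hind.iIndep
    (S := Set.Iio k) (T := {k}) (by simp)
  rw [IndepFun_iff_Indep]
  refine indep_of_indep_of_le_left (indep_of_indep_of_le_right h ?_)
    (measurable_algState_history x₀ k).comap_le
  simp

/-- Average consensus error of a state. -/
noncomputable def consensusError (s : AgentState n p) : ℝ := (n : ℝ)⁻¹ * ‖deviation s.x‖ ^ 2

/-- Optimality gap of the average of a state. -/
noncomputable def optGap (P : StochasticProblem.{u} n p) (s : AgentState n p) : ℝ :=
  P.cost (meanVec s.x) - P.costInf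

/-- Energy per agent of a state. -/
noncomputable def meanEnergy (G : WeightedGraph n) (b lo : ℝ) (s : AgentState n p) : ℝ :=
  (n : ℝ)⁻¹ * stateEnergy G b lo s

lemma consensusError_le_meanEnergy {b lo hi : ℝ} (hn : 0 < n) (hb : 0 < b) (hlo : 0 < lo)
    (hG : G.Connected) (hspec : spectrum ℝ G.laplacian ⊆ insert 0 (Set.Icc lo hi))
    (s : AgentState n p) : consensusError s ≤ 4 / lo * meanEnergy G b lo s := by
  have hgap := G.spectral_gap hG hspec (sum_deviation hn s.x)
  have h : ‖deviation s.x‖ ^ 2 ≤ 4 / lo * stateEnergy G b lo s := by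
    have h1 := le_energy (L := G.lapOp p) (v := stack s.v) (u := stack fun i => s.x i - s.y i)
      hb hlo hgap
    rw [div_mul_eq_mul_div, le_div_iff₀ hlo, stateEnergy]
    nlinarith [sq_nonneg ‖stack s.v‖, sq_nonneg ‖stack fun i => s.x i - s.y i‖]
  rw [consensusError, meanEnergy, mul_left_comm]
  exact mul_le_mul_of_nonneg_left h (by positivity)

lemma stateEnergy_nonneg {b lo hi : ℝ} (hn : 0 < n) (hb : 0 < b) (hlo : 0 < lo)
    (hG : G.Connected) (hspec : spectrum ℝ G.laplacian ⊆ insert 0 (Set.Icc lo hi))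
    (s : AgentState n p) : 0 ≤ stateEnergy G b lo s := by
  refine le_trans ?_ (le_energy hb hlo (G.spectral_gap hG hspec (sum_deviation hn s.x)))
  have := (G.spectral_bounds hlo hspec (deviation s.x)).1
  positivity

/-- Expected one-step recursions of the energy and of the optimality gap along the trajectory. -/
lemma trajectory_recursion [IsProbabilityMeasure Q] {c : CostConstants}
    {κμ lo hi H b h cc δ r ν α : ℝ} (hn : 0 < n) (hp : 0 < p)
    (hG : G.Connected) (hlo : 0 < lo)
    (hspec : spectrum ℝ G.laplacian ⊆ insert 0 (Set.Icc lo hi)) (hH : 0 < H) (hhiH : |hi| ≤ H)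
    (hK : K.IsCompressor δ r) (hδ : 0 < δ) (hr : 0 < r) (hω : 0 < a.ω) (hω' : a.ω ≤ 1 / r)
    (hS : P.Smooth c.ℓ) (hℓ : 0 < c.ℓ) (hV : P.BoundedVariance c.η₁ c.σ₁) (hB : P.LowerBounded)
    (hD : P.costInf - (n : ℝ)⁻¹ * ∑ i, P.localInf i ≤ c.gap) (hPL : P.PolyakLojasiewicz ν)
    (hb : 0 < b) (hh : 0 < h) (hh1 : h ≤ 1)
    (hα : ∀ k, a.α k = α) (hα0 : 0 < α) (hβ : ∀ k, a.α k * a.β k = b * h)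
    (hγ : ∀ k, a.α k * a.γ k = h)
    (hμ : ∀ i k, 0 < a.μ i k) (hμp : ∀ i k, (p : ℝ) ^ 2 * a.μ i k ^ 2 ≤ κμ ^ 2 * p)
    (hμn : ∀ i k, a.μ i k ^ 2 ≤ κμ ^ 2 * (α * (p / n)))
    (hc : ∀ S Q W U : ℝ, 0 ≤ Q → 0 ≤ U → S ≤ (1 / lo + 1) * Q → W ≤ S →
        W - min b (crossWeight b lo) / 4 * h * Q
            + energyConst b lo H (a.ω * r * δ) * (h * ((2 * r ^ 2 + 2 * (r - 1) ^ 2) * U) + h ^ 2 * Q)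
            + (1 + a.ω * r * δ / 2) * ((1 - a.ω * r * δ) * U)
          ≤ (1 - cc) * (W + U))
    (hℓα : 2 * c.ℓ * α ≤ 1) (hpα : p * α ≤ 1)
    (hcc : energyConst b lo H (a.ω * r * δ) / h * estimatorConst c κμ * (α ^ 2 * p) * (4 / lo)
      ≤ cc / 2)
    (hN : IsNoise P K Q N) (x₀ : Fin n → Vec p) (k : ℕ) :
    (Integrable (fun t => meanEnergy G b lo (algState G P K a x₀ (fun j => N j t) k)) Q ∧
      Integrable (fun t => optGap P (algState G P K a x₀ (fun j => N j t) k)) Q) ∧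
    (∫ t, meanEnergy G b lo (algState G P K a x₀ (fun j => N j t) (k + 1)) ∂Q
      ≤ (1 - cc / 2) * ∫ t, meanEnergy G b lo (algState G P K a x₀ (fun j => N j t) k) ∂Q
        + energyConst b lo H (a.ω * r * δ) / h * estimatorConst c κμ * (α ^ 2 * p)
          * (∫ t, optGap P (algState G P K a x₀ (fun j => N j t) k) ∂Q + 1)) ∧
    (∫ t, optGap P (algState G P K a x₀ (fun j => N j t) (k + 1)) ∂Q
      ≤ (1 - α * ν) * ∫ t, optGap P (algState G P K a x₀ (fun j => N j t) k) ∂Q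
        + descentConst c κμ * (α ^ 2 * (p / n))
          * (∫ t, optGap P (algState G P K a x₀ (fun j => N j t) k) ∂Q + 1)
        + α * (descentConst c κμ * (4 / lo))
          * ∫ t, meanEnergy G b lo (algState G P K a x₀ (fun j => N j t) k) ∂Q) := by
  have hn' : (0 : ℝ) < n := by exact_mod_cast hn
  have hgap : 0 ≤ c.gap := (StochasticProblem.gap_nonneg hB).trans hD
  have hA := estimatorConst_pos hℓ hgap κμ
  have hDC := descentConst_pos hℓ hgap κμ
  have hρ : 0 < a.ω * r * δ := by positivity
  have hC := energyConst_pos hb hlo hH hρ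
  set E := energyConst b lo H (a.ω * r * δ) / h * estimatorConst c κμ with hE
  have hE0 : 0 < E := by positivity
  set st : ℕ → Ω → AgentState n p := fun k t => algState G P K a x₀ (fun j => N j t) k with hst
  have hcons : ∀ k t, (st k t).Consistent G := fun k t => consistent_algState x₀ _ k
  have hme : ∀ s : AgentState n p, 0 ≤ meanEnergy G b lo s := fun s =>
    mul_nonneg (by positivity) (stateEnergy_nonneg hn hb hlo hG hspec s)
  have hog : ∀ s : AgentState n p, 0 ≤ optGap P s := fun s =>
    sub_nonneg.2 (StochasticProblem.costInf_le hPL.1 _)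
  have hcE : ∀ s : AgentState n p, consensusError s ≤ 4 / lo * meanEnergy G b lo s :=
    consensusError_le_meanEnergy hn hb hlo hG hspec
  -- one step from a state at which both quantities are integrable
  have hstep : ∀ k, Integrable (fun t => meanEnergy G b lo (st k t)) Q →
      Integrable (fun t => optGap P (st k t)) Q →
      (Integrable (fun t => meanEnergy G b lo (st (k + 1) t)) Q ∧
        ∫ t, meanEnergy G b lo (st (k + 1) t) ∂Q
          ≤ ∫ t, ((1 - cc / 2) * meanEnergy G b lo (st k t)
            + E * (α ^ 2 * p) * (optGap P (st k t) + 1)) ∂Q) ∧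
      (Integrable (fun t => optGap P (st (k + 1) t)) Q ∧
        ∫ t, optGap P (st (k + 1) t) ∂Q
          ≤ ∫ t, ((1 - α * ν) * optGap P (st k t)
            + descentConst c κμ * (α ^ 2 * (p / n)) * (optGap P (st k t) + 1)
            + α * (descentConst c κμ * (4 / lo)) * meanEnergy G b lo (st k t)) ∂Q) := by
    intro k hIu hId
    obtain ⟨seeds, hseedsP, hseeds, hlaw⟩ := hN.2.2 k
    change Q.map (N k) = noiseLaw P K seeds at hlaw
    have hX := measurable_algState (G := G) (a := a) hN.1 x₀ k
    have hind := indepFun_algState (G := G) (a := a) hN.1 hN.2.1 x₀ k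
    have hd := StochasticProblem.differentiable_cost hS hℓ.le
    have hmstep := measurable_algStep G P K a k
    constructor
    · have hΦ : Measurable fun t : AgentState n p × Noise P K =>
          meanEnergy G b lo (algStep G P K a k t.2 t.1) :=
        ((measurable_stateEnergy G b lo).comp hmstep).const_mul _
      refine integral_le_of_indepFun hX (hN.1 k) hind hΦ (fun t => hme _)
        ((hIu.const_mul _).add ((hId.add (integrable_const 1)).const_mul _)) fun t => ?_
      rw [hlaw]
      have h1 := integral_stateEnergy_algStep_le (seeds := seeds) hn hp hG hlo hspec hH hhiH hseeds
        hK hδ hr hω hω' hS hℓ.le hV (fun i => hμ i k) hb hh hh1 (hβ k) (hγ k) hc (hcons k t)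
      have h2 := mean_integral_estimators_sq_le (K := K) (seeds := seeds) (κμ := κμ) hn hp hS hℓ hV
        hB hD hPL.1 (fun i => hμ i k) (fun i => hμp i k) (st k t)
      refine ⟨h1.1.const_mul _, ?_⟩
      simp only [meanEnergy]
      rw [integral_const_mul]
      refine (mul_le_mul_of_nonneg_left h1.2 (by positivity : 0 ≤ (n : ℝ)⁻¹)).trans ?_
      rw [hα k]
      have h3 := mul_le_mul_of_nonneg_left h2
        (by positivity : 0 ≤ energyConst b lo H (a.ω * r * δ) / h * α ^ 2)
      have h4 := hcE (st k t)
      change _ ≤ (1 - cc / 2) * meanEnergy G b lo (st k t) + _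
      change _ ≤ energyConst b lo H (a.ω * r * δ) / h * α ^ 2
        * (p * estimatorConst c κμ * (optGap P (st k t) + consensusError (st k t) + 1)) at h3
      have h5 := mul_le_mul_of_nonneg_left h4 (by positivity : 0 ≤ E * (α ^ 2 * p))
      have h6 := mul_le_mul_of_nonneg_right hcc (hme (st k t))
      have e1 : energyConst b lo H (a.ω * r * δ) / h * α ^ 2
          * (p * estimatorConst c κμ * (optGap P (st k t) + consensusError (st k t) + 1))
          = E * (α ^ 2 * p) * (optGap P (st k t) + 1)
            + E * (α ^ 2 * p) * consensusError (st k t) := by rw [hE]; ring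
      have e2 : (n : ℝ)⁻¹ * ((1 - cc) * stateEnergy G b lo (st k t))
          = (1 - cc) * meanEnergy G b lo (st k t) := by rw [meanEnergy]; ring
      change (n : ℝ)⁻¹ * ((1 - cc) * stateEnergy G b lo (st k t) + _) ≤ _
      rw [mul_add, e2]
      linarith
    · have hΦ : Measurable fun t : AgentState n p × Noise P K =>
          optGap P (algStep G P K a k t.2 t.1) :=
        (hd.continuous.measurable.comp (measurable_meanVec.comp
          (AgentState.measurable_x.comp hmstep))).sub_const _
      refine integral_le_of_indepFun hX (hN.1 k) hind hΦ (fun t => hog _)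
        (((hId.const_mul _).add ((hId.add (integrable_const 1)).const_mul _)).add
          (hIu.const_mul _)) fun t => ?_
      rw [hlaw]
      have h1 := integral_cost_algStep_le (K := K) (seeds := seeds) (κμ := κμ) hn hp hS hℓ hV hB hD
        hPL (hα k) hα0 hℓα hpα (fun i => hμ i k) (fun i => hμp i k) (fun i => hμn i k) (hcons k t)
      refine ⟨h1.1, h1.2.trans ?_⟩
      have h4 := mul_le_mul_of_nonneg_left (hcE (st k t))
        (by positivity : 0 ≤ α * descentConst c κμ)
      change (1 - α * ν) * optGap P (st k t) + descentConst c κμ * (α ^ 2 * (p / n))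
        * (optGap P (st k t) + 1) + α * descentConst c κμ * consensusError (st k t) ≤ _
      linarith
  have hint : ∀ k, Integrable (fun t => meanEnergy G b lo (st k t)) Q ∧
      Integrable (fun t => optGap P (st k t)) Q := fun k => by
    induction k with
    | zero =>
      exact ⟨integrable_const (meanEnergy G b lo (⟨x₀, 0, 0, 0⟩ : AgentState n p)),
        integrable_const (optGap P (⟨x₀, 0, 0, 0⟩ : AgentState n p))⟩
    | succ k ih => exact ⟨(hstep k ih.1 ih.2).1.1, (hstep k ih.1 ih.2).2.1⟩
  obtain ⟨hIu, hId⟩ := hint k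
  refine ⟨⟨hIu, hId⟩, (hstep k hIu hId).1.2.trans (le_of_eq ?_),
    (hstep k hIu hId).2.2.trans (le_of_eq ?_)⟩
  · have j1 : Integrable (fun t => optGap P (st k t) + 1) Q := hId.add (integrable_const 1)
    rw [integral_add (hIu.const_mul _) (j1.const_mul _), integral_const_mul, integral_const_mul,
      integral_add hId (integrable_const 1)]
    simp [hst]
  · have j1 : Integrable (fun t => optGap P (st k t) + 1) Q := hId.add (integrable_const 1)
    have j2 : Integrable (fun t => (1 - α * ν) * optGap P (st k t)
        + descentConst c κμ * (α ^ 2 * (p / n)) * (optGap P (st k t) + 1)) Q :=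
      (hId.const_mul _).add (j1.const_mul _)
    rw [integral_add j2 (hIu.const_mul _), integral_add (hId.const_mul _) (j1.const_mul _),
      integral_const_mul, integral_const_mul, integral_const_mul,
      integral_add hId (integrable_const 1)]
    simp [hst]

end Trajectory

/-! ### The coupled recursion of energy and optimality gap -/

lemma le_of_affine_recursion {a : ℕ → ℝ} {q w : ℝ} {T : ℕ} (hq : 0 ≤ q) (hq1 : q < 1) (hw : 0 ≤ w)
    (h : ∀ k < T, a (k + 1) ≤ q * a k + w) : a T ≤ q ^ T * a 0 + w / (1 - q) := by
  have hq2 : 0 < 1 - q := sub_pos.2 hq1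
  have key : ∀ k ≤ T, a k ≤ q ^ k * a 0 + w / (1 - q) := by
    intro k
    induction k with
    | zero => intro _; have : 0 ≤ w / (1 - q) := by positivity
              simpa using this
    | succ k ih =>
      intro hk
      have h1 := mul_le_mul_of_nonneg_left (ih (by omega)) hq
      have h2 : q * (w / (1 - q)) + w = w / (1 - q) := by field_simp; ring
      calc a (k + 1) ≤ q * a k + w := h k hk
        _ ≤ q * (q ^ k * a 0 + w / (1 - q)) + w := by linarith
        _ = q ^ (k + 1) * a 0 + (q * (w / (1 - q)) + w) := by ring
        _ = _ := by rw [h2]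
  exact key T le_rfl

lemma le_exp_mul_of_recursion {a : ℕ → ℝ} {w : ℝ} (hw : 0 ≤ w)
    (h : ∀ k, a (k + 1) ≤ (1 + w) * a k) (h0 : 0 ≤ a 0) (k : ℕ) :
    a k ≤ Real.exp (k * w) * a 0 := by
  induction k with
  | zero => simp
  | succ k ih =>
    calc a (k + 1) ≤ (1 + w) * a k := h k
      _ ≤ (1 + w) * (Real.exp (k * w) * a 0) := by gcongr
      _ ≤ Real.exp w * (Real.exp (k * w) * a 0) := by
          gcongr
          linarith [Real.add_one_le_exp w]
      _ = Real.exp ((k + 1 : ℕ) * w) * a 0 := by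
          rw [← mul_assoc, ← Real.exp_add]; push_cast; ring_nf

/-- The energy `u` contracts at a rate independent of the step size `α` and is driven by the gap
`d`; the gap contracts at the slow rate `α * ν` and is driven by `α * u`. The combination
`d + α * (2 * D / c) * u` decouples the two: it first bounds the gap uniformly over the horizon, and
then decreases at the slow rate up to an error whose leading part carries the factor `1 / n`. -/
lemma coupled_recursion_le {u d : ℕ → ℝ} {c α ν B D E R Δ p n : ℝ} {T : ℕ} (hu : ∀ k, 0 ≤ u k)
    (hd : ∀ k, 0 ≤ d k) (hc : 0 < c) (hc1 : c < 1) (hα : 0 < α) (hν : 0 < ν) (hB : 0 ≤ B)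
    (hD : 0 ≤ D) (hE : 0 ≤ E) (hp : 0 ≤ p) (hn : 1 ≤ n)
    (h1 : ∀ k, u (k + 1) ≤ (1 - c) * u k + E * (α ^ 2 * p) * (d k + 1))
    (h2 : ∀ k, d (k + 1) ≤ (1 - α * ν) * d k + B * (α ^ 2 * (p / n)) * (d k + 1) + α * D * u k)
    (hαν : α * ν ≤ c / 2) (hαE : α * (2 * D / c * E) ≤ B) (hT : 2 * B * p * T * α ^ 2 ≤ 1)
    (hd0 : d 0 ≤ Δ) (hu0 : α * (2 * D / c) * u 0 ≤ R) :
    u T ≤ (1 - c) ^ T * u 0 + E * (Real.exp 1 * (Δ + R + 1)) / c * (α ^ 2 * p) ∧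
    d T ≤ (1 - α * ν) ^ T * (Δ + R)
      + (B * (Real.exp 1 * (Δ + R + 1)) / ν * (p / n * α)
        + 2 * D / c * E * (Real.exp 1 * (Δ + R + 1)) / ν * (p * α ^ 2)) := by
  set K := 2 * D / c with hKdef
  set M := Real.exp 1 * (Δ + R + 1) with hM
  have hn0 : 0 < n := by linarith
  have hK : 0 ≤ K := by positivity
  have hKc : K * c = 2 * D := by rw [hKdef]; field_simp
  have hR : 0 ≤ R := le_trans (mul_nonneg (by positivity) (hu 0)) hu0
  have hΔ : 0 ≤ Δ := (hd 0).trans hd0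
  have hM0 : 0 ≤ M := by positivity
  set e : ℕ → ℝ := fun k => d k + α * K * u k with he
  have hde : ∀ k, d k ≤ e k := fun k => le_add_of_nonneg_right (mul_nonneg (by positivity) (hu k))
  have he0 : e 0 ≤ Δ + R := add_le_add hd0 hu0
  have hrec : ∀ k, e (k + 1)
      ≤ (1 - α * ν) * e k + (B * (p / n) + α * (K * E) * p) * α ^ 2 * (d k + 1) := by
    intro k
    have h3 := mul_le_mul_of_nonneg_left (h1 k) (by positivity : 0 ≤ α * K)
    have h4 := mul_le_mul_of_nonneg_right hαν
      (mul_nonneg (by positivity : 0 ≤ α * K) (hu k))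
    have h5 : α * K * (c / 2 * u k) = α * D * u k := by
      linear_combination α * u k / 2 * hKc
    simp only [he]
    linarith [h2 k]
  have hpn : p / n ≤ p := div_le_self hp hn
  have hgrow : ∀ k, e (k + 1) + 1 ≤ (1 + 2 * B * p * α ^ 2) * (e k + 1) := by
    intro k
    have he' : 0 ≤ e k := (hd k).trans (hde k)
    have h3 : (B * (p / n) + α * (K * E) * p) * α ^ 2 * (d k + 1)
        ≤ (B * p + B * p) * α ^ 2 * (e k + 1) := by
      have := hd k
      have := hde k
      gcongr
    have h4 : 0 ≤ α * ν * e k := by positivity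
    linarith [hrec k]
  have hbound : ∀ k ≤ T, d k + 1 ≤ M := by
    intro k hk
    have h3 := le_exp_mul_of_recursion (a := fun k => e k + 1) (by positivity) hgrow
      (by linarith [hd 0, hde 0]) k
    have hk' : (k : ℝ) ≤ T := by exact_mod_cast hk
    have h4 : (k : ℝ) * (2 * B * p * α ^ 2) ≤ 1 := by
      have := mul_le_mul_of_nonneg_right hk' (by positivity : 0 ≤ 2 * B * p * α ^ 2)
      linarith
    calc d k + 1 ≤ e k + 1 := by linarith [hde k]
      _ ≤ Real.exp (k * (2 * B * p * α ^ 2)) * (e 0 + 1) := h3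
      _ ≤ Real.exp 1 * (Δ + R + 1) := by
          have := hd 0
          have := hde 0
          gcongr
          linarith
  constructor
  · have h3 := le_of_affine_recursion (a := u) (q := 1 - c) (w := E * (α ^ 2 * p) * M) (T := T)
      (by linarith) (by linarith) (by positivity) fun k hk => (h1 k).trans (by
        have := hbound k hk.le
        gcongr)
    refine h3.trans (le_of_eq ?_)
    rw [sub_sub_cancel]
    ring
  · have h3 := le_of_affine_recursion (a := e) (q := 1 - α * ν)
      (w := (B * (p / n) + α * (K * E) * p) * α ^ 2 * M) (T := T)
      (by linarith) (by linarith [mul_pos hα hν]) (by positivity) fun k hk => (hrec k).trans (by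
        have := hbound k hk.le
        gcongr)
    have h4 : (1 - α * ν) ^ T * e 0 ≤ (1 - α * ν) ^ T * (Δ + R) :=
      mul_le_mul_of_nonneg_left he0 (pow_nonneg (by linarith) _)
    refine (hde T).trans (h3.trans ?_)
    rw [sub_sub_cancel]
    have h5 : (B * (p / n) + α * (K * E) * p) * α ^ 2 * M / (α * ν)
        = B * M / ν * (p / n * α) + K * E * M / ν * (p * α ^ 2) := by
      field_simp
    linarith

/-! ### Asymptotics in the number of iterations -/

lemma exists_rpow_mul_exp_neg_rpow_le (θ : ℝ) {b s : ℝ} (hb : 0 < b) (hs : 0 < s) :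
    ∃ C, 0 < C ∧ ∀ T : ℕ, (T : ℝ) ^ θ * Real.exp (-b * (T : ℝ) ^ s) ≤ C := by
  have h1 := (tendsto_rpow_mul_exp_neg_mul_atTop_nhds_zero (θ / s) b hb).comp
    ((tendsto_rpow_atTop hs).comp tendsto_natCast_atTop_atTop)
  obtain ⟨C, hC⟩ := h1.bddAbove_range
  refine ⟨max C 1, by positivity, fun T => le_trans (le_of_eq ?_)
    ((hC ⟨T, rfl⟩).trans (le_max_left _ _))⟩
  simp only [Function.comp_apply]
  rw [← Real.rpow_mul T.cast_nonneg, mul_div_cancel₀ _ hs.ne']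

lemma one_sub_pow_le_exp {x : ℝ} (hx : x ≤ 1) (T : ℕ) : (1 - x) ^ T ≤ Real.exp (-(x * T)) := by
  have h := pow_le_pow_left₀ (sub_nonneg.2 hx) (Real.one_sub_le_exp_neg x) T
  refine h.trans (le_of_eq ?_)
  rw [← Real.exp_nat_mul]
  ring_nf

lemma exists_one_sub_pow_le {c θ : ℝ} (hc : 0 < c) (hc1 : c ≤ 1) :
    ∃ C, 0 < C ∧ ∀ T : ℕ, 1 ≤ T → (1 - c) ^ T ≤ C / (T : ℝ) ^ (2 * θ) := by
  obtain ⟨C, hC, h⟩ := exists_rpow_mul_exp_neg_rpow_le (2 * θ) hc one_pos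
  refine ⟨C, hC, fun T hT => ?_⟩
  have hT' : (0 : ℝ) < T := by exact_mod_cast hT
  rw [le_div_iff₀ (by positivity), mul_comm]
  refine le_trans ?_ (h T)
  rw [Real.rpow_one, neg_mul]
  exact mul_le_mul_of_nonneg_left (one_sub_pow_le_exp hc1 T) (by positivity)

/-- The slow contraction still makes the initial error negligible, since `α * T` is of order
`T ^ (1 - θ)`. -/
lemma exists_one_sub_stepsize_pow_le {ν θ : ℝ} (hν : 0 < ν) (hθ : 0 < θ) (hθ1 : θ < 1) :
    ∃ C, 0 < C ∧ ∀ T : ℕ, 1 ≤ T → 1 / ((T : ℝ) + 1) ^ θ * ν ≤ 1 →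
      (1 - 1 / ((T : ℝ) + 1) ^ θ * ν) ^ T ≤ C / (T : ℝ) ^ (2 * θ) := by
  obtain ⟨C, hC, h⟩ := exists_rpow_mul_exp_neg_rpow_le (2 * θ) (half_pos hν) (sub_pos.2 hθ1)
  refine ⟨C, hC, fun T hT hle => ?_⟩
  have hT' : (1 : ℝ) ≤ T := by exact_mod_cast hT
  have hT0 : (0 : ℝ) < T := by linarith
  rw [le_div_iff₀ (by positivity), mul_comm]
  refine le_trans (mul_le_mul_of_nonneg_left ((one_sub_pow_le_exp hle T).trans ?_)
    (by positivity)) (h T)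
  refine Real.exp_le_exp.2 ?_
  have h1 : ((T : ℝ) + 1) ^ θ ≤ 2 * (T : ℝ) ^ θ := by
    calc ((T : ℝ) + 1) ^ θ ≤ (2 * (T : ℝ)) ^ θ :=
          Real.rpow_le_rpow (by positivity) (by linarith) hθ.le
      _ = 2 ^ θ * (T : ℝ) ^ θ := Real.mul_rpow (by norm_num) hT0.le
      _ ≤ 2 ^ (1 : ℝ) * (T : ℝ) ^ θ := by
          gcongr
          · norm_num
      _ = _ := by rw [Real.rpow_one]
  have h2 : (T : ℝ) ^ (1 - θ) * (T : ℝ) ^ θ = T := by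
    rw [← Real.rpow_add hT0]; simp
  have h3 : (T : ℝ) ^ (1 - θ) / 2 ≤ T / ((T : ℝ) + 1) ^ θ := by
    rw [div_le_div_iff₀ (by norm_num) (by positivity)]
    calc (T : ℝ) ^ (1 - θ) * ((T : ℝ) + 1) ^ θ ≤ (T : ℝ) ^ (1 - θ) * (2 * (T : ℝ) ^ θ) := by
          gcongr
      _ = T * 2 := by linear_combination 2 * h2
  have h4 := mul_le_mul_of_nonneg_left h3 hν.le
  have h5 : 1 / ((T : ℝ) + 1) ^ θ * ν * T = ν * (T / ((T : ℝ) + 1) ^ θ) := by ring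
  rw [h5]
  linarith

/-- The step size tends to zero and, as `θ > 1/2`, the sum of its squares over the horizon does so
as well. -/
lemma exists_horizon (X Y θ : ℝ) : ∃ κ : ℝ, 0 < κ ∧ (1 / 2 < θ → ∀ T : ℕ, κ ≤ T →
    1 ≤ T ∧ X * (1 / ((T : ℝ) + 1) ^ θ) ≤ 1 ∧ Y * T * (1 / ((T : ℝ) + 1) ^ θ) ^ 2 ≤ 1) := by
  by_cases hθ : 1 / 2 < θ
  swap
  · exact ⟨1, one_pos, fun h => absurd h hθ⟩
  have ht : Filter.Tendsto (fun T : ℕ => (T : ℝ) + 1) Filter.atTop Filter.atTop :=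
    Filter.tendsto_atTop_add_const_right _ _ tendsto_natCast_atTop_atTop
  have h1 := ((tendsto_rpow_neg_atTop (by linarith : 0 < θ)).comp ht).const_mul X
  have h2 := ((tendsto_rpow_neg_atTop (by linarith : 0 < 2 * θ - 1)).comp ht).const_mul |Y|
  rw [mul_zero] at h1 h2
  obtain ⟨N, hN⟩ := Filter.eventually_atTop.1
    ((h1.eventually (eventually_le_nhds one_pos)).and (h2.eventually (eventually_le_nhds one_pos)))
  refine ⟨N + 1, by positivity, fun _ T hT => ?_⟩
  have hT1 : N + 1 ≤ T := by exact_mod_cast hT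
  obtain ⟨h3, h4⟩ := hN T (by omega)
  have hpos : (0 : ℝ) < (T : ℝ) + 1 := by positivity
  simp only [Function.comp_apply] at h3 h4
  refine ⟨by omega, ?_, ?_⟩
  · rwa [one_div, ← Real.rpow_neg hpos.le]
  · refine le_trans ?_ h4
    have e1 : (1 / ((T : ℝ) + 1) ^ θ) ^ 2 = ((T : ℝ) + 1) ^ (-(2 * θ)) := by
      rw [one_div, ← Real.rpow_neg hpos.le, ← Real.rpow_natCast, ← Real.rpow_mul hpos.le]
      congr 1; push_cast; ring
    have e2 : ((T : ℝ) + 1) ^ (-(2 * θ - 1)) = ((T : ℝ) + 1) * ((T : ℝ) + 1) ^ (-(2 * θ)) := by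
      rw [show -(2 * θ - 1) = 1 + -(2 * θ) by ring, Real.rpow_add hpos, Real.rpow_one]
    rw [e1, e2, mul_assoc]
    refine mul_le_mul (le_abs_self Y) ?_ (by positivity) (abs_nonneg _)
    exact mul_le_mul_of_nonneg_right (by linarith) (by positivity)

/-! ### Bounds after `T` iterations -/

lemma meanEnergy_start_le {n p : ℕ} {G : WeightedGraph n} {b lo hi H : ℝ} (hn : 0 < n) (hb : 0 < b)
    (hlo : 0 < lo) (hG : G.Connected) (hspec : spectrum ℝ G.laplacian ⊆ insert 0 (Set.Icc lo hi))
    (hhiH : |hi| ≤ H) (x₀ : Fin n → Vec p) :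
    meanEnergy G b lo (⟨x₀, 0, 0, 0⟩ : AgentState n p)
      ≤ (H + 1) * ((n : ℝ)⁻¹ * ∑ i, ‖x₀ i‖ ^ 2) := by
  have h0 : stack (0 : Fin n → Vec p) = 0 := rfl
  have h1 : (stack fun i => x₀ i - (0 : Fin n → Vec p) i) = stack x₀ := by simp
  have h2 := energy_le (L := G.lapOp p) (v := stack (0 : Fin n → Vec p)) (u := stack x₀) hb hlo
    (G.spectral_gap hG hspec (sum_deviation hn x₀))
  have h3 : inner ℝ (deviation x₀) (G.lapOp p (deviation x₀)) ≤ H * ‖stack x₀‖ ^ 2 := by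
    calc inner ℝ (deviation x₀) (G.lapOp p (deviation x₀))
        ≤ ‖deviation x₀‖ * ‖G.lapOp p (deviation x₀)‖ := real_inner_le_norm _ _
      _ ≤ ‖deviation x₀‖ * (H * ‖deviation x₀‖) := by
          gcongr
          exact (G.spectral_bounds hlo hspec _).2.2.trans (by gcongr)
      _ = H * ‖deviation x₀‖ ^ 2 := by ring
      _ ≤ _ := by
          have := (abs_nonneg hi).trans hhiH
          gcongr
          exact norm_deviation_le hn x₀
  rw [meanEnergy, stateEnergy, mul_left_comm]
  refine mul_le_mul_of_nonneg_left ?_ (by positivity)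
  rw [← norm_stack_sq]
  simp only [h1]
  rw [h0, norm_zero] at h2
  rw [h0]
  linarith

section Bounds

variable {n p : ℕ} {P : StochasticProblem.{u} n p} {K : RandomMap.{v} p} {G : WeightedGraph n}
  {a : AlgParams n} {Ω : Type w} [MeasurableSpace Ω] {Q : Measure Ω}
  {N : ℕ → Ω → Noise P K}

lemma measurable_consensusError :
    Measurable (consensusError : AgentState n p → ℝ) :=
  ((measurable_deviation.comp AgentState.measurable_x).norm.pow_const 2).const_mul _

/-- Explicit bounds after `T` iterations, for step sizes that are small enough. -/
lemma expected_error_le [IsProbabilityMeasure Q] {c : CostConstants}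
    {κμ lo hi H b h cc δ r ν α Δ R E B κ : ℝ} (hn : 0 < n) (hp : 0 < p)
    (hG : G.Connected) (hlo : 0 < lo)
    (hspec : spectrum ℝ G.laplacian ⊆ insert 0 (Set.Icc lo hi)) (hH : 0 < H) (hhiH : |hi| ≤ H)
    (hK : K.IsCompressor δ r) (hδ : 0 < δ) (hr : 0 < r) (hω : 0 < a.ω) (hω' : a.ω ≤ 1 / r)
    (hS : P.Smooth c.ℓ) (hℓ : 0 < c.ℓ) (hV : P.BoundedVariance c.η₁ c.σ₁) (hB : P.LowerBounded)
    (hD : P.costInf - (n : ℝ)⁻¹ * ∑ i, P.localInf i ≤ c.gap) (hPL : P.PolyakLojasiewicz ν)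
    (hν : 0 < ν) (hb : 0 < b) (hh : 0 < h) (hh1 : h ≤ 1)
    (hα : ∀ k, a.α k = α) (hα0 : 0 < α) (hβ : ∀ k, a.α k * a.β k = b * h)
    (hγ : ∀ k, a.α k * a.γ k = h)
    (hμ : ∀ i k, 0 < a.μ i k) (hμp : ∀ i k, (p : ℝ) ^ 2 * a.μ i k ^ 2 ≤ κμ ^ 2 * p)
    (hμn : ∀ i k, a.μ i k ^ 2 ≤ κμ ^ 2 * (α * (p / n)))
    (hcc0 : 0 < cc) (hcc1 : cc < 1)
    (hc : ∀ S Q W U : ℝ, 0 ≤ Q → 0 ≤ U → S ≤ (1 / lo + 1) * Q → W ≤ S →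
        W - min b (crossWeight b lo) / 4 * h * Q
            + energyConst b lo H (a.ω * r * δ) * (h * ((2 * r ^ 2 + 2 * (r - 1) ^ 2) * U) + h ^ 2 * Q)
            + (1 + a.ω * r * δ / 2) * ((1 - a.ω * r * δ) * U)
          ≤ (1 - cc) * (W + U))
    (hE : energyConst b lo H (a.ω * r * δ) / h * estimatorConst c κμ = E)
    (hBd : descentConst c κμ = B) (hκ : 2 * (B * (4 / lo)) / (cc / 2) = κ)
    (hℓα : 2 * c.ℓ * α ≤ 1) (hpα : p * α ≤ 1) (hEα : E * (4 / lo) * α ≤ cc / 2)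
    (hνα : ν * α ≤ cc / 4) (hκα : κ * E * α ≤ B) (hHα : κ * (H + 1) * α ≤ 1)
    {T : ℕ} (hT : 2 * B * p * T * α ^ 2 ≤ 1)
    (hN : IsNoise P K Q N) (x₀ : Fin n → Vec p) (hΔ : P.cost (meanVec x₀) - P.costInf ≤ Δ)
    (hR : (n : ℝ)⁻¹ * ∑ i, ‖x₀ i‖ ^ 2 ≤ R) :
    (Integrable (fun t => consensusError (algState G P K a x₀ (fun j => N j t) T)) Q ∧
      ∫ t, consensusError (algState G P K a x₀ (fun j => N j t) T) ∂Q
        ≤ 4 / lo * ((1 - cc / 2) ^ T * ((H + 1) * R)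
          + E * (Real.exp 1 * (Δ + R + 1)) / (cc / 2) * (α ^ 2 * p))) ∧
    (Integrable (fun t => optGap P (algState G P K a x₀ (fun j => N j t) T)) Q ∧
      ∫ t, optGap P (algState G P K a x₀ (fun j => N j t) T) ∂Q
        ≤ (1 - α * ν) ^ T * (Δ + R) + (B * (Real.exp 1 * (Δ + R + 1)) / ν * (p / n * α)
          + κ * E * (Real.exp 1 * (Δ + R + 1)) / ν * (p * α ^ 2))) := by
  have hn1 : (1 : ℝ) ≤ n := by exact_mod_cast hn
  have hgap : 0 ≤ c.gap := (StochasticProblem.gap_nonneg hB).trans hD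
  have hA := estimatorConst_pos hℓ hgap κμ
  have hB0 : 0 < B := hBd ▸ descentConst_pos hℓ hgap κμ
  have hρ : 0 < a.ω * r * δ := by positivity
  have hC := energyConst_pos hb hlo hH hρ
  have hE0 : 0 < E := hE ▸ (by positivity)
  have hκ0 : 0 < κ := hκ ▸ (by positivity)
  have hEα' : E * (α ^ 2 * p) * (4 / lo) ≤ cc / 2 := by
    have h1 : E * (4 / lo) * α * (p * α) ≤ E * (4 / lo) * α * 1 :=
      mul_le_mul_of_nonneg_left hpα (by positivity)
    linarith
  have hrec := trajectory_recursion (Q := Q) (N := N) hn hp hG hlo hspec hH hhiH hK hδ hr hω hω' hS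
    hℓ hV hB hD hPL hb hh hh1 hα hα0 hβ hγ hμ hμp hμn hc hℓα hpα (hE.symm ▸ hEα') hN x₀
  rw [hE, hBd] at hrec
  have hme : ∀ s : AgentState n p, 0 ≤ meanEnergy G b lo s := fun s =>
    mul_nonneg (by positivity) (stateEnergy_nonneg hn hb hlo hG hspec s)
  have hu0 := (meanEnergy_start_le hn hb hlo hG hspec hhiH x₀).trans
    (mul_le_mul_of_nonneg_left hR (by positivity))
  have hR0 : 0 ≤ R := le_trans (by positivity) hR
  obtain ⟨h1, h2⟩ := coupled_recursion_le
    (u := fun k => ∫ t, meanEnergy G b lo (algState G P K a x₀ (fun j => N j t) k) ∂Q)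
    (d := fun k => ∫ t, optGap P (algState G P K a x₀ (fun j => N j t) k) ∂Q)
    (c := cc / 2) (α := α) (ν := ν) (B := B) (D := B * (4 / lo)) (E := E) (R := R) (Δ := Δ)
    (p := p) (n := n) (T := T) (fun k => integral_nonneg fun t => hme _)
    (fun k => integral_nonneg fun t => sub_nonneg.2 (StochasticProblem.costInf_le hPL.1 _))
    (by positivity) (by linarith) hα0 hν hB0.le (by positivity) hE0.le (by positivity) hn1
    (fun k => (hrec k).2.1) (fun k => (hrec k).2.2) (by linarith)
    (by rw [hκ]; linarith) hT
    (by simpa [algState, optGap] using hΔ) (by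
      rw [hκ]
      simp only [algState, integral_const, probReal_univ, one_smul]
      have h3 := mul_le_mul_of_nonneg_left hu0 (by positivity : 0 ≤ α * κ)
      have h4 := mul_le_mul_of_nonneg_right hHα hR0
      linarith)
  rw [hκ] at h2
  have hle : ∀ t, consensusError (algState G P K a x₀ (fun j => N j t) T)
      ≤ 4 / lo * meanEnergy G b lo (algState G P K a x₀ (fun j => N j t) T) := fun t =>
    consensusError_le_meanEnergy hn hb hlo hG hspec _
  have hI : Integrable (fun t => consensusError (algState G P K a x₀ (fun j => N j t) T)) Q := by
    refine ((hrec T).1.1.const_mul (4 / lo)).mono'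
      (measurable_consensusError.comp
        (measurable_algState hN.1 x₀ T)).aestronglyMeasurable
      (Filter.Eventually.of_forall fun t => ?_)
    rw [Real.norm_of_nonneg (by rw [consensusError]; positivity)]
    exact hle t
  refine ⟨⟨hI, ?_⟩, (hrec T).1.2, h2⟩
  calc ∫ t, consensusError (algState G P K a x₀ (fun j => N j t) T) ∂Q
      ≤ ∫ t, 4 / lo * meanEnergy G b lo (algState G P K a x₀ (fun j => N j t) T) ∂Q :=
        integral_mono hI ((hrec T).1.1.const_mul _) hle
    _ = 4 / lo * ∫ t, meanEnergy G b lo (algState G P K a x₀ (fun j => N j t) T) ∂Q :=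
        integral_const_mul _ _
    _ ≤ _ := by
        refine mul_le_mul_of_nonneg_left (h1.trans ?_) (by positivity)
        have h5 : 0 ≤ (1 - cc / 2) ^ T := pow_nonneg (by linarith) _
        simp only [algState, integral_const, probReal_univ, one_smul]
        gcongr

end Bounds

/-- The contraction rate of the communication dynamics as a function of the communication constants
and of `ε₁`, `ε₂` alone. -/
lemma exists_contraction_rate (cm : CommConstants) (ε₁ : ℝ) :
    ∃ κ, 0 < κ ∧ κ ≤ 1 ∧ ∀ ε₂, ∃ cc, 0 < cc ∧ cc < 1 ∧
      (0 < cm.lo → 0 < cm.δ → cm.δ ≤ 1 → 0 < cm.r → 0 < cm.ω → cm.ω ≤ 1 / cm.r → 0 < ε₁ →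
        0 < ε₂ → ε₂ < κ → ∀ S Q W U : ℝ, 0 ≤ Q → 0 ≤ U → S ≤ (1 / cm.lo + 1) * Q → W ≤ S →
        W - min ε₁ (crossWeight ε₁ cm.lo) / 4 * ε₂ * Q
            + energyConst ε₁ cm.lo (|cm.hi| + 1) (cm.ω * cm.r * cm.δ)
              * (ε₂ * ((2 * cm.r ^ 2 + 2 * (cm.r - 1) ^ 2) * U) + ε₂ ^ 2 * Q)
            + (1 + cm.ω * cm.r * cm.δ / 2) * ((1 - cm.ω * cm.r * cm.δ) * U)
          ≤ (1 - cc) * (W + U)) := by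
  by_cases hcm : 0 < cm.lo ∧ 0 < cm.δ ∧ cm.δ ≤ 1 ∧ 0 < cm.r ∧ 0 < cm.ω ∧ cm.ω ≤ 1 / cm.r ∧ 0 < ε₁
  · obtain ⟨hlo, hδ, hδ1, hr, hω, hω1, hε⟩ := hcm
    have hωr : cm.ω * cm.r ≤ 1 := (le_div_iff₀ hr).1 hω1
    obtain ⟨κ, hκ, hκ1, h⟩ := exists_step_threshold (H := |cm.hi| + 1) (ρ := cm.ω * cm.r * cm.δ)
      (r₀ := 2 * cm.r ^ 2 + 2 * (cm.r - 1) ^ 2) hε hlo (by positivity) (by positivity)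
      (mul_le_one₀ hωr hδ.le hδ1) (by positivity)
    refine ⟨κ, hκ, hκ1, fun ε₂ => ?_⟩
    by_cases h2 : 0 < ε₂ ∧ ε₂ < κ
    · obtain ⟨cc, h0, h1, h3⟩ := h ε₂ h2.1 h2.2
      exact ⟨cc, h0, h1, fun _ _ _ _ _ _ _ _ _ => h3⟩
    · exact ⟨1 / 2, by norm_num, by norm_num, fun _ _ _ _ _ _ _ h3 h4 => absurd ⟨h3, h4⟩ h2⟩
  · exact ⟨1, one_pos, le_rfl, fun ε₂ => ⟨1 / 2, by norm_num, by norm_num,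
      fun h1 h2 h3 h4 h5 h6 h7 _ _ => absurd ⟨h1, h2, h3, h4, h5, h6, h7⟩ hcm⟩⟩

/-! ### Choice of the constants -/

theorem theorem2 :
    -- The arguments of these functions show everything that the constants may depend on.
    -- None of the thresholds `κ₁, κ₂, κT` depends on the P–Ł constant `ν`.
    ∃ (κ₁ : (lo : ℝ) → ℝ)
      (κ₂ : CommConstants → (ℓ ε₁ : ℝ) → ℝ)
      (κT : CommConstants → CostConstants → (κμ ε₁ ε₂ θ : ℝ) → (n p : ℕ) → ℝ)
      (Ccons : CommConstants → CostConstants → InitConstants → (κμ ε₁ ε₂ θ ν : ℝ) → ℝ)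
      (Clead : CostConstants → InitConstants → (κμ θ ν : ℝ) → ℝ)
      (Chigh : CommConstants → CostConstants → InitConstants → (κμ ε₁ ε₂ θ ν : ℝ) → ℝ),
      (∀ lo, 0 < κ₁ lo) ∧ (∀ cm ℓ ε₁, 0 < κ₂ cm ℓ ε₁) ∧
      (∀ cm c κμ ε₁ ε₂ θ n p, 0 < κT cm c κμ ε₁ ε₂ θ n p) ∧
      ∀ (cm : CommConstants) (c : CostConstants) (ini : InitConstants) (κμ ε₁ ε₂ θ ν : ℝ),
        0 < cm.lo → 0 < cm.δ → cm.δ ≤ 1 → 0 < cm.r → 0 < cm.ω → cm.ω ≤ 1 / cm.r →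
        0 < c.ℓ → 0 ≤ c.η₁ → 0 ≤ c.σ₁ → 0 < ν →
        0 < κμ → κ₁ cm.lo < ε₁ → 0 < ε₂ → ε₂ < κ₂ cm c.ℓ ε₁ → 1 / 2 < θ → θ < 1 →
      ∀ (n p : ℕ), 0 < n → 0 < p →
      -- connected undirected network
      ∀ (G : WeightedGraph n), G.Connected →
        spectrum ℝ G.laplacian ⊆ insert 0 (Set.Icc cm.lo cm.hi) →
      -- compressor
      ∀ (K : RandomMap.{v} p), K.IsCompressor cm.δ cm.r →
      -- costs
      ∀ (P : StochasticProblem.{u} n p), P.LowerBounded → P.Smooth c.ℓ →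
        P.BoundedVariance c.η₁ c.σ₁ → P.PolyakLojasiewicz ν →
        P.costInf - (n : ℝ)⁻¹ * ∑ i, P.localInf i ≤ c.gap →
      -- initial point
      ∀ (x₀ : Fin n → Vec p), P.cost (meanVec x₀) - P.costInf ≤ ini.gap →
        (n : ℝ)⁻¹ * ∑ i, ‖x₀ i‖ ^ 2 ≤ ini.sqNorm →
      -- number of iterations and algorithm parameters
      ∀ (T : ℕ), κT cm c κμ ε₁ ε₂ θ n p ≤ (T : ℝ) →
      ∀ (a : AlgParams n), (∀ k, a.α k = 1 / ((T : ℝ) + 1) ^ θ) → (∀ k, a.γ k = ε₂ / a.α k) →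
        (∀ k, a.β k = ε₁ * a.γ k) →
        (∀ i k, 0 < a.μ i k ∧ a.μ i k ≤ κμ * √(p * a.α k) / √((n : ℝ) + p)) →
        a.ω = cm.ω →
      -- randomness
      ∀ (Ω : Type w) [MeasurableSpace Ω] (Q : Measure Ω) [IsProbabilityMeasure Q]
        (N : ℕ → Ω → Noise P K), IsNoise P K Q N →
      let x : Ω → Fin n → Vec p := fun s => (algState G P K a x₀ (fun k => N k s) T).x
      (Integrable (fun s => (n : ℝ)⁻¹ * ∑ i, ‖x s i - meanVec (x s)‖ ^ 2) Q ∧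
        ∫ s, (n : ℝ)⁻¹ * ∑ i, ‖x s i - meanVec (x s)‖ ^ 2 ∂Q
          ≤ Ccons cm c ini κμ ε₁ ε₂ θ ν * (p / (T : ℝ) ^ (2 * θ))) ∧
      (Integrable (fun s => P.cost (meanVec (x s)) - P.costInf) Q ∧
        ∫ s, (P.cost (meanVec (x s)) - P.costInf) ∂Q
          ≤ Clead c ini κμ θ ν * (p / (n * (T : ℝ) ^ θ))
            + Chigh cm c ini κμ ε₁ ε₂ θ ν * (p / (T : ℝ) ^ (2 * θ))) := by
  choose κ₂ hκ₂ hκ₂1 cc hcc0 hcc1 hc using exists_contraction_rate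
  choose κ hκ hhor using exists_horizon
  have hfast : ∀ c θ : ℝ, ∃ C, 0 < C ∧ (0 < c → c ≤ 1 →
      ∀ T : ℕ, 1 ≤ T → (1 - c) ^ T ≤ C / (T : ℝ) ^ (2 * θ)) := fun c θ => by
    by_cases h : 0 < c ∧ c ≤ 1
    · obtain ⟨C, hC, h'⟩ := exists_one_sub_pow_le (θ := θ) h.1 h.2
      exact ⟨C, hC, fun _ _ => h'⟩
    · exact ⟨1, one_pos, fun h1 h2 => absurd ⟨h1, h2⟩ h⟩
  have hslow : ∀ ν θ : ℝ, ∃ C, 0 < C ∧ (0 < ν → 0 < θ → θ < 1 → ∀ T : ℕ, 1 ≤ T →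
      1 / ((T : ℝ) + 1) ^ θ * ν ≤ 1 →
        (1 - 1 / ((T : ℝ) + 1) ^ θ * ν) ^ T ≤ C / (T : ℝ) ^ (2 * θ)) := fun ν θ => by
    by_cases h : 0 < ν ∧ 0 < θ ∧ θ < 1
    · obtain ⟨C, hC, h'⟩ := exists_one_sub_stepsize_pow_le h.1 h.2.1 h.2.2
      exact ⟨C, hC, fun _ _ _ => h'⟩
    · exact ⟨1, one_pos, fun h1 h2 h3 => absurd ⟨h1, h2, h3⟩ h⟩
  choose Cfast hCfast0 hCfast using hfast
  choose Cslow hCslow0 hCslow using hslow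
  let E : CommConstants → CostConstants → ℝ → ℝ → ℝ → ℝ := fun cm c κμ ε₁ ε₂ =>
    energyConst ε₁ cm.lo (|cm.hi| + 1) (cm.ω * cm.r * cm.δ) / ε₂ * estimatorConst c κμ
  let W : CommConstants → CostConstants → ℝ → ℝ → ℝ → ℝ := fun cm c κμ ε₁ ε₂ =>
    2 * (descentConst c κμ * (4 / cm.lo)) / (cc cm ε₁ ε₂ / 2)
  let M : InitConstants → ℝ := fun ini => Real.exp 1 * (ini.gap + ini.sqNorm + 1)
  -- the first argument of `κ` collects all upper bounds that the step size has to obey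
  refine ⟨fun _ => 1, fun cm _ ε₁ => κ₂ cm ε₁,
    fun cm c κμ ε₁ ε₂ θ _ p => κ (2 * c.ℓ + p + E cm c κμ ε₁ ε₂ * (4 / cm.lo) / (cc cm ε₁ ε₂ / 2)
      + c.ℓ / (cc cm ε₁ ε₂ / 4) + W cm c κμ ε₁ ε₂ * E cm c κμ ε₁ ε₂ / descentConst c κμ
      + W cm c κμ ε₁ ε₂ * (|cm.hi| + 1 + 1)) (2 * descentConst c κμ * p) θ,
    fun cm c ini κμ ε₁ ε₂ θ _ => 4 / cm.lo
      * (Cfast (cc cm ε₁ ε₂ / 2) θ * ((|cm.hi| + 1 + 1) * ini.sqNorm)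
        + E cm c κμ ε₁ ε₂ * M ini / (cc cm ε₁ ε₂ / 2)),
    fun c ini κμ _ ν => descentConst c κμ * M ini / min ν c.ℓ,
    fun cm c ini κμ ε₁ ε₂ θ ν => Cslow (min ν c.ℓ) θ * (ini.gap + ini.sqNorm)
      + W cm c κμ ε₁ ε₂ * E cm c κμ ε₁ ε₂ * M ini / min ν c.ℓ,
    fun _ => one_pos, fun cm _ ε₁ => hκ₂ cm ε₁, fun _ _ _ _ _ _ _ _ => hκ _ _ _, ?_⟩
  intro cm c ini κμ ε₁ ε₂ θ ν hlo hδ hδ1 hr hω hω1 hℓ _ _ hν _ hε₁ hε₂ hε₂κ hθ hθ1 n p hn hp G hG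
    hspec K hK P hB hS hV hPL hD x₀ hΔ hR T hT a haα haγ haβ haμ haω Ω _ Q _ N hN
  have hε₁0 : 0 < ε₁ := one_pos.trans hε₁
  have hc' := hc cm ε₁ ε₂ hlo hδ hδ1 hr hω hω1 hε₁0 hε₂ hε₂κ
  have hccpos := hcc0 cm ε₁ ε₂
  have hcclt := hcc1 cm ε₁ ε₂
  obtain ⟨hT1, hX, hY⟩ := hhor _ _ _ hθ T hT
  set E' := E cm c κμ ε₁ ε₂ with hE'
  set W' := W cm c κμ ε₁ ε₂ with hW'
  set cc' := cc cm ε₁ ε₂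
  set B := descentConst c κμ with hBdef
  set H := |cm.hi| + 1 with hH
  set α := 1 / ((T : ℝ) + 1) ^ θ with hα
  set ν' := min ν c.ℓ with hν'
  have hgap : 0 ≤ c.gap := (StochasticProblem.gap_nonneg hB).trans hD
  have hA := estimatorConst_pos hℓ hgap κμ
  have hB0 : 0 < B := descentConst_pos hℓ hgap κμ
  have hH0 : 0 < H := by positivity
  have hC := energyConst_pos (ρ := cm.ω * cm.r * cm.δ) hε₁0 hlo hH0 (by positivity)
  have hE0 : 0 < E' := by simp only [hE', E]; positivity
  have hW0 : 0 < W' := by simp only [hW', W]; positivity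
  have hα0 : 0 < α := by positivity
  have hν'0 : 0 < ν' := lt_min hν hℓ
  have hn' : (0 : ℝ) < n := by exact_mod_cast hn
  have hp1 : (1 : ℝ) ≤ p := by exact_mod_cast hp
  have hp0 : (0 : ℝ) < p := by linarith
  have hT0 : (0 : ℝ) < T := by exact_mod_cast hT1
  have hΔ0 : 0 ≤ ini.gap := (sub_nonneg.2 (StochasticProblem.costInf_le hPL.1 _)).trans hΔ
  have hR0 : 0 ≤ ini.sqNorm := le_trans (by positivity) hR
  have hM0 : 0 < M ini := by simp only [M]; positivity
  have hPL' : P.PolyakLojasiewicz ν' := ⟨hPL.1, fun x =>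
    (mul_le_mul_of_nonneg_right (min_le_left _ _)
      (sub_nonneg.2 (StochasticProblem.costInf_le hPL.1 x))).trans (hPL.2 x)⟩
  have t1 : 0 ≤ 2 * c.ℓ * α := by positivity
  have t2 : 0 ≤ p * α := by positivity
  have t3 : 0 ≤ E' * (4 / cm.lo) / (cc' / 2) * α := by positivity
  have t4 : 0 ≤ c.ℓ / (cc' / 4) * α := by positivity
  have t5 : 0 ≤ W' * E' / B * α := by positivity
  have t6 : 0 ≤ W' * (H + 1) * α := by positivity
  have hpα : p * α ≤ 1 := by linarith
  have hEα : E' * (4 / cm.lo) * α ≤ cc' / 2 := by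
    have : E' * (4 / cm.lo) / (cc' / 2) * α ≤ 1 := by linarith
    rwa [div_mul_eq_mul_div, div_le_one (by positivity)] at this
  have hℓα : c.ℓ * α ≤ cc' / 4 := by
    have : c.ℓ / (cc' / 4) * α ≤ 1 := by linarith
    rwa [div_mul_eq_mul_div, div_le_one (by positivity)] at this
  have hWα : W' * E' * α ≤ B := by
    have : W' * E' / B * α ≤ 1 := by linarith
    rwa [div_mul_eq_mul_div, div_le_one hB0] at this
  have hνα : ν' * α ≤ cc' / 4 :=
    (mul_le_mul_of_nonneg_right (min_le_right _ _) hα0.le).trans hℓα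
  -- the bound on the exploration parameters, squared
  have hμsq : ∀ i k, a.μ i k ^ 2 ≤ κμ ^ 2 * (p * α) / (n + p) := by
    intro i k
    have h1 := pow_le_pow_left₀ (haμ i k).1.le (haμ i k).2 2
    rwa [haα k, div_pow, mul_pow, Real.sq_sqrt (by positivity), Real.sq_sqrt (by positivity)] at h1
  have hμn : ∀ i k, a.μ i k ^ 2 ≤ κμ ^ 2 * (α * (p / n)) := fun i k => by
    refine (hμsq i k).trans ?_
    calc κμ ^ 2 * (p * α) / (n + p) ≤ κμ ^ 2 * (p * α) / n := by gcongr; linarith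
      _ = _ := by ring
  have hμp : ∀ i k, (p : ℝ) ^ 2 * a.μ i k ^ 2 ≤ κμ ^ 2 * p := fun i k => by
    have h1 : a.μ i k ^ 2 ≤ κμ ^ 2 * (p * α) / p :=
      (hμsq i k).trans (by gcongr; linarith)
    calc (p : ℝ) ^ 2 * a.μ i k ^ 2 ≤ (p : ℝ) ^ 2 * (κμ ^ 2 * (p * α) / p) := by gcongr
      _ = κμ ^ 2 * p * (p * α) := by field_simp
      _ ≤ κμ ^ 2 * p * 1 := by gcongr
      _ = _ := mul_one _
  have hαγ : ∀ k, a.α k * a.γ k = ε₂ := fun k => by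
    rw [haγ, haα]; field_simp
  have hαβ : ∀ k, a.α k * a.β k = ε₁ * ε₂ := fun k => by
    rw [haβ, mul_left_comm, hαγ]
  have main := expected_error_le (Q := Q) (N := N) (a := a) (H := H) (T := T) (E := E') (B := B)
    (κ := W') (ν := ν') hn hp hG hlo hspec hH0 (by simp [hH]) hK hδ hr (haω ▸ hω) (haω ▸ hω1) hS
    hℓ hV hB hD hPL' hν'0 hε₁0 hε₂ (hε₂κ.le.trans (hκ₂1 cm ε₁)) haα hα0 hαβ hαγ
    (fun i k => (haμ i k).1) hμp hμn hccpos hcclt (by rw [haω]; exact hc') (by rw [haω]) rfl rfl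
    (by linarith) hpα hEα hνα hWα (by linarith) (by linarith) hN x₀ hΔ hR
  have hfastT := hCfast (cc' / 2) θ (by positivity) (by linarith) T hT1
  have hslowT := hCslow ν' θ hν'0 (by linarith) hθ1 T hT1 (by linarith)
  have hαT : α ≤ 1 / (T : ℝ) ^ θ := by
    rw [hα]
    gcongr
    linarith
  have hαT2 : α ^ 2 ≤ 1 / (T : ℝ) ^ (2 * θ) := by
    refine (pow_le_pow_left₀ hα0.le hαT 2).trans (le_of_eq ?_)
    rw [div_pow, one_pow, ← Real.rpow_natCast, ← Real.rpow_mul hT0.le, mul_comm]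
    norm_num
  have hTp : ∀ C : ℝ, 0 ≤ C → C / (T : ℝ) ^ (2 * θ) ≤ C * (p / (T : ℝ) ^ (2 * θ)) := fun C hC => by
    rw [mul_div_assoc']
    gcongr
    exact le_mul_of_one_le_right hC hp1
  have hα2p : α ^ 2 * p ≤ p / (T : ℝ) ^ (2 * θ) := by
    calc α ^ 2 * p ≤ 1 / (T : ℝ) ^ (2 * θ) * p := by gcongr
      _ = _ := by ring
  have hαpn : p / n * α ≤ p / (n * (T : ℝ) ^ θ) := by
    calc p / n * α ≤ p / n * (1 / (T : ℝ) ^ θ) := by gcongr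
      _ = _ := by field_simp
  simp only [consensusError, norm_deviation_sq] at main
  refine ⟨⟨main.1.1, main.1.2.trans ?_⟩, main.2.1, main.2.2.trans ?_⟩
  · have h1 := hfastT.trans (hTp _ (hCfast0 _ _).le)
    calc _ ≤ 4 / cm.lo * (Cfast (cc' / 2) θ * (p / (T : ℝ) ^ (2 * θ)) * ((H + 1) * ini.sqNorm)
          + E' * M ini / (cc' / 2) * (p / (T : ℝ) ^ (2 * θ))) := by
          gcongr
      _ = _ := by ring
  · have h1 := hslowT.trans (hTp _ (hCslow0 _ _).le)
    calc _ ≤ Cslow ν' θ * (p / (T : ℝ) ^ (2 * θ)) * (ini.gap + ini.sqNorm)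
          + (B * M ini / ν' * (p / (n * (T : ℝ) ^ θ))
            + W' * E' * M ini / ν' * (p / (T : ℝ) ^ (2 * θ))) := by
          rw [mul_comm (p : ℝ) (α ^ 2)]
          gcongr
      _ = _ := by ring
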